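/- Let $m\in\mathbb N$, let $\Omega\subset\mathbb R^3$ be bounded and open with smooth or piecewise smooth boundary (that is, $\partial\Omega$ has finite area and, off a closed subset of finite length, is a $C^1$ surface with $\Omega$ locally on exactly one side), let $n=(n_1,n_2,n_3)$ be the outward unit normal, $T>0$, $Q=\Omega\times(0,T)$ with indicator function $I$, and let $f=f(u,u_x,u_y,u_z,x,y,z,t)\in\mathbb R^m$ be continuous on $\mathbb R^{4m}\times Q$. Consider the system $$u_t=f(u,u_x,u_y,u_z,x,y,z,t)\quad\text{in }Q,\qquad u|_{t=0}=A_1,\quad u|_{t=T}=A_2,\quad u|_{\partial\Omega\times(0,T)}=A_3, \qquad (1)$$ where $A_1,A_2\in L^2(\Omega;\mathbb R^m)$, $A_3\in L^2(\partial\Omega\times(0,T);\mathbb R^m)$. A solution is a function $u\in C^1(Q;\mathbb R^m)$ that satisfies the equation pointwise in $Q$ and takes the data as $L^2$ traces: $u(\cdot,t)\to A_1$ in $L^2(\Omega)$ as $t\to0^+$, $u(\cdot,t)\to A_2$ in $L^2(\Omega)$ as $t\to T^-$, and every regular boundary point, with normal $\nu$, has a neighbourhood $V$ with $u(x-s\nu,t)\to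 A_3(x,t)$ in $L^2((\partial\Omega\cap V)\times(0,T))$ as $s\to0^+$. Write $F$ for the Fourier transform $Fg(\xi)=\int g\,e^{-i(t\xi_0+x\xi_1+y\xi_2+z\xi_3)}\,dx\,dy\,dz\,dt$ and $F^{-1}$ for its inverse, in the sense of tempered distributions on $\mathbb R^4$. Say that $F^{-1}(G)$ exists, for a function $G$ defined almost everywhere, if $\int|G(\xi)|(1+|\xi|)^{-k}\,d\xi<\infty$ for some $k$. Let $A,B,C,D$ be real $m\times m$ matrices, $E$ the identity, and $$B_0=A+i\xi_1B+i\xi_2C+i\xi_3D-i\xi_0E,\quad B_1=\begin{pmatrix} i\xi_0E-A&-B&-C&-D\\ i\xi_1E&-E&0&0\\ i\xi_2E&0&-E&0\\ i\xi_3E&0&0&-E\end{pmatrix},\quad B_2=\begin{pmatrix}E\\0\\0\\0\end{pmatrix},$$ such that $F^{-1}$ of every entry of $B_0^{-1}$ exists. Let $C_0=\{\xi\in\mathbb R^4:\det B_0=0\}$, $\beta_1=(-f_0^T,-f_1^T,-f_2^T,-f_3^T)^T$, $$f_0=\int_\Omega(A_2e^{-iT\xi_0}-A_1)e^{-i(x\xi_1+y\xi_2+z\xi_3)}\,dx\,dy\,dz,\qquad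 f_k=\int_0^T\!\!\int_{\partial\Omega}A_3\,n_k\,e^{-i(t\xi_0+x\xi_1+y\xi_2+z\xi_3)}\,dS\,dt\quad(k=1,2,3),$$ $$w_1=F^{-1}\big[B_1^{-1}\beta_1(1-I_{C_0})\big],\qquad w_2=F^{-1}\big[B_1^{-1}B_2\big],$$ and, for $Z_1=(p_0,p_1,p_2,p_3):Q\to(\mathbb R^m)^4$, $\ \psi(Z_1)=f(p_0,p_1,p_2,p_3,x,y,z,t)-Ap_0-Bp_1-Cp_2-Dp_3$. Then: (i) $\det B_1=\det B_0$, the set $C_0$ has measure $0$, and $w_1$ and $w_2$ exist. (ii) For every continuous $Z_1=(p_0,p_1,p_2,p_3)$ on $Q$ with $Z_1\in L^2(Q)$ and $\psi(Z_1)\in L^2(Q)$: $u=p_0$ is a solution of (1) and $Z_1=(u,u_x,u_y,u_z)$ on $Q$, if and only if $$Z_1I=w_1+w_2*(\psi(Z_1)I)$$ as tempered distributions on $\mathbb R^4$. (iii) If for all $(\xi_1,\xi_2,\xi_3)\in\mathbb R^3$ every eigenvalue of $-(A+i\xi_1B+i\xi_2C+i\xi_3D)$ has positive real part, then on $\{t<T\}$,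 in particular on $Q$, the distribution $w_1$ does not depend on the terminal data $A_2$: it agrees there with the one obtained with $f_0=\int_\Omega(-A_1)e^{-i(x\xi_1+y\xi_2+z\xi_3)}\,dx\,dy\,dz$. -/

import Mathlib

open MeasureTheory Set Filter Topology
open scoped ENNReal Matrix SchwartzMap

namespace FirstOrderSystem

/-! ### Space, space-time, and the cylinder -/

/-- Physical space `ℝ³` with its Euclidean norm. -/
abbrev Space := EuclideanSpace ℝ (Fin 3)

/-- Space-time. A point is `((x, y, z), t)`; a frequency is `((ξ₁, ξ₂, ξ₃), ξ₀)`. -/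
abbrev SpaceTime := Space × ℝ

/-- The open cylinder `Ω × (0, T)`. -/
def cylinder (Ω : Set Space) (T : ℝ) : Set SpaceTime := Ω ×ˢ Ioo 0 T

/-! ### Domains with smooth or piecewise smooth boundary -/

/-- `ρ` is a `C¹` defining function of `Ω` near its boundary point `x`: it vanishes at `x`, its
gradient does not, and near `x` the set `Ω` is `{ρ < 0}`. So near `x` the boundary is a `C¹`
surface with `Ω` on exactly one side. -/
structure IsLocalDefiningFunction (Ω : Set Space) (x : Space) (ρ : Space → ℝ) : Prop where
  contDiffAt : ContDiffAt ℝ 1 ρ x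
  eq_zero : ρ x = 0
  gradient_ne_zero : gradient ρ x ≠ 0
  mem_iff : ∀ᶠ y in 𝓝 x, (y ∈ Ω ↔ ρ y < 0)

/-- `ν` is the outward unit normal of `Ω` at the regular boundary point `x`. -/
def IsOutwardNormal (Ω : Set Space) (x ν : Space) : Prop :=
  ∃ ρ : Space → ℝ, IsLocalDefiningFunction Ω x ρ ∧ ν = ‖gradient ρ x‖⁻¹ • gradient ρ x

open Classical in
/-- The field `n = (n₁, n₂, n₃)` of outward unit normals (`0` at points that are not regular
boundary points; the normal at a regular point does not depend on the defining function). -/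
noncomputable def outwardNormal (Ω : Set Space) (x : Space) : Space :=
  if h : ∃ ν, IsOutwardNormal Ω x ν then h.choose else 0

/-- The boundary of `Ω` is smooth or piecewise smooth: it has finite area and, away from a closed
set of finite length (the edges and corners; empty for a smooth boundary), it is a `C¹` surface
with `Ω` on one side. -/
structure HasPiecewiseSmoothBoundary (Ω : Set Space) : Prop where
  finite_area : μHE[2] (frontier Ω) < ∞
  regular : ∃ S ⊆ frontier Ω, IsClosed S ∧ μH[1] S < ∞ ∧
    ∀ x ∈ frontier Ω \ S, ∃ ρ, IsLocalDefiningFunction Ω x ρ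

/-- The surface measure `dS` times `dt`, on `∂Ω × (0, T)`. -/
noncomputable def lateralMeasure (Ω : Set Space) (T : ℝ) : Measure SpaceTime :=
  ((μHE[2] : Measure Space).restrict (frontier Ω)).prod (volume.restrict (Ioo 0 T))

/-! ### The differential equation and its data -/

section Equation

variable {m : ℕ}

/-- `∂u/∂t`. -/
noncomputable def timeDeriv (u : SpaceTime → Fin m → ℝ) (p : SpaceTime) : Fin m → ℝ :=
  fderiv ℝ u p (0, 1)

/-- The partial derivative of `u` in the `k`-th space variable. -/
noncomputable def spaceDeriv (k : Fin 3) (u : SpaceTime → Fin m → ℝ) (p : SpaceTime) :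
    Fin m → ℝ :=
  fderiv ℝ u p (EuclideanSpace.single k 1, 0)

/-- `(u, u_x, u_y, u_z)`. -/
noncomputable def jet (u : SpaceTime → Fin m → ℝ) (p : SpaceTime) : Fin 4 → Fin m → ℝ :=
  ![u p, spaceDeriv 0 u p, spaceDeriv 1 u p, spaceDeriv 2 u p]

/-- `u(·, t) → g` in `L²(Ω)` as `t → t₀` within `J`. -/
def HasTimeTrace (Ω : Set Space) (u : SpaceTime → Fin m → ℝ) (t₀ : ℝ) (J : Set ℝ)
    (g : Space → Fin m → ℝ) : Prop :=
  Tendsto (fun t : ℝ => eLpNorm (fun x => u (x, t) - g x) 2 (volume.restrict Ω))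
    (𝓝[J] t₀) (𝓝 0)

/-- `u = g` on `∂Ω × (0, T)` in the sense of `L²` traces: near every regular boundary point, with
outward normal `ν`, the inner translates `u(x - sν, t)` tend to `g(x, t)` in `L²(dS dt)` as
`s → 0+`. -/
def HasLateralTrace (Ω : Set Space) (T : ℝ) (u g : SpaceTime → Fin m → ℝ) : Prop :=
  ∀ x₀ ν : Space, IsOutwardNormal Ω x₀ ν → ∃ V ∈ 𝓝 x₀,
    Tendsto (fun s : ℝ => eLpNorm (fun p : SpaceTime => u (p.1 - s • ν, p.2) - g p) 2
        (((μHE[2] : Measure Space).restrict (frontier Ω ∩ V)).prod (volume.restrict (Ioo 0 T))))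
      (𝓝[>] 0) (𝓝 0)

/-- `u` is a `C¹` solution of `u_t = f(u, u_x, u_y, u_z, x, y, z, t)` on `Ω × (0, T)` with
`u = A₁` at `t = 0`, `u = A₂` at `t = T`, and `u = A₃` on `∂Ω × (0, T)`. -/
structure IsSolution (f : (Fin 4 → Fin m → ℝ) → SpaceTime → Fin m → ℝ)
    (Ω : Set Space) (T : ℝ) (A₁ A₂ : Space → Fin m → ℝ) (A₃ : SpaceTime → Fin m → ℝ)
    (u : SpaceTime → Fin m → ℝ) : Prop where
  contDiffOn : ContDiffOn ℝ 1 u (cylinder Ω T)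
  equation : ∀ p ∈ cylinder Ω T, timeDeriv u p = f (jet u p) p
  initial : HasTimeTrace Ω u 0 (Ioi 0) A₁
  terminal : HasTimeTrace Ω u T (Iio T) A₂
  lateral : HasLateralTrace Ω T u A₃

/-- `ψ(Z₁) = f(Z₁, x, y, z, t) - A u - B u_x - C u_y - D u_z`, where `Z₁ = (u, u_x, u_y, u_z)`. -/
def psi (f : (Fin 4 → Fin m → ℝ) → SpaceTime → Fin m → ℝ) (A B C D : Matrix (Fin m) (Fin m) ℝ)
    (Z : SpaceTime → Fin 4 → Fin m → ℝ) (p : SpaceTime) : Fin m → ℝ :=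
  f (Z p) p - A *ᵥ Z p 0 - B *ᵥ Z p 1 - C *ᵥ Z p 2 - D *ᵥ Z p 3

end Equation

/-! ### Fourier transform

The convention is `F f(ξ) = ∫ f(p) exp(-i (t ξ₀ + x ξ₁ + y ξ₂ + z ξ₃)) dp`, and `F⁻¹` is its
inverse, with the factor `(2π)⁻⁴`. -/

/-- `exp(i (t ξ₀ + x ξ₁ + y ξ₂ + z ξ₃))`. -/
noncomputable def wave (p ξ : SpaceTime) : ℂ :=
  Complex.exp (Complex.I * ((inner ℝ p.1 ξ.1 + p.2 * ξ.2 : ℝ) : ℂ))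

/-- `F⁻¹ φ` for a test function `φ`. -/
noncomputable def invFourierTest (φ : SpaceTime → ℂ) (ξ : SpaceTime) : ℂ :=
  ((2 * Real.pi : ℝ) : ℂ)⁻¹ ^ 4 * ∫ p : SpaceTime, φ p * wave p ξ

/-- The function `G`, defined almost everywhere, is (locally integrable and) tempered, so that
its inverse Fourier transform exists as a tempered distribution. -/
def HasInvFourier (G : SpaceTime → ℂ) : Prop :=
  ∃ k : ℕ, Integrable (fun ξ => G ξ / (((1 + ‖ξ‖) ^ k : ℝ) : ℂ))

/-- The inverse Fourier transform of the tempered function `G`, a tempered distribution: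
`⟨F⁻¹ G, φ⟩ = ∫ G(ξ) (F⁻¹ φ)(ξ) dξ`. For a Schwartz function `φ` the integral converges
absolutely when `HasInvFourier G`. -/
noncomputable def invFourier (G : SpaceTime → ℂ) (φ : SpaceTime → ℂ) : ℂ :=
  ∫ ξ, G ξ * invFourierTest φ ξ

/-- The convolution of a tempered distribution `w` with `g · I_Q`, where `g` is integrable on the
bounded set `Q`: `⟨w ∗ (g I_Q), φ⟩ = ∫_Q g(q) ⟨w, φ(· + q)⟩ dq`. -/
noncomputable def convIndicator (w : (SpaceTime → ℂ) → ℂ) (g : SpaceTime → ℂ) (Q : Set SpaceTime)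
    (φ : SpaceTime → ℂ) : ℂ :=
  ∫ q in Q, g q * w (fun p => φ (p + q))

/-! ### The matrices `B₀`, `B₁`, `B₂`, the vector `β₁`, and the kernels `w₁`, `w₂` -/

section Symbols

variable {m : ℕ}

/-- A real matrix, regarded as a complex one. -/
def toC (M : Matrix (Fin m) (Fin m) ℝ) : Matrix (Fin m) (Fin m) ℂ := M.map Complex.ofReal

/-- `i ξ₁, i ξ₂, i ξ₃` for `k = 0, 1, 2`. -/
noncomputable def iξ (ξ : Space) (k : Fin 3) : ℂ := Complex.I * (ξ k : ℂ)

/-- `a₂ = -(A + i ξ₁ B + i ξ₂ C + i ξ₃ D)`. -/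
noncomputable def a₂ (A B C D : Matrix (Fin m) (Fin m) ℝ) (ξ : Space) :
    Matrix (Fin m) (Fin m) ℂ :=
  -(toC A + iξ ξ 0 • toC B + iξ ξ 1 • toC C + iξ ξ 2 • toC D)

/-- `B₀ = A + i ξ₁ B + i ξ₂ C + i ξ₃ D - i ξ₀ E`. -/
noncomputable def B₀ (A B C D : Matrix (Fin m) (Fin m) ℝ) (ξ : SpaceTime) :
    Matrix (Fin m) (Fin m) ℂ :=
  toC A + iξ ξ.1 0 • toC B + iξ ξ.1 1 • toC C + iξ ξ.1 2 • toC D - (Complex.I * (ξ.2 : ℂ)) • 1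

/-- The `4m × 4m` matrix `B₁`, written in `m × m` blocks. -/
noncomputable def B₁ (A B C D : Matrix (Fin m) (Fin m) ℝ) (ξ : SpaceTime) :
    Matrix (Fin 4 × Fin m) (Fin 4 × Fin m) ℂ :=
  Matrix.comp (Fin 4) (Fin 4) (Fin m) (Fin m) ℂ
    !![(Complex.I * (ξ.2 : ℂ)) • 1 - toC A, -toC B, -toC C, -toC D;
       iξ ξ.1 0 • 1, -1, 0, 0;
       iξ ξ.1 1 • 1, 0, -1, 0;
       iξ ξ.1 2 • 1, 0, 0, -1]

/-- The `4m × m` matrix `B₂ = (E, 0, 0, 0)ᵀ`. -/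
def B₂ (m : ℕ) : Matrix (Fin 4 × Fin m) (Fin m) ℂ :=
  Matrix.of fun k j => if k.1 = 0 ∧ k.2 = j then 1 else 0

/-- `f₀ = ∫_Ω (A₂ e^{-iTξ₀} - A₁) e^{-i(xξ₁+yξ₂+zξ₃)} dx dy dz`. -/
noncomputable def f₀ (Ω : Set Space) (T : ℝ) (A₁ A₂ : Space → Fin m → ℝ) (ξ : SpaceTime)
    (i : Fin m) : ℂ :=
  ∫ x in Ω, ((A₂ x i : ℂ) * wave (0, T) (-ξ) - (A₁ x i : ℂ)) * wave (x, 0) (-ξ)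

/-- `f_k = ∫_0^T ∫_{∂Ω} A₃ n_k e^{-i(tξ₀+xξ₁+yξ₂+zξ₃)} dS dt` for the `k`-th space variable. -/
noncomputable def fLateral (Ω : Set Space) (T : ℝ) (A₃ : SpaceTime → Fin m → ℝ) (k : Fin 3)
    (ξ : SpaceTime) (i : Fin m) : ℂ :=
  ∫ p, (A₃ p i : ℂ) * (outwardNormal Ω p.1 k : ℂ) * wave p (-ξ) ∂(lateralMeasure Ω T)

/-- `β₁ = (-f₀, -f₁, -f₂, -f₃)ᵀ`. -/
noncomputable def β₁ (Ω : Set Space) (T : ℝ) (A₁ A₂ : Space → Fin m → ℝ)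
    (A₃ : SpaceTime → Fin m → ℝ) (ξ : SpaceTime) : Fin 4 × Fin m → ℂ :=
  fun k => ![-f₀ Ω T A₁ A₂ ξ k.2, -fLateral Ω T A₃ 0 ξ k.2, -fLateral Ω T A₃ 1 ξ k.2,
    -fLateral Ω T A₃ 2 ξ k.2] k.1

/-- The Fourier transform `B₁⁻¹ β₁ (1 - I_{C₀})` of `w₁`, where `C₀ = {det B₀ = 0}`. -/
noncomputable def w₁Symbol (A B C D : Matrix (Fin m) (Fin m) ℝ) (Ω : Set Space) (T : ℝ)
    (A₁ A₂ : Space → Fin m → ℝ) (A₃ : SpaceTime → Fin m → ℝ) (k : Fin 4 × Fin m) :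
    SpaceTime → ℂ :=
  {ξ | (B₀ A B C D ξ).det = 0}ᶜ.indicator
    fun ξ => ((B₁ A B C D ξ)⁻¹ *ᵥ β₁ Ω T A₁ A₂ A₃ ξ) k

/-- The Fourier transform `B₁⁻¹ B₂` of `w₂`. -/
noncomputable def w₂Symbol (A B C D : Matrix (Fin m) (Fin m) ℝ) (k : Fin 4 × Fin m) (j : Fin m) :
    SpaceTime → ℂ :=
  fun ξ => ((B₁ A B C D ξ)⁻¹ * B₂ m) k j

/-- `w₁ = F⁻¹[B₁⁻¹ β₁ (1 - I_{C₀})]`, a vector of `4m` distributions. -/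
noncomputable def w₁ (A B C D : Matrix (Fin m) (Fin m) ℝ) (Ω : Set Space) (T : ℝ)
    (A₁ A₂ : Space → Fin m → ℝ) (A₃ : SpaceTime → Fin m → ℝ) (k : Fin 4 × Fin m) :
    (SpaceTime → ℂ) → ℂ :=
  invFourier (w₁Symbol A B C D Ω T A₁ A₂ A₃ k)

/-- `w₂ = F⁻¹(B₁⁻¹ B₂)`, a `4m × m` matrix of distributions. -/
noncomputable def w₂ (A B C D : Matrix (Fin m) (Fin m) ℝ) (k : Fin 4 × Fin m) (j : Fin m) :
    (SpaceTime → ℂ) → ℂ :=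
  invFourier (w₂Symbol A B C D k j)

/-- The integral equation `Z₁ I = w₁ + w₂ ∗ (ψ(Z₁) I)`, with `I` the indicator function of
`Ω × (0, T)`, as an equality of tempered distributions on space-time. -/
def IntegralEquation (f : (Fin 4 → Fin m → ℝ) → SpaceTime → Fin m → ℝ)
    (A B C D : Matrix (Fin m) (Fin m) ℝ) (Ω : Set Space) (T : ℝ)
    (A₁ A₂ : Space → Fin m → ℝ) (A₃ : SpaceTime → Fin m → ℝ)
    (Z : SpaceTime → Fin 4 → Fin m → ℝ) : Prop :=
  ∀ (k : Fin 4 × Fin m) (φ : 𝓢(SpaceTime, ℂ)),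
    ∫ p in cylinder Ω T, (Z p k.1 k.2 : ℂ) * φ p =
      w₁ A B C D Ω T A₁ A₂ A₃ k φ +
        ∑ j, convIndicator (w₂ A B C D k j) (fun q => (psi f A B C D Z q j : ℂ))
          (cylinder Ω T) φ

end Symbols

end FirstOrderSystem

namespace FirstOrderSystem

section Algebra

variable {m : ℕ}

/-- The index set of `B₁`, split into the first block and the three others. -/
def blockEquiv (m : ℕ) : Fin m ⊕ (Fin 3 × Fin m) ≃ Fin 4 × Fin m where
  toFun := Sum.elim (fun i => (0, i)) (fun p => (p.1.succ, p.2))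
  invFun p := Fin.cases (Sum.inl p.2) (fun k => Sum.inr (k, p.2)) p.1
  left_inv := by rintro (i | ⟨k, i⟩) <;> simp
  right_inv := by
    rintro ⟨k, i⟩
    induction k using Fin.cases <;> simp

theorem B₁_zero_zero (A B C D : Matrix (Fin m) (Fin m) ℝ) (ξ : SpaceTime) (i j : Fin m) :
    B₁ A B C D ξ (0, i) (0, j) =
      Complex.I * ξ.2 * (1 : Matrix (Fin m) (Fin m) ℂ) i j - toC A i j := rfl

theorem B₁_zero_succ (A B C D : Matrix (Fin m) (Fin m) ℝ) (ξ : SpaceTime) (k : Fin 3)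
    (i j : Fin m) : B₁ A B C D ξ (0, i) (k.succ, j) = - (![toC B, toC C, toC D] k) i j := by
  fin_cases k <;> rfl

theorem B₁_succ_zero (A B C D : Matrix (Fin m) (Fin m) ℝ) (ξ : SpaceTime) (k : Fin 3)
    (i j : Fin m) : B₁ A B C D ξ (k.succ, i) (0, j) =
      iξ ξ.1 k * (1 : Matrix (Fin m) (Fin m) ℂ) i j := by
  fin_cases k <;> rfl

theorem B₁_succ_succ (A B C D : Matrix (Fin m) (Fin m) ℝ) (ξ : SpaceTime) (k l : Fin 3)
    (i j : Fin m) : B₁ A B C D ξ (k.succ, i) (l.succ, j) =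
      (-1 : Matrix (Fin 3 × Fin m) (Fin 3 × Fin m) ℂ) (k, i) (l, j) := by
  have h : B₁ A B C D ξ (k.succ, i) (l.succ, j) =
      if k = l then (-1 : Matrix (Fin m) (Fin m) ℂ) i j else 0 := by
    fin_cases k <;> fin_cases l <;> rfl
  rw [h, Matrix.neg_apply, Matrix.neg_apply, Matrix.one_apply, Matrix.one_apply]
  by_cases hk : k = l <;> by_cases hi : i = j <;> simp [hk, hi]

theorem det_B₁ (A B C D : Matrix (Fin m) (Fin m) ℝ) (ξ : SpaceTime) :
    (B₁ A B C D ξ).det = (B₀ A B C D ξ).det := by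
  rw [← Matrix.det_submatrix_equiv_self (blockEquiv m)]
  have h : (B₁ A B C D ξ).submatrix (blockEquiv m) (blockEquiv m) =
      Matrix.fromBlocks (Matrix.of fun i j =>
          Complex.I * ξ.2 * (1 : Matrix (Fin m) (Fin m) ℂ) i j - toC A i j)
        (Matrix.of fun i p => - (![toC B, toC C, toC D] p.1) i p.2)
        (Matrix.of fun p j => iξ ξ.1 p.1 * (1 : Matrix (Fin m) (Fin m) ℂ) p.2 j)
        (-1) := by
    ext (i | ⟨k, i⟩) (j | ⟨l, j⟩)
    · exact B₁_zero_zero A B C D ξ i j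
    · exact B₁_zero_succ A B C D ξ l i j
    · exact B₁_succ_zero A B C D ξ k i j
    · exact B₁_succ_succ A B C D ξ k l i j
  let : Invertible (-1 : Matrix (Fin 3 × Fin m) (Fin 3 × Fin m) ℂ) := ⟨-1, by simp, by simp⟩
  rw [h, Matrix.det_fromBlocks₂₂]
  have h2 : ⅟(-1 : Matrix (Fin 3 × Fin m) (Fin 3 × Fin m) ℂ) = -1 := rfl
  have h3 : (Matrix.of fun i j =>
          Complex.I * ξ.2 * (1 : Matrix (Fin m) (Fin m) ℂ) i j - toC A i j) -
      (Matrix.of fun i (p : Fin 3 × Fin m) => - (![toC B, toC C, toC D] p.1) i p.2) *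
        ⅟(-1 : Matrix (Fin 3 × Fin m) (Fin 3 × Fin m) ℂ) *
      (Matrix.of fun (p : Fin 3 × Fin m) j =>
        iξ ξ.1 p.1 * (1 : Matrix (Fin m) (Fin m) ℂ) p.2 j) = -B₀ A B C D ξ := by
    rw [h2, Matrix.mul_neg, Matrix.mul_one]
    ext i j
    rw [Matrix.neg_mul, sub_neg_eq_add, Matrix.add_apply, Matrix.mul_apply,
      Fintype.sum_prod_type, Fin.sum_univ_three]
    simp only [Matrix.of_apply, Matrix.cons_val, neg_mul, Finset.sum_neg_distrib]
    have hs : ∀ (M : Matrix (Fin m) (Fin m) ℂ) (c : ℂ),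
        ∑ x, M i x * (c * (1 : Matrix (Fin m) (Fin m) ℂ) x j) = c * M i j := by
      intro M c
      simp [Matrix.one_apply, mul_comm]
    rw [hs, hs, hs, Matrix.neg_apply, B₀, Matrix.sub_apply, Matrix.add_apply, Matrix.add_apply,
      Matrix.add_apply, Matrix.smul_apply, Matrix.smul_apply, Matrix.smul_apply,
      Matrix.smul_apply, smul_eq_mul, smul_eq_mul, smul_eq_mul, smul_eq_mul]
    ring
  rw [h3, Matrix.det_neg, Matrix.det_neg, Matrix.det_one, mul_one, ← mul_assoc, ← pow_add,
    Fintype.card_prod, Fintype.card_fin, Fintype.card_fin,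
    show 3 * m + m = 2 * (2 * m) by ring, pow_mul, neg_one_sq, one_pow, one_mul]

/-- The rows of `B₁ X`. -/
theorem B₁_mulVec_zero (A B C D : Matrix (Fin m) (Fin m) ℝ) (ξ : SpaceTime)
    (X : Fin 4 × Fin m → ℂ) (i : Fin m) :
    (B₁ A B C D ξ *ᵥ X) (0, i) = Complex.I * ξ.2 * X (0, i) -
      (toC A *ᵥ fun j => X (0, j)) i - (toC B *ᵥ fun j => X (1, j)) i -
      (toC C *ᵥ fun j => X (2, j)) i - (toC D *ᵥ fun j => X (3, j)) i := by
  have h : (B₁ A B C D ξ *ᵥ X) (0, i) = ∑ p, B₁ A B C D ξ (0, i) p * X p := rfl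
  rw [h, Fintype.sum_prod_type, Fin.sum_univ_succ]
  simp only [B₁_zero_zero, B₁_zero_succ, Fin.sum_univ_three, sub_mul, neg_mul,
    Finset.sum_sub_distrib, Finset.sum_neg_distrib]
  have h1 : ∑ x, Complex.I * ξ.2 * (1 : Matrix (Fin m) (Fin m) ℂ) i x * X (0, x) =
      Complex.I * ξ.2 * X (0, i) := by
    simp [Matrix.one_apply]
  rw [h1]
  simp only [Matrix.mulVec, dotProduct]
  change _ - _ + - ((∑ x, toC B i x * X (1, x)) + (∑ x, toC C i x * X (2, x)) +
    (∑ x, toC D i x * X (3, x))) = _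
  ring

theorem B₁_mulVec_succ (A B C D : Matrix (Fin m) (Fin m) ℝ) (ξ : SpaceTime)
    (X : Fin 4 × Fin m → ℂ) (k : Fin 3) (i : Fin m) :
    (B₁ A B C D ξ *ᵥ X) (k.succ, i) = iξ ξ.1 k * X (0, i) - X (k.succ, i) := by
  have h : (B₁ A B C D ξ *ᵥ X) (k.succ, i) = ∑ p, B₁ A B C D ξ (k.succ, i) p * X p := rfl
  rw [h, Fintype.sum_prod_type, Fin.sum_univ_succ]
  simp only [B₁_succ_zero, B₁_succ_succ]
  have h1 : ∑ x, iξ ξ.1 k * (1 : Matrix (Fin m) (Fin m) ℂ) i x * X (0, x) =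
      iξ ξ.1 k * X (0, i) := by
    simp [Matrix.one_apply]
  have h2 : ∑ x : Fin 3, ∑ y, (-1 : Matrix (Fin 3 × Fin m) (Fin 3 × Fin m) ℂ) (k, i) (x, y) *
      X (x.succ, y) = - X (k.succ, i) := by
    rw [← Fintype.sum_prod_type (f := fun p : Fin 3 × Fin m =>
      (-1 : Matrix (Fin 3 × Fin m) (Fin 3 × Fin m) ℂ) (k, i) p * X (p.1.succ, p.2))]
    simp [Matrix.one_apply]
  rw [h1, h2, sub_eq_add_neg]

theorem B₂_mulVec (v : Fin m → ℂ) (k : Fin 4) (i : Fin m) :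
    (B₂ m *ᵥ v) (k, i) = if k = 0 then v i else 0 := by
  simp [Matrix.mulVec, dotProduct, B₂, ite_and]

theorem B₀_mulVec (A B C D : Matrix (Fin m) (Fin m) ℝ) (ξ : SpaceTime) (v : Fin m → ℂ)
    (i : Fin m) :
    (B₀ A B C D ξ *ᵥ v) i = (toC A *ᵥ v) i + iξ ξ.1 0 * (toC B *ᵥ v) i +
      iξ ξ.1 1 * (toC C *ᵥ v) i + iξ ξ.1 2 * (toC D *ᵥ v) i - Complex.I * ξ.2 * v i := by
  simp [B₀, Matrix.add_mulVec, Matrix.sub_mulVec, Matrix.smul_mulVec]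

/-- The right-hand side of the equation for the first block of `B₁⁻¹ b`. -/
def reducedRhs (B C D : Matrix (Fin m) (Fin m) ℝ) (b : Fin 4 × Fin m → ℂ) (i : Fin m) : ℂ :=
  b (0, i) - (toC B *ᵥ fun j => b (1, j)) i - (toC C *ᵥ fun j => b (2, j)) i -
    (toC D *ᵥ fun j => b (3, j)) i

theorem B₁_inv_mulVec_zero {A B C D : Matrix (Fin m) (Fin m) ℝ} {ξ : SpaceTime}
    (h : (B₀ A B C D ξ).det ≠ 0) (b : Fin 4 × Fin m → ℂ) (i : Fin m) :
    ((B₁ A B C D ξ)⁻¹ *ᵥ b) (0, i) = - ((B₀ A B C D ξ)⁻¹ *ᵥ reducedRhs B C D b) i := by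
  have h1 : IsUnit (B₁ A B C D ξ).det := by rw [det_B₁]; exact h.isUnit
  set X := (B₁ A B C D ξ)⁻¹ *ᵥ b with hX
  have hb : B₁ A B C D ξ *ᵥ X = b := by
    rw [hX, Matrix.mulVec_mulVec, Matrix.mul_nonsing_inv _ h1, Matrix.one_mulVec]
  have key : B₀ A B C D ξ *ᵥ (fun j => X (0, j)) = - reducedRhs B C D b := by
    have hk : ∀ k : Fin 3, (fun j => b (k.succ, j)) =
        iξ ξ.1 k • (fun j => X (0, j)) - fun j => X (k.succ, j) := by
      intro k
      ext j
      rw [← hb, B₁_mulVec_succ]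
      simp
    have e1 := hk 0
    have e2 := hk 1
    have e3 := hk 2
    simp only [show Fin.succ (0 : Fin 3) = 1 from rfl, show Fin.succ (1 : Fin 3) = 2 from rfl,
      show Fin.succ (2 : Fin 3) = 3 from rfl] at e1 e2 e3
    ext i
    have e0 := congrFun hb (0, i)
    rw [B₁_mulVec_zero] at e0
    rw [B₀_mulVec, Pi.neg_apply, reducedRhs, e1, e2, e3, ← e0]
    simp only [Matrix.mulVec_sub, Matrix.mulVec_smul, Pi.sub_apply, Pi.smul_apply, smul_eq_mul]
    ring
  have := congrArg (fun v => (B₀ A B C D ξ)⁻¹ *ᵥ v) key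
  simp only [Matrix.mulVec_mulVec, Matrix.nonsing_inv_mul _ h.isUnit, Matrix.one_mulVec,
    Matrix.mulVec_neg] at this
  exact congrFun this i

theorem B₁_inv_mulVec_succ {A B C D : Matrix (Fin m) (Fin m) ℝ} {ξ : SpaceTime}
    (h : (B₀ A B C D ξ).det ≠ 0) (b : Fin 4 × Fin m → ℂ) (k : Fin 3) (i : Fin m) :
    ((B₁ A B C D ξ)⁻¹ *ᵥ b) (k.succ, i) =
      iξ ξ.1 k * ((B₁ A B C D ξ)⁻¹ *ᵥ b) (0, i) - b (k.succ, i) := by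
  have h1 : IsUnit (B₁ A B C D ξ).det := by rw [det_B₁]; exact h.isUnit
  set X := (B₁ A B C D ξ)⁻¹ *ᵥ b with hX
  have hb : B₁ A B C D ξ *ᵥ X = b := by
    rw [hX, Matrix.mulVec_mulVec, Matrix.mul_nonsing_inv _ h1, Matrix.one_mulVec]
  have := congrFun hb (k.succ, i)
  rw [B₁_mulVec_succ] at this
  rw [← this]; ring

theorem B₀_eq_neg_a₂ (A B C D : Matrix (Fin m) (Fin m) ℝ) (ξ : SpaceTime) :
    B₀ A B C D ξ = -a₂ A B C D ξ.1 - (Complex.I * (ξ.2 : ℂ)) • 1 := by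
  simp [B₀, a₂]

theorem continuous_iξ (k : Fin 3) : Continuous fun ξ : SpaceTime => iξ ξ.1 k := by
  unfold iξ; fun_prop

theorem continuous_B₀ (A B C D : Matrix (Fin m) (Fin m) ℝ) : Continuous (B₀ A B C D) := by
  unfold B₀ iξ
  fun_prop

/-- The zero set `C₀` of `det B₀` is a null set. -/
theorem volume_det_B₀_eq_zero (A B C D : Matrix (Fin m) (Fin m) ℝ) :
    volume {ξ | (B₀ A B C D ξ).det = 0} = 0 := by
  have hm : MeasurableSet {ξ | (B₀ A B C D ξ).det = 0} :=
    (isClosed_singleton.preimage (continuous_B₀ A B C D).matrix_det).measurableSet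
  rw [Measure.volume_eq_prod, Measure.measure_prod_null hm]
  refine Eventually.of_forall fun x => ?_
  refine Set.Finite.measure_zero ?_ _
  have hne : (-a₂ A B C D x).charpoly ≠ 0 := (Matrix.charpoly_monic _).ne_zero
  have hfin := (-a₂ A B C D x).charpoly.roots.toFinset.finite_toSet
  refine Set.Finite.subset (hfin.preimage (f := fun t : ℝ => Complex.I * (t : ℂ)) ?_) ?_
  · intro s _ t _ hst
    simpa using hst
  · intro t ht
    simp only [Set.mem_preimage, Set.mem_ofPred_eq, B₀_eq_neg_a₂] at ht
    simp only [Set.mem_preimage, Finset.mem_coe, Multiset.mem_toFinset, Polynomial.mem_roots hne,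
      Polynomial.IsRoot.def, Matrix.eval_charpoly]
    rw [← neg_sub, Matrix.det_neg, mul_eq_zero]
    right
    rw [← ht]
    congr 1
    ext i j
    simp [Matrix.scalar_apply, Matrix.diagonal_apply, Matrix.one_apply]

end Algebra

section Tempered

theorem HasInvFourier.congr {G H : SpaceTime → ℂ} (hG : HasInvFourier G) (h : G =ᵐ[volume] H) :
    HasInvFourier H := by
  obtain ⟨k, hk⟩ := hG
  exact ⟨k, hk.congr (h.mono fun x hx => by simp [hx])⟩

theorem HasInvFourier.aestronglyMeasurable {G : SpaceTime → ℂ} (hG : HasInvFourier G) :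
    AEStronglyMeasurable G volume := by
  obtain ⟨k, hk⟩ := hG
  have : G = fun ξ => (G ξ / (((1 + ‖ξ‖) ^ k : ℝ) : ℂ)) * (((1 + ‖ξ‖) ^ k : ℝ) : ℂ) := by
    ext ξ
    rw [div_mul_cancel₀]
    norm_cast
    positivity
  rw [this]
  refine hk.aestronglyMeasurable.mul (Continuous.aestronglyMeasurable ?_)
  fun_prop

theorem HasInvFourier.mul {G P : SpaceTime → ℂ} (hG : HasInvFourier G)
    (hP : AEStronglyMeasurable P volume) {N : ℕ} {c : ℝ} (hc : ∀ ξ, ‖P ξ‖ ≤ c * (1 + ‖ξ‖) ^ N) :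
    HasInvFourier fun ξ => G ξ * P ξ := by
  have hGm := hG.aestronglyMeasurable
  obtain ⟨k, hk⟩ := hG
  refine ⟨k + N, (hk.norm.const_mul c).mono' ?_ (Eventually.of_forall fun ξ => ?_)⟩
  · simp only [div_eq_mul_inv]
    refine (hGm.mul hP).mul (Continuous.aestronglyMeasurable ?_)
    refine Continuous.inv₀ (by fun_prop) fun ξ => ?_
    norm_cast
    positivity
  · have h1 : (0 : ℝ) < 1 + ‖ξ‖ := by positivity
    have h2 : ∀ n : ℕ, ‖(((1 + ‖ξ‖) ^ n : ℝ) : ℂ)‖ = (1 + ‖ξ‖) ^ n := fun n => by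
      rw [Complex.norm_real, Real.norm_of_nonneg (by positivity)]
    rw [norm_div, norm_div, norm_mul, h2, h2, pow_add, mul_div_assoc', div_le_div_iff₀ (by positivity) (by positivity)]
    have := mul_le_mul_of_nonneg_left (hc ξ) (norm_nonneg (G ξ))
    have h3 := mul_le_mul_of_nonneg_right this (by positivity : 0 ≤ (1 + ‖ξ‖) ^ k)
    calc _ ≤ _ := h3
      _ = _ := by ring

theorem HasInvFourier.of_bound {P : SpaceTime → ℂ}
    (hP : AEStronglyMeasurable P volume) {N : ℕ} {c : ℝ} (hc : ∀ ξ, ‖P ξ‖ ≤ c * (1 + ‖ξ‖) ^ N) :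
    HasInvFourier P := by
  have h1 : HasInvFourier fun _ => 1 := by
    have hd : ((Module.finrank ℝ SpaceTime : ℕ) : ℝ) < ((Module.finrank ℝ SpaceTime + 1 : ℕ) : ℝ) := by
      norm_cast; omega
    refine ⟨Module.finrank ℝ SpaceTime + 1, ?_⟩
    have : (volume : Measure SpaceTime).IsAddHaarMeasure :=
      inferInstanceAs ((volume : Measure Space).prod (volume : Measure ℝ)).IsAddHaarMeasure
    have := (integrable_one_add_norm (μ := (volume : Measure SpaceTime)) hd).ofReal (𝕜 := ℂ)
    refine this.congr (Eventually.of_forall fun ξ => ?_)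
    simp only [one_div]
    rw [Real.rpow_neg (by positivity), Real.rpow_natCast]
    simp
  simpa using h1.mul hP hc

theorem HasInvFourier.add {G H : SpaceTime → ℂ} (hG : HasInvFourier G) (hH : HasInvFourier H) :
    HasInvFourier fun ξ => G ξ + H ξ := by
  have key : ∀ (G : SpaceTime → ℂ) (k l : ℕ),
      Integrable (fun ξ => G ξ / (((1 + ‖ξ‖) ^ k : ℝ) : ℂ)) → k ≤ l →
      Integrable (fun ξ => G ξ / (((1 + ‖ξ‖) ^ l : ℝ) : ℂ)) := by
    intro G k l hk hkl
    refine hk.norm.mono' ?_ (Eventually.of_forall fun ξ => ?_)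
    · have hGm : AEStronglyMeasurable G volume := HasInvFourier.aestronglyMeasurable ⟨k, hk⟩
      simp only [div_eq_mul_inv]
      refine hGm.mul (Continuous.aestronglyMeasurable ?_)
      refine Continuous.inv₀ (by fun_prop) fun ξ => ?_
      norm_cast
      positivity
    · rw [norm_div, norm_div]
      have h2 : ∀ n : ℕ, ‖(((1 + ‖ξ‖) ^ n : ℝ) : ℂ)‖ = (1 + ‖ξ‖) ^ n := fun n => by
        rw [Complex.norm_real, Real.norm_of_nonneg (by positivity)]
      rw [h2, h2]
      gcongr
      simp
  obtain ⟨k, hk⟩ := hG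
  obtain ⟨l, hl⟩ := hH
  refine ⟨max k l, ?_⟩
  simp only [add_div]
  exact (key G k _ hk (le_max_left _ _)).add (key H l _ hl (le_max_right _ _))

theorem HasInvFourier.const_mul {G : SpaceTime → ℂ} (hG : HasInvFourier G) (c : ℂ) :
    HasInvFourier fun ξ => c * G ξ := by
  obtain ⟨k, hk⟩ := hG
  refine ⟨k, ?_⟩
  simp only [mul_div_assoc]
  exact hk.const_mul c

theorem HasInvFourier.sum {ι : Type*} (s : Finset ι) {G : ι → SpaceTime → ℂ}
    (hG : ∀ i ∈ s, HasInvFourier (G i)) : HasInvFourier fun ξ => ∑ i ∈ s, G i ξ := by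
  classical
  induction s using Finset.induction_on with
  | empty => exact ⟨0, by simp⟩
  | insert a s ha ih =>
    simp only [Finset.sum_insert ha]
    exact (hG a (by simp)).add (ih fun i hi => hG i (by simp [hi]))

theorem HasInvFourier.iξ_mul {G : SpaceTime → ℂ} (hG : HasInvFourier G) (k : Fin 3) :
    HasInvFourier fun ξ => iξ ξ.1 k * G ξ := by
  have := hG.mul (P := fun ξ => iξ ξ.1 k) (continuous_iξ k).aestronglyMeasurable (N := 1) (c := 1)
    (fun ξ => by
      have h1 : |ξ.1 k| ≤ ‖ξ.1‖ := PiLp.norm_apply_le ξ.1 k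
      have h2 : ‖ξ.1‖ ≤ ‖ξ‖ := norm_fst_le ξ
      simp only [iξ, norm_mul, Complex.norm_I, Complex.norm_real, Real.norm_eq_abs, pow_one]
      linarith)
  simpa only [mul_comm] using this

end Tempered

section Waves

theorem norm_wave (p ξ : SpaceTime) : ‖wave p ξ‖ = 1 := by
  rw [wave, mul_comm, Complex.norm_exp_ofReal_mul_I]

theorem continuous_wave : Continuous fun q : SpaceTime × SpaceTime => wave q.1 q.2 := by
  unfold wave
  fun_prop

theorem Continuous.wave {Y : Type*} [TopologicalSpace Y] {f g : Y → SpaceTime}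
    (hf : Continuous f) (hg : Continuous g) : Continuous fun y => wave (f y) (g y) := by
  unfold FirstOrderSystem.wave
  fun_prop

theorem wave_add_left (p q ξ : SpaceTime) : wave (p + q) ξ = wave p ξ * wave q ξ := by
  rw [wave, wave, wave, ← Complex.exp_add]
  congr 1
  simp [inner_add_left, add_mul]
  ring

theorem wave_neg_left (p ξ : SpaceTime) : wave (-p) ξ = wave p (-ξ) := by
  simp [wave]

theorem wave_mul_wave_neg (p ξ : SpaceTime) : wave p ξ * wave p (-ξ) = 1 := by
  rw [← wave_neg_left, ← wave_add_left]
  simp [wave]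

variable {X : Type*} [MeasurableSpace X] {μ : Measure X} {a : X → ℂ} {ι : X → SpaceTime}

theorem integrable_mul_wave (ha : Integrable a μ) (hι : Measurable ι) (ξ : SpaceTime) :
    Integrable (fun x => a x * wave (ι x) ξ) μ := by
  refine ha.mul_bdd (c := 1) ?_ (Eventually.of_forall fun x => (norm_wave _ _).le)
  exact ((continuous_wave.comp (Continuous.prodMk_left ξ)).measurable.comp hι).aestronglyMeasurable

/-- The Fourier transform of a measure with an integrable density. -/
theorem continuous_integral_wave (ha : Integrable a μ) (hι : Measurable ι) :
    Continuous fun ξ : SpaceTime => ∫ x, a x * wave (ι x) (-ξ) ∂μ := by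
  refine continuous_of_dominated (bound := fun x => ‖a x‖)
    (fun ξ => (integrable_mul_wave ha hι (-ξ)).aestronglyMeasurable) (fun ξ => ?_) ha.norm ?_
  · exact Eventually.of_forall fun x => by simp [norm_wave]
  · refine Eventually.of_forall fun x => continuous_const.mul ?_
    exact Continuous.wave continuous_const continuous_neg

theorem norm_integral_wave_le (ξ : SpaceTime) :
    ‖∫ x, a x * wave (ι x) (-ξ) ∂μ‖ ≤ ∫ x, ‖a x‖ ∂μ := by
  refine (norm_integral_le_integral_norm _).trans (le_of_eq ?_)
  simp [norm_wave]

theorem integral_integral_wave_mul [SFinite μ] (ha : Integrable a μ) (hι : Measurable ι)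
    {η : SpaceTime → ℂ} (hη : Integrable η) :
    ∫ ξ, (∫ x, a x * wave (ι x) (-ξ) ∂μ) * η ξ =
      ∫ x, a x * (∫ ξ, η ξ * wave (ι x) (-ξ)) ∂μ := by
  have hint : Integrable (fun q : SpaceTime × X => a q.2 * wave (ι q.2) (-q.1) * η q.1)
      ((volume : Measure SpaceTime).prod μ) := by
    have h1 := (hη.mul_prod ha)
    refine (h1.mul_bdd (c := 1) (g := fun q => wave (ι q.2) (-q.1)) ?_ ?_).congr ?_
    · refine (continuous_wave.measurable.comp (Measurable.prodMk ?_ ?_)).aestronglyMeasurable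
      · exact hι.comp measurable_snd
      · exact measurable_fst.neg
    · exact Eventually.of_forall fun x => (norm_wave _ _).le
    · exact Eventually.of_forall fun x => by simp only []; ring
  simp only [← integral_mul_const, ← integral_const_mul]
  rw [integral_integral_swap hint]
  refine integral_congr_ae (Eventually.of_forall fun x => ?_)
  refine integral_congr_ae (Eventually.of_forall fun ξ => ?_)
  simp only []
  ring

end Waves
end FirstOrderSystem

namespace FirstOrderSystem

section SchwartzFourier

open scoped FourierTransform ContDiff

instance : (volume : Measure SpaceTime).IsAddHaarMeasure :=
  inferInstanceAs ((volume : Measure Space).prod (volume : Measure ℝ)).IsAddHaarMeasure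

/-- Space-time with its Euclidean norm. -/
abbrev EuclideanSpaceTime := WithLp 2 (Space × ℝ)

/-- The identification of the two models of space-time. -/
noncomputable def ofEuclidean : EuclideanSpaceTime ≃L[ℝ] SpaceTime :=
  WithLp.prodContinuousLinearEquiv 2 ℝ Space ℝ

theorem measurePreserving_ofEuclidean :
    MeasurePreserving ofEuclidean volume (volume : Measure SpaceTime) :=
  WithLp.volume_preserving_ofLp Space ℝ

/-- `ξ ↦ (2π)⁻¹ ξ`, from space-time to its Euclidean model. -/
noncomputable def frequencyScale : SpaceTime ≃L[ℝ] EuclideanSpaceTime :=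
  (ContinuousLinearEquiv.smulLeft (Units.mk0 (2 * Real.pi)⁻¹ (by positivity))).trans
    ofEuclidean.symm

theorem frequencyScale_apply (ξ : SpaceTime) :
    frequencyScale ξ = ofEuclidean.symm ((2 * Real.pi)⁻¹ • ξ) := rfl

theorem inner_frequencyScale (v : EuclideanSpaceTime) (ξ : SpaceTime) :
    2 * Real.pi * inner ℝ v (frequencyScale ξ) =
      inner ℝ (ofEuclidean v).1 ξ.1 + (ofEuclidean v).2 * ξ.2 := by
  rw [WithLp.prod_inner_apply]
  have h1 : (frequencyScale ξ).fst = (2 * Real.pi)⁻¹ • ξ.1 := rfl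
  have h2 : (frequencyScale ξ).snd = (2 * Real.pi)⁻¹ • ξ.2 := rfl
  have h3 : v.fst = (ofEuclidean v).1 := rfl
  have h4 : v.snd = (ofEuclidean v).2 := rfl
  have h1' : (WithLp.ofLp (frequencyScale ξ)).1 = (2 * Real.pi)⁻¹ • ξ.1 := rfl
  have h2' : (WithLp.ofLp (frequencyScale ξ)).2 = (2 * Real.pi)⁻¹ • ξ.2 := rfl
  have h3' : (WithLp.ofLp v).1 = (ofEuclidean v).1 := rfl
  have h4' : (WithLp.ofLp v).2 = (ofEuclidean v).2 := rfl
  rw [h1', h2', h3', h4', real_inner_smul_right, real_inner_smul_right]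
  have : inner ℝ (ofEuclidean v).2 ξ.2 = (ofEuclidean v).2 * ξ.2 := by
    simp [mul_comm]
  rw [this]
  field_simp

/-- `F⁻¹` on Schwartz functions. -/
noncomputable def invFourierSchwartz (φ : 𝓢(SpaceTime, ℂ)) : 𝓢(SpaceTime, ℂ) :=
  (((2 * Real.pi : ℝ) : ℂ)⁻¹ ^ 4) • SchwartzMap.compCLMOfContinuousLinearEquiv ℂ frequencyScale
    (𝓕⁻ (SchwartzMap.compCLMOfContinuousLinearEquiv ℂ ofEuclidean φ))

theorem coe_invFourierSchwartz (φ : 𝓢(SpaceTime, ℂ)) :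
    ⇑(invFourierSchwartz φ) = invFourierTest φ := by
  ext ξ
  rw [invFourierSchwartz, _root_.smul_apply, invFourierTest, smul_eq_mul]
  congr 1
  have h : SchwartzMap.compCLMOfContinuousLinearEquiv ℂ frequencyScale
      (𝓕⁻ (SchwartzMap.compCLMOfContinuousLinearEquiv ℂ ofEuclidean φ)) ξ =
      (𝓕⁻ (φ ∘ ofEuclidean)) (frequencyScale ξ) := by
    rw [SchwartzMap.compCLMOfContinuousLinearEquiv_apply, Function.comp_apply,
      SchwartzMap.fourierInv_coe, SchwartzMap.compCLMOfContinuousLinearEquiv_apply]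
  rw [h, Real.fourierInv_eq', ← measurePreserving_ofEuclidean.integral_comp
    ofEuclidean.toHomeomorph.measurableEmbedding]
  refine integral_congr_ae (Eventually.of_forall fun v => ?_)
  simp only [Function.comp_apply, smul_eq_mul]
  rw [inner_frequencyScale, mul_comm, wave, mul_comm Complex.I]

theorem exists_invFourierSchwartz_eq (η : 𝓢(SpaceTime, ℂ)) :
    ∃ φ, invFourierSchwartz φ = η := by
  refine ⟨SchwartzMap.compCLMOfContinuousLinearEquiv ℂ ofEuclidean.symm
    (𝓕 (SchwartzMap.compCLMOfContinuousLinearEquiv ℂ frequencyScale.symm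
      ((((2 * Real.pi : ℝ) : ℂ) ^ 4) • η))), ?_⟩
  rw [invFourierSchwartz]
  have h1 : ∀ f : 𝓢(EuclideanSpaceTime, ℂ),
      SchwartzMap.compCLMOfContinuousLinearEquiv ℂ ofEuclidean
        (SchwartzMap.compCLMOfContinuousLinearEquiv ℂ ofEuclidean.symm f) = f := by
    intro f; ext x; simp
  have h2 : ∀ f : 𝓢(SpaceTime, ℂ),
      SchwartzMap.compCLMOfContinuousLinearEquiv ℂ frequencyScale
        (SchwartzMap.compCLMOfContinuousLinearEquiv ℂ frequencyScale.symm f) = f := by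
    intro f; ext x; simp
  rw [h1, FourierTransform.fourierInv_fourier_eq, h2, smul_smul]
  have : (((2 * Real.pi : ℝ) : ℂ)⁻¹ ^ 4) * (((2 * Real.pi : ℝ) : ℂ) ^ 4) = 1 := by
    rw [← mul_pow, inv_mul_cancel₀, one_pow]
    norm_cast
    positivity
  rw [this, one_smul]

theorem finrank_spaceTime : Module.finrank ℝ SpaceTime = 4 := by
  rw [Module.finrank_prod, finrank_euclideanSpace]
  simp

/-- Fourier inversion. -/
theorem integral_invFourierTest_mul_wave (φ : 𝓢(SpaceTime, ℂ)) (p : SpaceTime) :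
    ∫ ξ, invFourierTest φ ξ * wave p (-ξ) = φ p := by
  set f := SchwartzMap.compCLMOfContinuousLinearEquiv ℂ ofEuclidean φ with hf
  have h1 : 𝓕 (𝓕⁻ f) (ofEuclidean.symm p) = φ p := by
    rw [FourierTransform.fourier_fourierInv_eq, hf]
    simp
  rw [← h1, SchwartzMap.fourier_coe, Real.fourier_eq']
  let g : SpaceTime → ℂ := fun ζ => (((2 * Real.pi : ℝ) : ℂ)⁻¹ ^ 4) *
    (Complex.exp (↑(-2 * Real.pi * inner ℝ (ofEuclidean.symm ζ) (ofEuclidean.symm p)) *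
      Complex.I) • (𝓕⁻ f) (ofEuclidean.symm ζ))
  have h2 : ∀ ξ : SpaceTime, invFourierTest φ ξ * wave p (-ξ) = g ((2 * Real.pi)⁻¹ • ξ) := by
    intro ξ
    simp only [g]
    rw [← coe_invFourierSchwartz, invFourierSchwartz, _root_.smul_apply,
      SchwartzMap.compCLMOfContinuousLinearEquiv_apply, Function.comp_apply, frequencyScale_apply,
      smul_eq_mul, smul_eq_mul, ← hf, mul_assoc, mul_comm (Complex.exp _)]
    congr 2
    rw [← frequencyScale_apply, real_inner_comm, wave]
    have := inner_frequencyScale (ofEuclidean.symm p) ξ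
    rw [ContinuousLinearEquiv.apply_symm_apply] at this
    rw [show -2 * Real.pi * inner ℝ (ofEuclidean.symm p) (frequencyScale ξ) =
      -(2 * Real.pi * inner ℝ (ofEuclidean.symm p) (frequencyScale ξ)) by ring, this]
    congr 1
    simp
    ring
  rw [integral_congr_ae (Eventually.of_forall h2)]
  rw [Measure.integral_comp_smul (volume : Measure SpaceTime) g, finrank_spaceTime,
    integral_const_mul]
  have h3 : (|((2 * Real.pi)⁻¹ ^ 4)⁻¹| : ℝ) = (2 * Real.pi) ^ 4 := by
    rw [abs_of_nonneg (by positivity), inv_pow, inv_inv]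
  rw [h3, ← measurePreserving_ofEuclidean.integral_comp
    ofEuclidean.toHomeomorph.measurableEmbedding]
  simp only [ContinuousLinearEquiv.symm_apply_apply]
  rw [Complex.real_smul, ← mul_assoc]
  have : (((2 * Real.pi) ^ 4 : ℝ) : ℂ) * (((2 * Real.pi : ℝ) : ℂ)⁻¹ ^ 4) = 1 := by
    rw [Complex.ofReal_pow, ← mul_pow, mul_inv_cancel₀, one_pow]
    norm_cast
    positivity
  rw [this, one_mul]

theorem invFourierTest_translate (φ : SpaceTime → ℂ) (q ξ : SpaceTime) :
    invFourierTest (fun p => φ (p + q)) ξ = invFourierTest φ ξ * wave q (-ξ) := by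
  rw [invFourierTest, invFourierTest, mul_assoc]
  congr 1
  rw [← integral_mul_const, ← integral_add_right_eq_self (μ := (volume : Measure SpaceTime))
    (fun p => φ p * wave p ξ * wave q (-ξ)) q]
  refine integral_congr_ae (Eventually.of_forall fun p => ?_)
  simp only []
  rw [wave_add_left, mul_assoc, mul_assoc, wave_mul_wave_neg, mul_one]

/-- The directional derivative of the phase. -/
noncomputable def phase (ξ : SpaceTime) : SpaceTime →L[ℝ] ℝ :=
  (innerSL ℝ ξ.1).comp (ContinuousLinearMap.fst ℝ Space ℝ) +
    ξ.2 • ContinuousLinearMap.snd ℝ Space ℝ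

theorem phase_apply (ξ p : SpaceTime) : phase ξ p = inner ℝ p.1 ξ.1 + p.2 * ξ.2 := by
  simp [phase, real_inner_comm, mul_comm]

theorem wave_eq (p ξ : SpaceTime) : wave p ξ = Complex.exp (Complex.I * (phase ξ p : ℂ)) := by
  rw [wave, phase_apply]

theorem hasFDerivAt_wave (p ξ : SpaceTime) :
    HasFDerivAt (fun p => wave p ξ)
      ((wave p ξ * Complex.I) • (Complex.ofRealCLM.comp (phase ξ))) p := by
  have h1 : HasFDerivAt (fun p => Complex.I * (phase ξ p : ℂ))
      (Complex.I • (Complex.ofRealCLM.comp (phase ξ))) p :=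
    ((Complex.ofRealCLM.comp (phase ξ)).hasFDerivAt).const_mul Complex.I
  have h2 := h1.cexp
  simp only [← wave_eq] at h2
  rwa [smul_smul] at h2

theorem fderiv_wave (p ξ e : SpaceTime) :
    fderiv ℝ (fun p => wave p ξ) p e = Complex.I * phase ξ e * wave p ξ := by
  rw [(hasFDerivAt_wave p ξ).fderiv]
  simp
  ring

theorem contDiff_wave (ξ : SpaceTime) : ContDiff ℝ ∞ fun p => wave p ξ := by
  simp only [wave_eq]
  have : ContDiff ℝ ∞ fun p => Complex.I * (Complex.ofRealCLM.comp (phase ξ)) p :=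
    contDiff_const.mul (Complex.ofRealCLM.comp (phase ξ)).contDiff
  exact this.cexp

theorem phase_neg (ξ p : SpaceTime) : phase (-ξ) p = - phase ξ p := by
  simp [phase_apply]; ring

theorem integrable_schwartz_mul_wave (φ : 𝓢(SpaceTime, ℂ)) (ξ : SpaceTime) :
    Integrable fun p => φ p * wave p ξ :=
  integrable_mul_wave φ.integrable measurable_id ξ

theorem invFourierTest_fderiv (φ : 𝓢(SpaceTime, ℂ)) (e ξ : SpaceTime) :
    invFourierTest (fun p => fderiv ℝ φ p e) ξ = -(Complex.I * phase ξ e) * invFourierTest φ ξ := by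
  rw [invFourierTest, invFourierTest, mul_left_comm]
  congr 1
  have hφ' : Integrable fun p => fderiv ℝ φ p e :=
    (LineDeriv.lineDerivOpCLM ℂ 𝓢(SpaceTime, ℂ) e φ).integrable
  have h := integral_mul_fderiv_eq_neg_fderiv_mul_of_integrable (μ := (volume : Measure SpaceTime))
    (f := fun p => wave p ξ) (g := φ) (v := e) ?_ ?_ ?_
    (fun p _ => (hasFDerivAt_wave p ξ).differentiableAt) (fun p _ => φ.differentiableAt)
  · simp only [fderiv_wave] at h
    calc _ = ∫ p, wave p ξ * fderiv ℝ φ p e := by simp only [mul_comm]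
      _ = _ := h
      _ = _ := by
        rw [← integral_neg, ← integral_const_mul]
        refine integral_congr_ae (Eventually.of_forall fun p => ?_)
        simp only []
        ring
  · simp only [fderiv_wave]
    refine ((integrable_schwartz_mul_wave φ ξ).const_mul (Complex.I * phase ξ e)).congr
      (Eventually.of_forall fun p => ?_)
    simp only []
    ring
  · refine (integrable_mul_wave hφ' measurable_id ξ).congr (Eventually.of_forall fun p => ?_)
    simp only [id, mul_comm]
  · refine (integrable_schwartz_mul_wave φ ξ).congr (Eventually.of_forall fun p => ?_)
    simp only [mul_comm]

theorem HasInvFourier.integrable_mul {G : SpaceTime → ℂ} (hG : HasInvFourier G)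
    (η : 𝓢(SpaceTime, ℂ)) : Integrable fun ξ => G ξ * η ξ := by
  obtain ⟨k, hk⟩ := hG
  have hb : ∃ c, ∀ ξ, ‖(((1 + ‖ξ‖) ^ k : ℝ) : ℂ) * η ξ‖ ≤ c := by
    refine ⟨2 ^ k * ((Finset.Iic (k, 0)).sup fun m => SchwartzMap.seminorm ℂ m.1 m.2) η,
      fun ξ => ?_⟩
    have := SchwartzMap.one_add_le_sup_seminorm_apply (𝕜 := ℂ) (m := (k, 0)) (k := k) (n := 0)
      le_rfl le_rfl η ξ
    rw [norm_iteratedFDeriv_zero] at this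
    rw [norm_mul, Complex.norm_real, Real.norm_of_nonneg (by positivity)]
    exact this
  obtain ⟨c, hc⟩ := hb
  refine (hk.mul_bdd (c := c) (g := fun ξ => (((1 + ‖ξ‖) ^ k : ℝ) : ℂ) * η ξ) ?_
    (Eventually.of_forall hc)).congr (Eventually.of_forall fun ξ => ?_)
  · refine Continuous.aestronglyMeasurable (Continuous.mul ?_ η.continuous)
    fun_prop
  · simp only []
    rw [← mul_assoc, div_mul_cancel₀]
    norm_cast
    positivity

theorem HasInvFourier.integrable_mul_invFourierTest {G : SpaceTime → ℂ} (hG : HasInvFourier G)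
    (φ : 𝓢(SpaceTime, ℂ)) : Integrable fun ξ => G ξ * invFourierTest φ ξ := by
  rw [← coe_invFourierSchwartz]
  exact hG.integrable_mul _

theorem integrable_invFourierTest (φ : 𝓢(SpaceTime, ℂ)) : Integrable (invFourierTest φ) := by
  rw [← coe_invFourierSchwartz]
  exact (invFourierSchwartz φ).integrable

/-- A tempered function is determined by its inverse Fourier transform. -/
theorem HasInvFourier.ae_eq {G H : SpaceTime → ℂ} (hG : HasInvFourier G) (hH : HasInvFourier H)
    (h : ∀ φ : 𝓢(SpaceTime, ℂ), invFourier G φ = invFourier H φ) : G =ᵐ[volume] H := by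
  have hloc : ∀ {G : SpaceTime → ℂ}, HasInvFourier G → LocallyIntegrable G := by
    rintro G ⟨k, hk⟩
    have hc : Continuous fun ξ : SpaceTime => (((1 + ‖ξ‖) ^ k : ℝ) : ℂ) := by fun_prop
    have := (locallyIntegrableOn_univ.2 hk.locallyIntegrable).mul_continuousOn hc.continuousOn
      isClosed_univ.isLocallyClosed
    rw [locallyIntegrableOn_univ] at this
    refine this.congr (Eventually.of_forall fun ξ => ?_)
    simp only []
    rw [div_mul_cancel₀]
    norm_cast
    positivity
  refine ae_eq_of_integral_contDiff_smul_eq (hloc hG) (hloc hH) fun g hg hgs => ?_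
  have hg' : ContDiff ℝ ∞ fun ξ => (g ξ : ℂ) := Complex.ofRealCLM.contDiff.comp hg
  have hgs' : HasCompactSupport fun ξ => (g ξ : ℂ) := hgs.comp_left (g := Complex.ofReal) rfl
  obtain ⟨φ, hφ⟩ := exists_invFourierSchwartz_eq (hgs'.toSchwartzMap hg')
  have h1 : invFourierTest φ = fun ξ => (g ξ : ℂ) := by
    rw [← coe_invFourierSchwartz, hφ]; rfl
  have := h φ
  simp only [invFourier, h1] at this
  simp only [Complex.real_smul]
  simpa only [mul_comm] using this

end SchwartzFourier
end FirstOrderSystem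

namespace FirstOrderSystem

section Symbols

variable {m : ℕ} {A B C D : Matrix (Fin m) (Fin m) ℝ}

theorem ae_det_B₀_ne_zero (A B C D : Matrix (Fin m) (Fin m) ℝ) :
    ∀ᵐ ξ, (B₀ A B C D ξ).det ≠ 0 := by
  rw [ae_iff]
  simpa using volume_det_B₀_eq_zero A B C D

/-- `B₁⁻¹ b` is tempered for bounded `b`. -/
theorem hasInvFourier_B₁_inv_mulVec
    (hB₀ : ∀ i j, HasInvFourier (fun ξ => (B₀ A B C D ξ)⁻¹ i j))
    {b : SpaceTime → Fin 4 × Fin m → ℂ} (hb : ∀ k, AEStronglyMeasurable (fun ξ => b ξ k) volume)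
    {c : ℝ} (hc : ∀ k ξ, ‖b ξ k‖ ≤ c) (k : Fin 4 × Fin m) :
    HasInvFourier fun ξ => ((B₁ A B C D ξ)⁻¹ *ᵥ b ξ) k := by
  have hb' : ∀ k, HasInvFourier fun ξ => b ξ k := fun k =>
    HasInvFourier.of_bound (hb k) (N := 0) (c := c) (by simpa using hc k)
  have hmul : ∀ i j k, HasInvFourier fun ξ => (B₀ A B C D ξ)⁻¹ i j * b ξ k := fun i j k =>
    (hB₀ i j).mul (hb k) (N := 0) (c := c) (by simpa using hc k)
  have hterm : ∀ (M : Matrix (Fin m) (Fin m) ℂ) (i j : Fin m) (l : Fin 4), HasInvFourier fun ξ =>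
      (B₀ A B C D ξ)⁻¹ i j * (M *ᵥ fun n => b ξ (l, n)) j := by
    intro M i j l
    simp only [Matrix.mulVec, dotProduct, Finset.mul_sum]
    refine HasInvFourier.sum _ fun n _ => ?_
    simpa only [mul_left_comm] using (hmul i j (l, n)).const_mul (M j n)
  have hneg : ∀ {G : SpaceTime → ℂ}, HasInvFourier G → HasInvFourier fun ξ => - G ξ := by
    intro G hG
    simpa using hG.const_mul (-1)
  have h0 : ∀ i, HasInvFourier fun ξ => ((B₁ A B C D ξ)⁻¹ *ᵥ b ξ) (0, i) := by
    intro i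
    have : HasInvFourier fun ξ => - ((B₀ A B C D ξ)⁻¹ *ᵥ reducedRhs B C D (b ξ)) i := by
      refine hneg ?_
      simp only [Matrix.mulVec, dotProduct]
      refine HasInvFourier.sum _ fun j _ => ?_
      simp only [reducedRhs, sub_eq_add_neg, mul_add, mul_neg]
      exact (((hmul i j _).add (hneg (hterm _ i j 1))).add (hneg (hterm _ i j 2))).add
        (hneg (hterm _ i j 3))
    exact this.congr ((ae_det_B₀_ne_zero A B C D).mono fun ξ hξ =>
      (B₁_inv_mulVec_zero hξ (b ξ) i).symm)
  obtain ⟨k, i⟩ := k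
  induction k using Fin.cases with
  | zero => exact h0 i
  | succ k =>
    have := ((h0 i).iξ_mul k).add (hneg (hb' (k.succ, i)))
    refine this.congr ((ae_det_B₀_ne_zero A B C D).mono fun ξ hξ => ?_)
    simp only []
    rw [B₁_inv_mulVec_succ hξ, sub_eq_add_neg]

theorem w₁Symbol_ae_eq (Ω : Set Space) (T : ℝ) (A₁ A₂ : Space → Fin m → ℝ)
    (A₃ : SpaceTime → Fin m → ℝ) (k : Fin 4 × Fin m) :
    w₁Symbol A B C D Ω T A₁ A₂ A₃ k =ᵐ[volume]
      fun ξ => ((B₁ A B C D ξ)⁻¹ *ᵥ β₁ Ω T A₁ A₂ A₃ ξ) k := by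
  filter_upwards [ae_det_B₀_ne_zero A B C D] with ξ hξ
  rw [w₁Symbol, Set.indicator_of_mem]
  exact hξ

theorem hasInvFourier_w₂Symbol (hB₀ : ∀ i j, HasInvFourier (fun ξ => (B₀ A B C D ξ)⁻¹ i j))
    (k : Fin 4 × Fin m) (j : Fin m) : HasInvFourier (w₂Symbol A B C D k j) := by
  refine hasInvFourier_B₁_inv_mulVec hB₀ (b := fun _ l => B₂ m l j)
    (fun _ => aestronglyMeasurable_const) (c := 1) (fun l ξ => ?_) k
  simp only [B₂, Matrix.of_apply]
  split_ifs <;> simp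

end Symbols

section Transforms

variable {m : ℕ}

/-- The Fourier transform of `a I_Q`. -/
noncomputable def setTransform (Q : Set SpaceTime) (a : SpaceTime → ℝ) (ξ : SpaceTime) : ℂ :=
  ∫ p in Q, (a p : ℂ) * wave p (-ξ)

variable {Q : Set SpaceTime} {a : SpaceTime → ℝ}

theorem continuous_setTransform (ha : IntegrableOn a Q) : Continuous (setTransform Q a) :=
  continuous_integral_wave ha.ofReal measurable_id

theorem norm_setTransform_le (ξ : SpaceTime) : ‖setTransform Q a ξ‖ ≤ ∫ p in Q, ‖(a p : ℂ)‖ :=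
  norm_integral_wave_le (ι := id) ξ

theorem hasInvFourier_setTransform (ha : IntegrableOn a Q) : HasInvFourier (setTransform Q a) :=
  HasInvFourier.of_bound (continuous_setTransform ha).aestronglyMeasurable (N := 0)
    (by simpa using norm_setTransform_le)

theorem invFourier_setTransform (ha : IntegrableOn a Q) (φ : 𝓢(SpaceTime, ℂ)) :
    invFourier (setTransform Q a) φ = ∫ p in Q, (a p : ℂ) * φ p := by
  have := integral_integral_wave_mul (μ := volume.restrict Q) (ι := id) (ha.ofReal (𝕜 := ℂ))
    measurable_id (integrable_invFourierTest φ)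
  simp only [id, integral_invFourierTest_mul_wave] at this
  exact this

theorem convIndicator_invFourier {G : SpaceTime → ℂ} (hG : HasInvFourier G)
    (ha : IntegrableOn a Q) (φ : 𝓢(SpaceTime, ℂ)) :
    convIndicator (invFourier G) (fun q => (a q : ℂ)) Q φ =
      invFourier (fun ξ => G ξ * setTransform Q a ξ) φ := by
  have := integral_integral_wave_mul (μ := volume.restrict Q) (ι := id) (ha.ofReal (𝕜 := ℂ))
    measurable_id (hG.integrable_mul_invFourierTest φ)
  simp only [id] at this
  simp only [convIndicator, invFourier, invFourierTest_translate, ← mul_assoc]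
  refine this.symm.trans (integral_congr_ae (Eventually.of_forall fun ξ => ?_))
  change setTransform Q a ξ * (G ξ * invFourierTest φ ξ) =
    G ξ * setTransform Q a ξ * invFourierTest φ ξ
  ring

theorem invFourier_add {G H : SpaceTime → ℂ} (hG : HasInvFourier G) (hH : HasInvFourier H)
    (φ : 𝓢(SpaceTime, ℂ)) :
    invFourier (fun ξ => G ξ + H ξ) φ = invFourier G φ + invFourier H φ := by
  simp only [invFourier, add_mul]
  exact integral_add (hG.integrable_mul_invFourierTest φ) (hH.integrable_mul_invFourierTest φ)

theorem invFourier_sum {ι : Type*} (s : Finset ι) {G : ι → SpaceTime → ℂ}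
    (hG : ∀ i ∈ s, HasInvFourier (G i)) (φ : 𝓢(SpaceTime, ℂ)) :
    invFourier (fun ξ => ∑ i ∈ s, G i ξ) φ = ∑ i ∈ s, invFourier (G i) φ := by
  simp only [invFourier, Finset.sum_mul]
  exact integral_finsetSum _ fun i hi => (hG i hi).integrable_mul_invFourierTest φ

theorem invFourier_congr {G H : SpaceTime → ℂ} (h : G =ᵐ[volume] H) (φ : SpaceTime → ℂ) :
    invFourier G φ = invFourier H φ :=
  integral_congr_ae (h.mono fun ξ hξ => by simp only [hξ])

theorem hasInvFourier_mul_setTransform {G : SpaceTime → ℂ} (hG : HasInvFourier G)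
    (ha : IntegrableOn a Q) : HasInvFourier fun ξ => G ξ * setTransform Q a ξ :=
  hG.mul (continuous_setTransform ha).aestronglyMeasurable (N := 0)
    (by simpa using norm_setTransform_le)

variable {f : (Fin 4 → Fin m → ℝ) → SpaceTime → Fin m → ℝ} {A B C D : Matrix (Fin m) (Fin m) ℝ}
  {Ω : Set Space} {T : ℝ} {A₁ A₂ : Space → Fin m → ℝ} {A₃ : SpaceTime → Fin m → ℝ}
  {Z : SpaceTime → Fin 4 → Fin m → ℝ}

/-- The integral equation, on the Fourier side. -/
theorem integralEquation_iff_ae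
    (hw₁ : ∀ k, HasInvFourier (w₁Symbol A B C D Ω T A₁ A₂ A₃ k))
    (hw₂ : ∀ k j, HasInvFourier (w₂Symbol A B C D k j))
    (hZ : ∀ k i, IntegrableOn (fun p => Z p k i) (cylinder Ω T))
    (hψ : ∀ j, IntegrableOn (fun p => psi f A B C D Z p j) (cylinder Ω T)) :
    IntegralEquation f A B C D Ω T A₁ A₂ A₃ Z ↔
      ∀ k : Fin 4 × Fin m, setTransform (cylinder Ω T) (fun p => Z p k.1 k.2) =ᵐ[volume]
        fun ξ => w₁Symbol A B C D Ω T A₁ A₂ A₃ k ξ + ∑ j, w₂Symbol A B C D k j ξ *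
          setTransform (cylinder Ω T) (fun p => psi f A B C D Z p j) ξ := by
  refine forall_congr' fun k => ?_
  have hsum : HasInvFourier fun ξ => ∑ j, w₂Symbol A B C D k j ξ *
          setTransform (cylinder Ω T) (fun p => psi f A B C D Z p j) ξ :=
    HasInvFourier.sum _ fun j _ => hasInvFourier_mul_setTransform (hw₂ k j) (hψ j)
  have key : ∀ φ : 𝓢(SpaceTime, ℂ), w₁ A B C D Ω T A₁ A₂ A₃ k φ +
        ∑ j, convIndicator (w₂ A B C D k j) (fun q => (psi f A B C D Z q j : ℂ))
          (cylinder Ω T) φ = invFourier (fun ξ => w₁Symbol A B C D Ω T A₁ A₂ A₃ k ξ +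
          ∑ j, w₂Symbol A B C D k j ξ *
          setTransform (cylinder Ω T) (fun p => psi f A B C D Z p j) ξ) φ := by
    intro φ
    rw [invFourier_add (hw₁ k) hsum, invFourier_sum _ fun j _ =>
      hasInvFourier_mul_setTransform (hw₂ k j) (hψ j)]
    congr 1
    exact Finset.sum_congr rfl fun j _ => convIndicator_invFourier (hw₂ k j) (hψ j) φ
  constructor
  · intro h
    refine (hasInvFourier_setTransform (hZ k.1 k.2)).ae_eq ((hw₁ k).add hsum) fun φ => ?_
    rw [invFourier_setTransform (hZ k.1 k.2), h φ, key]
  · intro h φ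
    rw [key, ← invFourier_congr h, invFourier_setTransform (hZ k.1 k.2)]

theorem mulVec_setTransform (M : Matrix (Fin m) (Fin m) ℝ) {z : SpaceTime → Fin m → ℝ}
    (hz : ∀ i, IntegrableOn (fun p => z p i) Q) (i : Fin m) (ξ : SpaceTime) :
    (toC M *ᵥ fun j => setTransform Q (fun p => z p j) ξ) i =
      setTransform Q (fun p => (M *ᵥ z p) i) ξ := by
  simp only [Matrix.mulVec, dotProduct, setTransform, toC, Matrix.map_apply]
  simp only [← integral_const_mul]
  rw [← integral_finsetSum]
  · refine integral_congr_ae (Eventually.of_forall fun p => ?_)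
    simp only [Complex.ofReal_sum, Complex.ofReal_mul, Finset.sum_mul, mul_assoc]
  · intro j _
    exact (integrable_mul_wave ((hz j).ofReal (𝕜 := ℂ)) measurable_id _).const_mul _

theorem setTransform_add {b : SpaceTime → ℝ} (ha : IntegrableOn a Q) (hb : IntegrableOn b Q)
    (ξ : SpaceTime) :
    setTransform Q (fun p => a p + b p) ξ = setTransform Q a ξ + setTransform Q b ξ := by
  simp only [setTransform, Complex.ofReal_add, add_mul]
  exact integral_add (integrable_mul_wave (ha.ofReal (𝕜 := ℂ)) measurable_id _)
    (integrable_mul_wave (hb.ofReal (𝕜 := ℂ)) measurable_id _)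

theorem integrableOn_mulVec (M : Matrix (Fin m) (Fin m) ℝ) {z : SpaceTime → Fin m → ℝ}
    (hz : ∀ i, IntegrableOn (fun p => z p i) Q) (i : Fin m) :
    IntegrableOn (fun p => (M *ᵥ z p) i) Q := by
  simp only [Matrix.mulVec, dotProduct]
  exact integrable_finsetSum _ fun j _ => (hz j).const_mul _

theorem apply_eq_psi_add (p : SpaceTime) (i : Fin m) :
    f (Z p) p i = psi f A B C D Z p i + (A *ᵥ Z p 0) i + (B *ᵥ Z p 1) i + (C *ᵥ Z p 2) i +
      (D *ᵥ Z p 3) i := by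
  simp only [psi, Pi.sub_apply]
  ring

/-- The integral equation, as the algebraic system `B₁ Ẑ = β₁ + B₂ ψ̂`. -/
theorem integralEquation_iff_rows
    (hw₁ : ∀ k, HasInvFourier (w₁Symbol A B C D Ω T A₁ A₂ A₃ k))
    (hw₂ : ∀ k j, HasInvFourier (w₂Symbol A B C D k j))
    (hZ : ∀ k i, IntegrableOn (fun p => Z p k i) (cylinder Ω T))
    (hψ : ∀ j, IntegrableOn (fun p => psi f A B C D Z p j) (cylinder Ω T)) :
    IntegralEquation f A B C D Ω T A₁ A₂ A₃ Z ↔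
      (∀ i, ∀ᵐ ξ : SpaceTime, setTransform (cylinder Ω T) (fun p => f (Z p) p i) ξ -
        Complex.I * ξ.2 * setTransform (cylinder Ω T) (fun p => Z p 0 i) ξ =
          f₀ Ω T A₁ A₂ ξ i) ∧
      ∀ (k : Fin 3) (i : Fin m), ∀ᵐ ξ : SpaceTime,
        setTransform (cylinder Ω T) (fun p => Z p k.succ i) ξ -
        iξ ξ.1 k * setTransform (cylinder Ω T) (fun p => Z p 0 i) ξ = fLateral Ω T A₃ k ξ i := by
  rw [integralEquation_iff_ae hw₁ hw₂ hZ hψ]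
  simp only [EventuallyEq, ← ae_all_iff, ← eventually_and]
  have hf : ∀ i ξ, setTransform (cylinder Ω T) (fun p => f (Z p) p i) ξ =
      setTransform (cylinder Ω T) (fun p => psi f A B C D Z p i) ξ +
      (toC A *ᵥ fun j => setTransform (cylinder Ω T) (fun p => Z p 0 j) ξ) i +
      (toC B *ᵥ fun j => setTransform (cylinder Ω T) (fun p => Z p 1 j) ξ) i +
      (toC C *ᵥ fun j => setTransform (cylinder Ω T) (fun p => Z p 2 j) ξ) i +
      (toC D *ᵥ fun j => setTransform (cylinder Ω T) (fun p => Z p 3 j) ξ) i := by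
    intro i ξ
    have i0 := integrableOn_mulVec A (hZ 0) i
    have i1 := integrableOn_mulVec B (hZ 1) i
    have i2 := integrableOn_mulVec C (hZ 2) i
    have i3 := integrableOn_mulVec D (hZ 3) i
    simp only [apply_eq_psi_add (A := A) (B := B) (C := C) (D := D)]
    have j0 : IntegrableOn (fun p => psi f A B C D Z p i + (A *ᵥ Z p 0) i) (cylinder Ω T) :=
      (hψ i).add i0
    have j1 : IntegrableOn (fun p => psi f A B C D Z p i + (A *ᵥ Z p 0) i + (B *ᵥ Z p 1) i)
      (cylinder Ω T) := j0.add i1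
    have j2 : IntegrableOn (fun p => psi f A B C D Z p i + (A *ᵥ Z p 0) i + (B *ᵥ Z p 1) i +
      (C *ᵥ Z p 2) i) (cylinder Ω T) := j1.add i2
    rw [setTransform_add j2 i3, setTransform_add j1 i2, setTransform_add j0 i1,
      setTransform_add (hψ i) i0, mulVec_setTransform A (hZ 0), mulVec_setTransform B (hZ 1),
      mulVec_setTransform C (hZ 2), mulVec_setTransform D (hZ 3)]
  refine eventually_congr ?_
  filter_upwards [ae_det_B₀_ne_zero A B C D] with ξ hξ
  have hu : IsUnit (B₁ A B C D ξ).det := by rw [det_B₁]; exact hξ.isUnit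
  set X : Fin 4 × Fin m → ℂ := fun k => setTransform (cylinder Ω T) (fun p => Z p k.1 k.2) ξ
    with hX
  set v : Fin m → ℂ := fun j => setTransform (cylinder Ω T) (fun p => psi f A B C D Z p j) ξ
    with hv
  have e1 : (∀ k : Fin 4 × Fin m, setTransform (cylinder Ω T) (fun p => Z p k.1 k.2) ξ =
      w₁Symbol A B C D Ω T A₁ A₂ A₃ k ξ + ∑ j, w₂Symbol A B C D k j ξ *
          setTransform (cylinder Ω T) (fun p => psi f A B C D Z p j) ξ) ↔
      B₁ A B C D ξ *ᵥ X = β₁ Ω T A₁ A₂ A₃ ξ + B₂ m *ᵥ v := by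
    have h1 : ∀ k, w₁Symbol A B C D Ω T A₁ A₂ A₃ k ξ + ∑ j, w₂Symbol A B C D k j ξ *
          setTransform (cylinder Ω T) (fun p => psi f A B C D Z p j) ξ =
        ((B₁ A B C D ξ)⁻¹ *ᵥ (β₁ Ω T A₁ A₂ A₃ ξ + B₂ m *ᵥ v)) k := by
      intro k
      rw [Matrix.mulVec_add, Matrix.mulVec_mulVec, Pi.add_apply, w₁Symbol,
        Set.indicator_of_mem (by exact hξ)]
      rfl
    simp only [h1]
    constructor
    · intro h
      have : X = (B₁ A B C D ξ)⁻¹ *ᵥ (β₁ Ω T A₁ A₂ A₃ ξ + B₂ m *ᵥ v) := funext h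
      rw [this, Matrix.mulVec_mulVec, Matrix.mul_nonsing_inv _ hu, Matrix.one_mulVec]
    · intro h k
      rw [← h, Matrix.mulVec_mulVec, Matrix.nonsing_inv_mul _ hu, Matrix.one_mulVec]
  rw [e1, funext_iff, Prod.forall]
  have hs : ∀ (k : Fin 3) i, (B₁ A B C D ξ *ᵥ X) (k.succ, i) =
      (β₁ Ω T A₁ A₂ A₃ ξ + B₂ m *ᵥ v) (k.succ, i) ↔
      setTransform (cylinder Ω T) (fun p => Z p k.succ i) ξ -
        iξ ξ.1 k * setTransform (cylinder Ω T) (fun p => Z p 0 i) ξ = fLateral Ω T A₃ k ξ i := by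
    intro k i
    rw [B₁_mulVec_succ, Pi.add_apply, B₂_mulVec, if_neg (Fin.succ_ne_zero k)]
    have : β₁ Ω T A₁ A₂ A₃ ξ (k.succ, i) = - fLateral Ω T A₃ k ξ i := by
      fin_cases k <;> rfl
    rw [this, add_zero, ← neg_inj, neg_sub, neg_neg]
  have h0 : ∀ i, (B₁ A B C D ξ *ᵥ X) (0, i) =
      (β₁ Ω T A₁ A₂ A₃ ξ + B₂ m *ᵥ v) (0, i) ↔
      setTransform (cylinder Ω T) (fun p => f (Z p) p i) ξ -
        Complex.I * ξ.2 * setTransform (cylinder Ω T) (fun p => Z p 0 i) ξ =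
          f₀ Ω T A₁ A₂ ξ i := by
    intro i
    rw [B₁_mulVec_zero, Pi.add_apply, B₂_mulVec, if_pos rfl, hf]
    have : β₁ Ω T A₁ A₂ A₃ ξ (0, i) = - f₀ Ω T A₁ A₂ ξ i := rfl
    rw [this]
    constructor <;> intro h <;> linear_combination -h
  rw [Fin.forall_fin_succ]
  simp only [hs, h0]

theorem hasInvFourier_w₁Symbol
    (hB₀ : ∀ i j, HasInvFourier (fun ξ => (B₀ A B C D ξ)⁻¹ i j))
    (h₁ : ∀ i, IntegrableOn (fun x => A₁ x i) Ω) (h₂ : ∀ i, IntegrableOn (fun x => A₂ x i) Ω)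
    (h₃ : ∀ k i, Integrable (fun p => A₃ p i * outwardNormal Ω p.1 k) (lateralMeasure Ω T))
    (k : Fin 4 × Fin m) : HasInvFourier (w₁Symbol A B C D Ω T A₁ A₂ A₃ k) := by
  have hf0 : ∀ i, ∃ c, (Continuous fun ξ => f₀ Ω T A₁ A₂ ξ i) ∧
      ∀ ξ, ‖f₀ Ω T A₁ A₂ ξ i‖ ≤ c := by
    intro i
    have e : ∀ ξ, f₀ Ω T A₁ A₂ ξ i =
        (∫ x in Ω, (A₂ x i : ℂ) * wave (x, 0) (-ξ)) * wave (0, T) (-ξ) -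
          ∫ x in Ω, (A₁ x i : ℂ) * wave (x, 0) (-ξ) := by
      intro ξ
      rw [f₀, ← integral_mul_const, ← integral_sub]
      · refine integral_congr_ae (Eventually.of_forall fun x => ?_)
        simp only []
        ring
      · exact (integrable_mul_wave ((h₂ i).ofReal (𝕜 := ℂ))
          (measurable_id.prodMk measurable_const) _).mul_const _
      · exact integrable_mul_wave ((h₁ i).ofReal (𝕜 := ℂ))
          (measurable_id.prodMk measurable_const) _
    refine ⟨(∫ x in Ω, ‖(A₂ x i : ℂ)‖) + ∫ x in Ω, ‖(A₁ x i : ℂ)‖, ?_, fun ξ => ?_⟩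
    · simp only [e]
      refine Continuous.sub (Continuous.mul ?_ (Continuous.wave continuous_const continuous_neg)) ?_
      · exact continuous_integral_wave ((h₂ i).ofReal (𝕜 := ℂ))
          (measurable_id.prodMk measurable_const)
      · exact continuous_integral_wave ((h₁ i).ofReal (𝕜 := ℂ))
          (measurable_id.prodMk measurable_const)
    · rw [e]
      refine (norm_sub_le _ _).trans (add_le_add ?_ (norm_integral_wave_le _))
      rw [norm_mul, norm_wave, mul_one]
      exact norm_integral_wave_le _
  have hfk : ∀ (l : Fin 3) i, ∃ c, (Continuous fun ξ => fLateral Ω T A₃ l ξ i) ∧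
      ∀ ξ, ‖fLateral Ω T A₃ l ξ i‖ ≤ c := by
    intro l i
    have e : ∀ ξ, fLateral Ω T A₃ l ξ i = ∫ p, ((A₃ p i * outwardNormal Ω p.1 l : ℝ) : ℂ) *
        wave (id p) (-ξ) ∂(lateralMeasure Ω T) := by
      intro ξ
      simp only [fLateral, Complex.ofReal_mul, id]
    simp only [e]
    exact ⟨_, continuous_integral_wave ((h₃ l i).ofReal (𝕜 := ℂ)) measurable_id,
      norm_integral_wave_le⟩
  have hβ : ∀ l : Fin 4 × Fin m, ∃ c, (Continuous fun ξ => β₁ Ω T A₁ A₂ A₃ ξ l) ∧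
      ∀ ξ, ‖β₁ Ω T A₁ A₂ A₃ ξ l‖ ≤ c := by
    rintro ⟨l, i⟩
    induction l using Fin.cases with
    | zero =>
      obtain ⟨c, h1, h2⟩ := hf0 i
      exact ⟨c, h1.neg, fun ξ => (norm_neg (f₀ Ω T A₁ A₂ ξ i)).trans_le (h2 ξ)⟩
    | succ l =>
      obtain ⟨c, h1, h2⟩ := hfk l i
      have : ∀ ξ, β₁ Ω T A₁ A₂ A₃ ξ (l.succ, i) = - fLateral Ω T A₃ l ξ i := by
        intro ξ; fin_cases l <;> rfl
      simp only [this]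
      exact ⟨c, h1.neg, fun ξ => (norm_neg (fLateral Ω T A₃ l ξ i)).trans_le (h2 ξ)⟩
  choose c hc1 hc2 using hβ
  refine (hasInvFourier_B₁_inv_mulVec hB₀ (fun l => (hc1 l).aestronglyMeasurable)
    (c := ∑ l, |c l|) (fun l ξ => ?_) k).congr (w₁Symbol_ae_eq Ω T A₁ A₂ A₃ k).symm
  exact (hc2 l ξ).trans ((le_abs_self _).trans
    (Finset.single_le_sum (f := fun l => |c l|) (fun _ _ => abs_nonneg _) (Finset.mem_univ l)))

end Transforms

end FirstOrderSystem

namespace FirstOrderSystem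

section Weak

open scoped ContDiff

/-- `v` is the derivative of `u` in the direction `e`, up to the boundary: `∫_Q (v φ + u ∂φ)` is
the boundary term `b φ`, for every test function `φ` on the whole space-time. -/
def WeakIdentity (Q : Set SpaceTime) (e : SpaceTime) (u v : SpaceTime → ℝ)
    (b : (SpaceTime → ℝ) → ℝ) : Prop :=
  ∀ φ : SpaceTime → ℝ, ContDiff ℝ ∞ φ → HasCompactSupport φ →
    (∫ p in Q, v p * φ p) + ∫ p in Q, u p * fderiv ℝ φ p e = b φ

variable {Q : Set SpaceTime} {e : SpaceTime} {u v : SpaceTime → ℝ} {b : (SpaceTime → ℝ) → ℝ}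
  {X : Type*} [MeasurableSpace X] {μ : Measure X} {a a' : X → ℝ} {ι ι' : X → SpaceTime}

theorem integrable_mul_of_compactSupport {μ : Measure X} {a : X → ℝ} {ι : X → SpaceTime}
    (ha : Integrable a μ) (hι : Measurable ι) {φ : SpaceTime → ℂ} (hφ : Continuous φ)
    (hs : HasCompactSupport φ) : Integrable (fun x => (a x : ℂ) * φ (ι x)) μ := by
  obtain ⟨c, hc⟩ := hs.exists_bound_of_continuous hφ
  exact ha.ofReal.mul_bdd (c := c) (hφ.measurable.comp hι).aestronglyMeasurable
    (Eventually.of_forall fun x => hc _)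

theorem integrable_mul_of_compactSupport_real {μ : Measure X} {a : X → ℝ} {ι : X → SpaceTime}
    (ha : Integrable a μ) (hι : Measurable ι) {φ : SpaceTime → ℝ} (hφ : Continuous φ)
    (hs : HasCompactSupport φ) : Integrable (fun x => a x * φ (ι x)) μ := by
  obtain ⟨c, hc⟩ := hs.exists_bound_of_continuous hφ
  exact ha.mul_bdd (c := c) (hφ.measurable.comp hι).aestronglyMeasurable
    (Eventually.of_forall fun x => hc _)

/-- Complex-valued test functions. -/
theorem WeakIdentity.complex (h : WeakIdentity Q e u v b) (hu : IntegrableOn u Q)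
    (hv : IntegrableOn v Q) (ha : Integrable a μ) (ha' : Integrable a' μ)
    (hι : Measurable ι) (hι' : Measurable ι')
    (hb : ∀ φ : SpaceTime → ℝ, ContDiff ℝ ∞ φ → HasCompactSupport φ →
      b φ = (∫ x, a x * φ (ι x) ∂μ) + ∫ x, a' x * φ (ι' x) ∂μ)
    {φ : SpaceTime → ℂ} (hφ : ContDiff ℝ ∞ φ) (hs : HasCompactSupport φ) :
    (∫ p in Q, (v p : ℂ) * φ p) + ∫ p in Q, (u p : ℂ) * fderiv ℝ φ p e =
      (∫ x, (a x : ℂ) * φ (ι x) ∂μ) + ∫ x, (a' x : ℂ) * φ (ι' x) ∂μ := by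
  have hd : Continuous fun p => fderiv ℝ φ p e :=
    (hφ.continuous_fderiv (by simp)).clm_apply continuous_const
  have hds : HasCompactSupport fun p => fderiv ℝ φ p e := hs.fderiv_apply ℝ e
  have i1 := integrable_mul_of_compactSupport hv measurable_id hφ.continuous hs
  have i2 := integrable_mul_of_compactSupport hu measurable_id hd hds
  have i3 := integrable_mul_of_compactSupport ha hι hφ.continuous hs
  have i4 := integrable_mul_of_compactSupport ha' hι' hφ.continuous hs
  have key : ∀ L : ℂ →L[ℝ] ℝ, (∀ (r : ℝ) (z : ℂ), L (r * z) = r * L z) →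
      L ((∫ p in Q, (v p : ℂ) * φ p) + ∫ p in Q, (u p : ℂ) * fderiv ℝ φ p e) =
      L ((∫ x, (a x : ℂ) * φ (ι x) ∂μ) + ∫ x, (a' x : ℂ) * φ (ι' x) ∂μ) := by
    intro L hL
    have hLφ : ContDiff ℝ ∞ fun p => L (φ p) := L.contDiff.comp hφ
    have hLs : HasCompactSupport fun p => L (φ p) := hs.comp_left (map_zero L)
    have hLd : ∀ p, fderiv ℝ (fun p => L (φ p)) p e = L (fderiv ℝ φ p e) := by
      intro p
      have := (L.hasFDerivAt.comp p (hφ.differentiable (by simp) p).hasFDerivAt).fderiv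
      exact congrArg (fun M : SpaceTime →L[ℝ] ℝ => M e) this
    have h1 := h _ hLφ hLs
    rw [hb _ hLφ hLs] at h1
    simp only [hLd] at h1
    rw [map_add, map_add]
    have e1 := L.integral_comp_comm i1
    have e2 := L.integral_comp_comm i2
    have e3 := L.integral_comp_comm i3
    have e4 := L.integral_comp_comm i4
    simp only [hL, id] at e1 e2 e3 e4
    rw [← e1, ← e2, ← e3, ← e4]
    exact h1
  refine Complex.ext ?_ ?_
  · exact key Complex.reCLM (fun r z => by simp)
  · exact key Complex.imCLM (fun r z => by simp)

theorem integral_integral_wave_mul_invFourierTest [SFinite μ] (ha : Integrable a μ)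
    (hι : Measurable ι) (θ : 𝓢(SpaceTime, ℂ)) :
    ∫ ξ, (∫ x, (a x : ℂ) * wave (ι x) (-ξ) ∂μ) * invFourierTest θ ξ =
      ∫ x, (a x : ℂ) * θ (ι x) ∂μ := by
  have := integral_integral_wave_mul (ha.ofReal (𝕜 := ℂ)) hι (integrable_invFourierTest θ)
  simp only [integral_invFourierTest_mul_wave] at this
  exact this

theorem integrable_integral_wave_mul_invFourierTest (ha : Integrable a μ)
    (hι : Measurable ι) (θ : 𝓢(SpaceTime, ℂ)) :
    Integrable fun ξ => (∫ x, (a x : ℂ) * wave (ι x) (-ξ) ∂μ) * invFourierTest θ ξ :=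
  (integrable_invFourierTest θ).bdd_mul (c := ∫ x, ‖(a x : ℂ)‖ ∂μ)
    (continuous_integral_wave (ha.ofReal (𝕜 := ℂ)) hι).aestronglyMeasurable
    (Eventually.of_forall fun ξ => norm_integral_wave_le ξ)

theorem weakIdentity_iff_ae [SFinite μ] (hQ : IsOpen Q) (hu : IntegrableOn u Q)
    (hv : IntegrableOn v Q) (ha : Integrable a μ) (ha' : Integrable a' μ)
    (hι : Measurable ι) (hι' : Measurable ι') {R : ℝ} (hQR : Q ⊆ Metric.ball 0 R)
    (hR : ∀ᵐ x ∂μ, ι x ∈ Metric.closedBall 0 R) (hR' : ∀ᵐ x ∂μ, ι' x ∈ Metric.closedBall 0 R)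
    (hb : ∀ φ : SpaceTime → ℝ, ContDiff ℝ ∞ φ → HasCompactSupport φ →
      b φ = (∫ x, a x * φ (ι x) ∂μ) + ∫ x, a' x * φ (ι' x) ∂μ) :
    WeakIdentity Q e u v b ↔ ∀ᵐ ξ : SpaceTime,
      setTransform Q v ξ - Complex.I * phase ξ e * setTransform Q u ξ =
        (∫ x, (a x : ℂ) * wave (ι x) (-ξ) ∂μ) + ∫ x, (a' x : ℂ) * wave (ι' x) (-ξ) ∂μ := by
  constructor
  · intro h
    refine Eventually.of_forall fun ξ => ?_
    let χ : ContDiffBump (0 : SpaceTime) :=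
      ⟨max R 1, max R 1 + 1, lt_of_lt_of_le one_pos (le_max_right _ _), lt_add_one _⟩
    have hχ : ∀ p ∈ Metric.closedBall (0 : SpaceTime) R, χ p = 1 := fun p hp =>
      χ.one_of_mem_closedBall (Metric.closedBall_subset_closedBall (le_max_left _ _) hp)
    have hc1 : ContDiff ℝ ∞ fun p => (χ p : ℂ) := Complex.ofRealCLM.contDiff.comp χ.contDiff
    have hs1 : HasCompactSupport fun p => (χ p : ℂ) := χ.hasCompactSupport.comp_left
      (g := Complex.ofReal) rfl
    have := h.complex hu hv ha ha' hι hι' hb (φ := fun p => (χ p : ℂ) * wave p (-ξ))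
      (hc1.mul (contDiff_wave (-ξ))) hs1.mul_right
    have e1 : ∫ p in Q, (v p : ℂ) * ((χ p : ℂ) * wave p (-ξ)) = setTransform Q v ξ := by
      refine setIntegral_congr_fun hQ.measurableSet fun p hp => ?_
      simp only [hχ p (Metric.ball_subset_closedBall (hQR hp)), Complex.ofReal_one, one_mul]
    have e2 : ∫ p in Q, (u p : ℂ) * fderiv ℝ (fun p => (χ p : ℂ) * wave p (-ξ)) p e =
        - (Complex.I * phase ξ e * setTransform Q u ξ) := by
      rw [setTransform, ← integral_const_mul, ← integral_neg]
      refine setIntegral_congr_fun hQ.measurableSet fun p hp => ?_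
      have : (fun p => (χ p : ℂ) * wave p (-ξ)) =ᶠ[𝓝 p] fun p => wave p (-ξ) := by
        filter_upwards [hQ.mem_nhds hp] with q hq
        simp only [hχ q (Metric.ball_subset_closedBall (hQR hq)), Complex.ofReal_one, one_mul]
      rw [this.fderiv_eq, fderiv_wave, phase_neg]
      push_cast
      ring
    have e3 : ∀ {a : X → ℝ} {ι : X → SpaceTime}, (∀ᵐ x ∂μ, ι x ∈ Metric.closedBall 0 R) →
        ∫ x, (a x : ℂ) * ((χ (ι x) : ℂ) * wave (ι x) (-ξ)) ∂μ =
        ∫ x, (a x : ℂ) * wave (ι x) (-ξ) ∂μ := by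
      intro a ι hR
      refine integral_congr_ae (hR.mono fun x hx => ?_)
      simp only [hχ _ hx, Complex.ofReal_one, one_mul]
    rw [e1, e2, e3 hR, e3 hR'] at this
    rw [← this, sub_eq_add_neg]
  · intro h φ hφ hs
    have hc1 : ContDiff ℝ ∞ fun p => (φ p : ℂ) := Complex.ofRealCLM.contDiff.comp hφ
    have hs1 : HasCompactSupport fun p => (φ p : ℂ) := hs.comp_left (g := Complex.ofReal) rfl
    set Φ : 𝓢(SpaceTime, ℂ) := hs1.toSchwartzMap hc1 with hΦ
    have hΦc : ∀ p, Φ p = φ p := fun p => rfl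
    set Ψ : 𝓢(SpaceTime, ℂ) := LineDeriv.lineDerivOpCLM ℂ 𝓢(SpaceTime, ℂ) e Φ with hΨ
    have hΨf : ⇑Ψ = fun p => fderiv ℝ Φ p e := rfl
    have hΨc : ∀ p, Ψ p = (fderiv ℝ φ p e : ℝ) := by
      intro p
      have := (Complex.ofRealCLM.hasFDerivAt.comp p
        (hφ.differentiable (by simp) p).hasFDerivAt).fderiv
      exact congrArg (fun M : SpaceTime →L[ℝ] ℂ => M e) this
    have e1 := integral_integral_wave_mul_invFourierTest hv measurable_id Φ
    have e2 := integral_integral_wave_mul_invFourierTest hu measurable_id Ψ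
    have e3 := integral_integral_wave_mul_invFourierTest ha hι Φ
    have e4 := integral_integral_wave_mul_invFourierTest ha' hι' Φ
    have key : (∫ p in Q, (v p : ℂ) * φ p) + ∫ p in Q, (u p : ℂ) * (fderiv ℝ φ p e : ℝ) =
        (∫ x, (a x : ℂ) * φ (ι x) ∂μ) + ∫ x, (a' x : ℂ) * φ (ι' x) ∂μ := by
      simp only [hΦc, hΨc, id] at e1 e2 e3 e4
      have j1 := integrable_integral_wave_mul_invFourierTest hv measurable_id Φ
      have j2 := integrable_integral_wave_mul_invFourierTest hu measurable_id Ψ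
      simp only [id] at j1 j2
      rw [← e1, ← e2, ← e3, ← e4, ← integral_add j1 j2,
        ← integral_add (integrable_integral_wave_mul_invFourierTest ha hι Φ)
          (integrable_integral_wave_mul_invFourierTest ha' hι' Φ)]
      refine integral_congr_ae (h.mono fun ξ hξ => ?_)
      simp only []
      rw [hΨf, invFourierTest_fderiv, ← add_mul, ← hξ]
      change setTransform Q v ξ * _ + setTransform Q u ξ * _ = _
      ring
    rw [hb φ hφ hs]
    have hreal : ∀ r s : ℝ, (r : ℂ) * (s : ℂ) = ((r * s : ℝ) : ℂ) := fun r s => by push_cast; rfl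
    simp only [hreal, integral_complex_ofReal] at key
    exact_mod_cast key

end Weak
end FirstOrderSystem

namespace FirstOrderSystem

section LinearODE

variable {m : ℕ}

theorem hasDerivAt_mulVec (M : Matrix (Fin m) (Fin m) ℂ) {w : ℝ → Fin m → ℂ} {w' : Fin m → ℂ}
    {t : ℝ} (h : HasDerivAt w w' t) : HasDerivAt (fun t => M *ᵥ w t) (M *ᵥ w') t := by
  have := ((M.mulVecLin.restrictScalars ℝ).toContinuousLinearMap).hasFDerivAt.comp_hasDerivAt t h
  exact this

theorem exists_norm_mulVec_le (M : Matrix (Fin m) (Fin m) ℂ) :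
    ∃ c, 0 ≤ c ∧ ∀ v : Fin m → ℂ, ‖M *ᵥ v‖ ≤ c * ‖v‖ :=
  ⟨_, norm_nonneg _, fun v => (M.mulVecLin.toContinuousLinearMap).le_opNorm v⟩

/-- A bounded solution of `w' = a w` on a half-line vanishes if it is annihilated by a product of
factors `a - μ` with `Re μ > 0`. -/
theorem eq_zero_of_bounded_solution_of_prod (a : Matrix (Fin m) (Fin m) ℂ) (T : ℝ)
    (s : Multiset ℂ) (hs : ∀ μ ∈ s, 0 < μ.re) :
    ∀ (w : ℝ → Fin m → ℂ), (∀ t, T ≤ t → HasDerivAt w (a *ᵥ w t) t) →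
      (∃ c, ∀ t, ‖w t‖ ≤ c) →
      (∀ t, T ≤ t → Polynomial.aeval a (s.map fun μ => Polynomial.X - Polynomial.C μ).prod *ᵥ w t
        = 0) → ∀ t, T ≤ t → w t = 0 := by
  induction s using Multiset.induction with
  | empty => intro w _ _ h t ht; simpa using h t ht
  | cons μ s ih =>
    intro w hw ⟨c, hc⟩ h t ht
    have hμ : 0 < μ.re := hs μ (by simp)
    set w₂ : ℝ → Fin m → ℂ := fun t => a *ᵥ w t - μ • w t with hw₂
    have hcomm : ∀ v : Fin m → ℂ, (a - algebraMap ℂ _ μ) *ᵥ v = a *ᵥ v - μ • v := by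
      intro v
      rw [Matrix.sub_mulVec, Algebra.algebraMap_eq_smul_one, Matrix.smul_mulVec, Matrix.one_mulVec]
    have hw₂0 : ∀ t, T ≤ t → w₂ t = 0 := by
      refine ih (fun ν hν => hs ν (by simp [hν])) w₂ (fun t ht => ?_) ?_ (fun t ht => ?_)
      · have := (hasDerivAt_mulVec a (hw t ht)).sub ((hw t ht).const_smul μ)
        convert! this using 1
        rw [hw₂, Matrix.mulVec_sub, Matrix.mulVec_smul]
      · obtain ⟨K, hK0, hK⟩ := exists_norm_mulVec_le a
        refine ⟨K * c + ‖μ‖ * c, fun t => (norm_sub_le _ _).trans (add_le_add ?_ ?_)⟩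
        · exact (hK _).trans (mul_le_mul_of_nonneg_left (hc t) hK0)
        · rw [norm_smul]
          exact mul_le_mul_of_nonneg_left (hc t) (norm_nonneg _)
      · have := h t ht
        rw [Multiset.map_cons, Multiset.prod_cons, mul_comm, map_mul, ← Matrix.mulVec_mulVec,
          map_sub, Polynomial.aeval_X, Polynomial.aeval_C, hcomm] at this
        exact this
    have hscal : ∀ t, T ≤ t → HasDerivAt w (μ • w t) t := by
      intro t ht
      have := hw t ht
      rwa [sub_eq_zero.1 (hw₂0 t ht)] at this
    have hconst : ∀ r, t ≤ r → Complex.exp (-(μ * r)) • w r = Complex.exp (-(μ * t)) • w t := by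
      intro r hr
      have hd : ∀ x : ℝ, T ≤ x →
          HasDerivAt (fun x : ℝ => Complex.exp (-(μ * x)) • w x) 0 x := by
        intro x hx
        have h1 : HasDerivAt (fun x : ℝ => Complex.exp (-(μ * x)))
            (Complex.exp (-(μ * x)) * (-μ)) x := by
          have : HasDerivAt (fun x : ℝ => -(μ * (x : ℂ))) (-μ) x := by
            simpa using (((hasDerivAt_id x).ofReal_comp).const_mul μ).fun_neg
          exact this.cexp
        convert! h1.smul (hscal x hx) using 1
        rw [smul_smul, ← add_smul]
        simp
      refine constant_of_has_deriv_right_zero (a := t) (b := r)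
        (f := fun x : ℝ => Complex.exp (-(μ * x)) • w x) (fun x hx => ?_) (fun x hx => ?_)
        r ⟨hr, le_rfl⟩
      · exact (hd x (ht.trans hx.1)).continuousAt.continuousWithinAt
      · exact (hd x (ht.trans hx.1)).hasDerivWithinAt
    have hle : ∀ r, t ≤ r → ‖w t‖ ≤ Real.exp (-(μ.re * (r - t))) * c := by
      intro r hr
      have := congrArg norm (hconst r hr)
      rw [norm_smul, norm_smul, Complex.norm_exp, Complex.norm_exp] at this
      simp only [Complex.neg_re, Complex.mul_re, Complex.ofReal_re, Complex.ofReal_im, mul_zero,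
        sub_zero] at this
      have h2 : ‖w t‖ = Real.exp (-(μ.re * (r - t))) * ‖w r‖ := by
        rw [show -(μ.re * (r - t)) = μ.re * t + -(μ.re * r) by ring, Real.exp_add, mul_assoc, this,
          ← mul_assoc, ← Real.exp_add]
        simp
      rw [h2]
      exact mul_le_mul_of_nonneg_left (hc r) (Real.exp_pos _).le
    have hlim : Tendsto (fun r => Real.exp (-(μ.re * (r - t))) * c) atTop (𝓝 (0 * c)) := by
      refine Tendsto.mul_const c (Real.tendsto_exp_neg_atTop_nhds_zero.comp ?_)
      exact (tendsto_atTop_add_const_right _ (-t) tendsto_id).const_mul_atTop hμ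
    rw [zero_mul] at hlim
    have := ge_of_tendsto hlim ((eventually_ge_atTop t).mono hle)
    exact norm_le_zero_iff.1 this

theorem eq_zero_of_bounded_solution {a : Matrix (Fin m) (Fin m) ℂ} {T : ℝ}
    (ha : ∀ μ ∈ spectrum ℂ a, 0 < μ.re) {w : ℝ → Fin m → ℂ}
    (hw : ∀ t, T ≤ t → HasDerivAt w (a *ᵥ w t) t) (hb : ∃ c, ∀ t, ‖w t‖ ≤ c) {t : ℝ}
    (ht : T ≤ t) : w t = 0 := by
  refine eq_zero_of_bounded_solution_of_prod a T a.charpoly.roots (fun μ hμ => ha μ ?_) w hw hb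
    (fun t _ => ?_) t ht
  · exact Matrix.mem_spectrum_of_isRoot_charpoly (Polynomial.isRoot_of_mem_roots hμ)
  · rw [← (IsAlgClosed.splits a.charpoly).eq_prod_roots_of_monic a.charpoly_monic,
      Matrix.aeval_self_charpoly, Matrix.zero_mulVec]

end LinearODE

section Causality

open scoped FourierTransform

variable {m : ℕ} {A B C D : Matrix (Fin m) (Fin m) ℝ}

theorem det_B₀_ne_zero_of_spectrum
    (h : ∀ (ξ : Space), ∀ μ ∈ spectrum ℂ (a₂ A B C D ξ), 0 < μ.re) (ξ : SpaceTime) :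
    (B₀ A B C D ξ).det ≠ 0 := by
  intro h0
  have : -(Complex.I * (ξ.2 : ℂ)) ∈ spectrum ℂ (a₂ A B C D ξ.1) := by
    rw [spectrum.mem_iff, Matrix.isUnit_iff_isUnit_det, isUnit_iff_ne_zero, not_not, ← h0,
      B₀_eq_neg_a₂, Algebra.algebraMap_eq_smul_one]
    congr 1
    rw [neg_smul]
    abel
  have := h _ _ this
  simp at this

/-- `B₀⁻¹` is bounded along the time frequencies. -/
theorem exists_norm_B₀_inv_mulVec_le
    (h : ∀ (ξ : Space), ∀ μ ∈ spectrum ℂ (a₂ A B C D ξ), 0 < μ.re) (ζ : Space) (b : Fin m → ℂ) :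
    Continuous (fun r : ℝ => (B₀ A B C D (ζ, r))⁻¹ *ᵥ b) ∧
      ∃ c, ∀ r : ℝ, ‖(B₀ A B C D (ζ, r))⁻¹ *ᵥ b‖ ≤ c := by
  have hc : Continuous fun r : ℝ => B₀ A B C D (ζ, r) :=
    (continuous_B₀ A B C D).comp (Continuous.prodMk_right ζ)
  have hY : Continuous (fun r : ℝ => (B₀ A B C D (ζ, r))⁻¹ *ᵥ b) := by
    simp only [Matrix.inv_def, Ring.inverse_eq_inv']
    refine Continuous.matrix_mulVec (Continuous.fun_smul ?_ hc.matrix_adjugate) continuous_const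
    exact hc.matrix_det.inv₀ fun r => det_B₀_ne_zero_of_spectrum h (ζ, r)
  refine ⟨hY, ?_⟩
  obtain ⟨K, hK0, hK⟩ := exists_norm_mulVec_le (a₂ A B C D ζ)
  obtain ⟨c, hcb⟩ := (isCompact_Icc (a := -(1 + K)) (b := 1 + K)).exists_bound_of_continuousOn
    hY.continuousOn
  refine ⟨max c ‖b‖, fun r => ?_⟩
  by_cases hr : r ∈ Icc (-(1 + K)) (1 + K)
  · exact (hcb r hr).trans (le_max_left _ _)
  · refine le_trans ?_ (le_max_right _ _)
    set Y := (B₀ A B C D (ζ, r))⁻¹ *ᵥ b with hYdef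
    have h1 : B₀ A B C D (ζ, r) *ᵥ Y = b := by
      rw [hYdef, Matrix.mulVec_mulVec, Matrix.mul_nonsing_inv, Matrix.one_mulVec]
      exact (det_B₀_ne_zero_of_spectrum h (ζ, r)).isUnit
    rw [B₀_eq_neg_a₂, Matrix.sub_mulVec, Matrix.neg_mulVec, Matrix.smul_mulVec,
      Matrix.one_mulVec] at h1
    have h2 : (Complex.I * (r : ℂ)) • Y = -(b + a₂ A B C D ζ *ᵥ Y) := by
      rw [← h1]; simp only []; abel
    have h3 : |r| * ‖Y‖ ≤ ‖b‖ + K * ‖Y‖ := by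
      have := congrArg norm h2
      rw [norm_smul, norm_neg, norm_mul, Complex.norm_I, one_mul, Complex.norm_real,
        Real.norm_eq_abs] at this
      rw [this]
      exact (norm_add_le _ _).trans (by gcongr; exact hK Y)
    have h4 : 1 + K < |r| := by
      by_contra hcon
      exact hr (abs_le.1 (not_lt.1 hcon))
    nlinarith [norm_nonneg Y]

theorem integrable_slice (η : 𝓢(SpaceTime, ℂ)) (ζ : Space) :
    Integrable (fun r : ℝ => η (ζ, r)) ∧ Integrable (fun r : ℝ => (r : ℂ) * η (ζ, r)) := by
  have hb : ∃ c, ∀ ξ, ‖(((1 + ‖ξ‖) ^ 3 : ℝ) : ℂ) * η ξ‖ ≤ c := by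
    refine ⟨2 ^ 3 * ((Finset.Iic (3, 0)).sup fun m => SchwartzMap.seminorm ℂ m.1 m.2) η,
      fun ξ => ?_⟩
    have := SchwartzMap.one_add_le_sup_seminorm_apply (𝕜 := ℂ) (m := (3, 0)) (k := 3) (n := 0)
      le_rfl le_rfl η ξ
    rw [norm_iteratedFDeriv_zero] at this
    rw [norm_mul, Complex.norm_real, Real.norm_of_nonneg (by positivity)]
    exact this
  obtain ⟨c, hc⟩ := hb
  have hc' : ∀ r : ℝ, (1 + |r|) ^ 3 * ‖η (ζ, r)‖ ≤ c := by
    intro r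
    refine le_trans ?_ (hc (ζ, r))
    rw [norm_mul, Complex.norm_real, Real.norm_of_nonneg (by positivity)]
    gcongr
    exact norm_snd_le (ζ, r)
  have hint : Integrable fun r : ℝ => c * (1 + ‖r‖) ^ (-(2 : ℝ)) :=
    (integrable_one_add_norm (by simp)).const_mul c
  have hη : Continuous fun r : ℝ => η (ζ, r) := η.continuous.comp (Continuous.prodMk_right ζ)
  have hpow : ∀ r : ℝ, (1 + ‖r‖) ^ (-(2 : ℝ)) = ((1 + |r|) ^ 2)⁻¹ := by
    intro r
    rw [Real.rpow_neg (by positivity), Real.norm_eq_abs]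
    norm_cast
  constructor
  · refine hint.mono' hη.aestronglyMeasurable (Eventually.of_forall fun r => ?_)
    rw [hpow, ← div_eq_mul_inv, le_div_iff₀ (by positivity)]
    refine le_trans ?_ (hc' r)
    rw [mul_comm]
    gcongr
    · linarith [abs_nonneg r]
    · norm_num
  · refine hint.mono' (by fun_prop) (Eventually.of_forall fun r => ?_)
    rw [hpow, ← div_eq_mul_inv, le_div_iff₀ (by positivity)]
    refine le_trans ?_ (hc' r)
    rw [norm_mul, Complex.norm_real, Real.norm_eq_abs, pow_succ (1 + |r|) 2]
    have := abs_nonneg r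
    have h5 : 0 ≤ (1 + |r|) ^ 2 * ‖η (ζ, r)‖ := by positivity
    nlinarith

/-- The inverse Fourier transform of `F⁻¹ φ` in time alone vanishes where `φ` does. -/
theorem integral_invFourierTest_slice_eq_zero (φ : 𝓢(SpaceTime, ℂ)) (ζ : Space) {t : ℝ}
    (ht : ∀ x, φ (x, t) = 0) :
    ∫ r : ℝ, invFourierTest φ (ζ, r) * Complex.exp (-(Complex.I * (t * r : ℝ))) = 0 := by
  set H : ℝ → ℂ := fun s => ∫ x : Space, φ (x, s) * wave (x, 0) (ζ, 0) with hH
  have hwint : Integrable fun p : SpaceTime => φ p * wave (p.1, 0) (ζ, 0) :=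
    integrable_mul_wave (ι := fun p : SpaceTime => ((p.1, 0) : SpaceTime)) φ.integrable
      (by fun_prop) (ζ, 0)
  have hHint : Integrable H := Integrable.integral_prod_right hwint
  have hHc : Continuous H := by
    have hb : ∃ c, ∀ ξ, ‖(((1 + ‖ξ‖) ^ 4 : ℝ) : ℂ) * φ ξ‖ ≤ c := by
      refine ⟨2 ^ 4 * ((Finset.Iic (4, 0)).sup fun m => SchwartzMap.seminorm ℂ m.1 m.2) φ,
        fun ξ => ?_⟩
      have := SchwartzMap.one_add_le_sup_seminorm_apply (𝕜 := ℂ) (m := (4, 0)) (k := 4) (n := 0)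
        le_rfl le_rfl φ ξ
      rw [norm_iteratedFDeriv_zero] at this
      rw [norm_mul, Complex.norm_real, Real.norm_of_nonneg (by positivity)]
      exact this
    obtain ⟨c, hc⟩ := hb
    refine continuous_of_dominated (bound := fun x : Space => c * (1 + ‖x‖) ^ (-(4 : ℝ)))
      (fun s => ?_) (fun s => Eventually.of_forall fun x => ?_) ?_
      (Eventually.of_forall fun x => ?_)
    · refine Continuous.aestronglyMeasurable (Continuous.mul ?_ ?_)
      · exact φ.continuous.comp (Continuous.prodMk_left s)
      · exact Continuous.wave (Continuous.prodMk_left 0) continuous_const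
    · rw [norm_mul, norm_wave, mul_one, Real.rpow_neg (by positivity), ← div_eq_mul_inv,
        le_div_iff₀ (by positivity)]
      refine le_trans ?_ (hc (x, s))
      rw [norm_mul, Complex.norm_real, Real.norm_of_nonneg (by positivity), mul_comm]
      norm_cast
      gcongr
      exact norm_fst_le (x, s)
    · exact (integrable_one_add_norm (by rw [finrank_euclideanSpace]; norm_num)).const_mul c
    · exact (φ.continuous.comp (Continuous.prodMk_right x)).mul continuous_const
  have hη : ∀ r : ℝ, invFourierTest φ (ζ, r) =
      ((2 * Real.pi : ℝ) : ℂ)⁻¹ ^ 4 * (𝓕⁻ H) ((2 * Real.pi)⁻¹ * r) := by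
    intro r
    rw [invFourierTest, Real.fourierInv_eq']
    congr 1
    rw [Measure.volume_eq_prod, integral_prod_symm]
    · refine integral_congr_ae (Eventually.of_forall fun s => ?_)
      simp only [smul_eq_mul, hH]
      rw [← integral_const_mul]
      refine integral_congr_ae (Eventually.of_forall fun x => ?_)
      simp only []
      have h1 : wave (x, s) (ζ, r) = wave (x, 0) (ζ, 0) * Complex.exp (Complex.I * (s * r : ℝ)) := by
        simp only [wave, mul_zero, add_zero]
        rw [← Complex.exp_add]
        push_cast
        ring_nf
      have h2 : (2 * Real.pi * inner ℝ s ((2 * Real.pi)⁻¹ * r) : ℝ) = s * r := by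
        simp only [RCLike.inner_apply, conj_trivial]
        field_simp
      rw [h1, h2]
      ring_nf
    · exact integrable_schwartz_mul_wave φ (ζ, r)
  have hηint : Integrable fun r : ℝ => invFourierTest φ (ζ, r) := by
    rw [← coe_invFourierSchwartz]
    exact (integrable_slice (invFourierSchwartz φ) ζ).1
  have hc0 : ((2 * Real.pi : ℝ) : ℂ)⁻¹ ^ 4 ≠ 0 := by
    refine pow_ne_zero _ (inv_ne_zero ?_)
    norm_cast
    positivity
  have hInv : Integrable (𝓕⁻ H) := by
    have h1 : Integrable fun r : ℝ => (𝓕⁻ H) ((2 * Real.pi)⁻¹ * r) := by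
      refine (hηint.const_mul (((2 * Real.pi : ℝ) : ℂ)⁻¹ ^ 4)⁻¹).congr
        (Eventually.of_forall fun r => ?_)
      simp only [hη]
      rw [inv_mul_cancel_left₀ hc0]
    exact (integrable_comp_mul_left_iff (𝓕⁻ H) (by positivity)).1 h1
  have hF : Integrable (𝓕 H) := by
    refine (hInv.comp_neg).congr (Eventually.of_forall fun r => ?_)
    simp only []
    rw [Real.fourierInv_eq_fourier_neg, neg_neg]
  have hinv : 𝓕 (𝓕⁻ H) t = H t := congrFun (hHc.fourier_fourierInv_eq hHint hF) t
  have hHt : H t = 0 := by simp [hH, ht]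
  rw [hHt, Real.fourier_eq'] at hinv
  simp only [hη]
  let g : ℝ → ℂ := fun r => ((2 * Real.pi : ℝ) : ℂ)⁻¹ ^ 4 *
    (Complex.exp (↑(-2 * Real.pi * inner ℝ r t) * Complex.I) • (𝓕⁻ H) r)
  have hg : ∀ r : ℝ, ((2 * Real.pi : ℝ) : ℂ)⁻¹ ^ 4 * (𝓕⁻ H) ((2 * Real.pi)⁻¹ * r) *
      Complex.exp (-(Complex.I * (t * r : ℝ))) = g ((2 * Real.pi)⁻¹ * r) := by
    intro r
    simp only [g, smul_eq_mul]
    have h2 : (-2 * Real.pi * inner ℝ ((2 * Real.pi)⁻¹ * r) t : ℝ) = -(t * r) := by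
      simp only [RCLike.inner_apply, conj_trivial]
      field_simp
    rw [h2]
    push_cast
    ring_nf
  rw [integral_congr_ae (Eventually.of_forall hg), Measure.integral_comp_mul_left g]
  simp only [g]
  rw [integral_const_mul, hinv, mul_zero, smul_zero]

end Causality
end FirstOrderSystem

namespace FirstOrderSystem

section Causality

variable {m : ℕ} {A B C D : Matrix (Fin m) (Fin m) ℝ}

theorem integral_slice_smul_B₀_inv_eq_zero
    (h : ∀ (ξ : Space), ∀ μ ∈ spectrum ℂ (a₂ A B C D ξ), 0 < μ.re) (φ : 𝓢(SpaceTime, ℂ))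
    {T : ℝ} (hφ : ∀ x t, T ≤ t → φ (x, t) = 0) (ζ : Space) (b : Fin m → ℂ) :
    ∫ r : ℝ, (invFourierTest φ (ζ, r) * Complex.exp (-(Complex.I * (T * r : ℝ)))) •
      ((B₀ A B C D (ζ, r))⁻¹ *ᵥ b) = 0 := by
  obtain ⟨hYc, c, hYb⟩ := exists_norm_B₀_inv_mulVec_le h ζ b
  set Y : ℝ → Fin m → ℂ := fun r => (B₀ A B C D (ζ, r))⁻¹ *ᵥ b with hY
  set η : 𝓢(SpaceTime, ℂ) := invFourierSchwartz φ with hη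
  have hηφ : invFourierTest φ = ⇑η := (coe_invFourierSchwartz φ).symm
  obtain ⟨hi0, hi1⟩ := integrable_slice η ζ
  have hηc : Continuous fun r : ℝ => η (ζ, r) := η.continuous.comp (Continuous.prodMk_right ζ)
  let F : ℝ → ℝ → Fin m → ℂ := fun t r =>
    (η (ζ, r) * Complex.exp (-(Complex.I * (t * r : ℝ)))) • Y r
  let F' : ℝ → ℝ → Fin m → ℂ := fun t r =>
    (η (ζ, r) * (Complex.exp (-(Complex.I * (t * r : ℝ))) * -(Complex.I * r))) • Y r
  have hexp : ∀ t r : ℝ, ‖Complex.exp (-(Complex.I * (t * r : ℝ)))‖ = 1 := by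
    intro t r
    rw [Complex.norm_exp]
    simp
  have hFc : ∀ t, Continuous (F t) := fun t => by
    refine Continuous.fun_smul (hηc.mul ?_) hYc
    fun_prop
  have hF'c : ∀ t, Continuous (F' t) := fun t => by
    refine Continuous.fun_smul (hηc.mul ?_) hYc
    fun_prop
  have hFb : ∀ t r, ‖F t r‖ ≤ c * ‖η (ζ, r)‖ := by
    intro t r
    simp only [F, norm_smul, norm_mul, hexp, mul_one]
    rw [mul_comm]
    exact mul_le_mul_of_nonneg_right (hYb r) (norm_nonneg _)
  have hF'b : ∀ t r, ‖F' t r‖ ≤ c * ‖(r : ℂ) * η (ζ, r)‖ := by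
    intro t r
    simp only [F', norm_smul, norm_mul, hexp, one_mul, norm_neg, Complex.norm_I]
    rw [mul_comm, mul_comm ‖η (ζ, r)‖]
    exact mul_le_mul_of_nonneg_right (hYb r) (by positivity)
  have hFint : ∀ t, Integrable (F t) := fun t =>
    (hi0.norm.const_mul c).mono' (hFc t).aestronglyMeasurable (Eventually.of_forall (hFb t))
  have hderiv : ∀ t, HasDerivAt (fun t => ∫ r, F t r) (∫ r, F' t r) t := by
    intro t
    refine (hasDerivAt_integral_of_dominated_loc_of_deriv_le (s := univ) univ_mem
      (Eventually.of_forall fun t => (hFc t).aestronglyMeasurable) (hFint t)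
      (hF'c t).aestronglyMeasurable (Eventually.of_forall fun r s _ => hF'b s r)
      (hi1.norm.const_mul c) (Eventually.of_forall fun r s _ => ?_)).2
    have h1 : HasDerivAt (fun s : ℝ => -(Complex.I * ((s * r : ℝ) : ℂ))) (-(Complex.I * r)) s := by
      have h2 : HasDerivAt (fun s : ℝ => ((s * r : ℝ) : ℂ)) ((1 * r : ℝ) : ℂ) s :=
        ((hasDerivAt_id s).mul_const r).ofReal_comp
      simpa using (h2.const_mul Complex.I).fun_neg
    exact (h1.cexp.const_mul (η (ζ, r))).smul_const (Y r)
  have hzero := eq_zero_of_bounded_solution (a := a₂ A B C D ζ) (T := T) (h ζ)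
    (w := fun t => ∫ r, F t r) (fun t ht => ?_) ?_ le_rfl
  · simpa only [F, hηφ] using hzero
  · have hR := integral_invFourierTest_slice_eq_zero φ ζ (hφ · t ht)
    rw [hηφ] at hR
    convert! hderiv t using 1
    have e1 : ∀ r, F' t r = (η (ζ, r) * Complex.exp (-(Complex.I * (t * r : ℝ)))) • b +
        a₂ A B C D ζ *ᵥ F t r := by
      intro r
      have h1 : B₀ A B C D (ζ, r) *ᵥ Y r = b := by
        rw [hY, Matrix.mulVec_mulVec, Matrix.mul_nonsing_inv, Matrix.one_mulVec]
        exact (det_B₀_ne_zero_of_spectrum h (ζ, r)).isUnit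
      rw [B₀_eq_neg_a₂, Matrix.sub_mulVec, Matrix.neg_mulVec, Matrix.smul_mulVec,
        Matrix.one_mulVec] at h1
      have h2 : -(Complex.I * (r : ℂ)) • Y r = b + a₂ A B C D ζ *ᵥ Y r := by
        rw [← h1, neg_smul]; simp only []; abel
      simp only [F, F']
      rw [Matrix.mulVec_smul, ← smul_add, ← h2, smul_smul, mul_assoc]
    have hb : Integrable fun r : ℝ =>
        (η (ζ, r) * Complex.exp (-(Complex.I * (t * r : ℝ)))) • b := by
      refine Integrable.smul_const ?_ b
      refine hi0.mul_bdd (c := 1) (by fun_prop) (Eventually.of_forall fun r => (hexp t r).le)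
    have hL := ((Matrix.mulVecLin (a₂ A B C D ζ)).toContinuousLinearMap).integral_comp_comm
      (hFint t)
    have hLi := ((Matrix.mulVecLin (a₂ A B C D ζ)).toContinuousLinearMap).integrable_comp
      (hFint t)
    simp only [LinearMap.coe_toContinuousLinearMap', Matrix.mulVecLin_apply] at hL hLi
    simp only [e1]
    rw [integral_add hb hLi, hL, integral_smul_const, hR, zero_smul, zero_add]
  · refine ⟨∫ r, c * ‖η (ζ, r)‖, fun t => ?_⟩
    exact norm_integral_le_of_norm_le (hi0.norm.const_mul c) (Eventually.of_forall (hFb t))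

theorem integrable_slice_smul_B₀_inv
    (h : ∀ (ξ : Space), ∀ μ ∈ spectrum ℂ (a₂ A B C D ξ), 0 < μ.re) (φ : 𝓢(SpaceTime, ℂ))
    (T : ℝ) (ζ : Space) (b : Fin m → ℂ) :
    Integrable fun r : ℝ => (invFourierTest φ (ζ, r) *
      Complex.exp (-(Complex.I * (T * r : ℝ)))) • ((B₀ A B C D (ζ, r))⁻¹ *ᵥ b) := by
  obtain ⟨hYc, c, hYb⟩ := exists_norm_B₀_inv_mulVec_le h ζ b
  rw [← coe_invFourierSchwartz φ]
  obtain ⟨hi0, -⟩ := integrable_slice (invFourierSchwartz φ) ζ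
  have hηc : Continuous fun r : ℝ => invFourierSchwartz φ (ζ, r) :=
    (invFourierSchwartz φ).continuous.comp (Continuous.prodMk_right ζ)
  refine (hi0.norm.const_mul c).mono' (Continuous.aestronglyMeasurable ?_)
    (Eventually.of_forall fun r => ?_)
  · refine Continuous.fun_smul (hηc.mul ?_) hYc
    fun_prop
  · have hexp : ‖Complex.exp (-(Complex.I * (T * r : ℝ)))‖ = 1 := by
      rw [Complex.norm_exp]
      simp
    rw [norm_smul, norm_mul, hexp, mul_one, mul_comm]
    exact mul_le_mul_of_nonneg_right (hYb r) (norm_nonneg _)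

variable {Ω : Set Space} {T : ℝ} {A₁ A₂ : Space → Fin m → ℝ} {A₃ : SpaceTime → Fin m → ℝ}

/-- The terminal data have no influence on `w₁` before the terminal time. -/
theorem w₁_eq_of_spectrum {k : Fin 4 × Fin m}
    (h : ∀ (ξ : Space), ∀ μ ∈ spectrum ℂ (a₂ A B C D ξ), 0 < μ.re)
    (hw : HasInvFourier (w₁Symbol A B C D Ω T A₁ A₂ A₃ k))
    (hw0 : HasInvFourier (w₁Symbol A B C D Ω T A₁ 0 A₃ k))
    (h₁ : ∀ i, IntegrableOn (fun x => A₁ x i) Ω) (h₂ : ∀ i, IntegrableOn (fun x => A₂ x i) Ω)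
    (φ : 𝓢(SpaceTime, ℂ)) (hφ : ∀ x t, T ≤ t → φ (x, t) = 0) :
    w₁ A B C D Ω T A₁ A₂ A₃ k φ = w₁ A B C D Ω T A₁ 0 A₃ k φ := by
  set g : Space → Fin m → ℂ := fun ζ i => ∫ x in Ω, (A₂ x i : ℂ) * wave (x, 0) (-(ζ, 0)) with hg
  have hwave : ∀ ξ : SpaceTime, wave (0, T) (-ξ) = Complex.exp (-(Complex.I * (T * ξ.2 : ℝ))) := by
    intro ξ
    simp [wave]
  have hf0 : ∀ ξ i, f₀ Ω T A₁ A₂ ξ i = f₀ Ω T A₁ 0 ξ i + wave (0, T) (-ξ) * g ξ.1 i := by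
    intro ξ i
    have hx : ∀ x : Space, wave (x, 0) (-(ξ.1, 0)) = wave (x, 0) (-ξ) := by
      intro x
      simp [wave]
    simp only [f₀, hg, hx]
    rw [← integral_const_mul, ← integral_add]
    · refine integral_congr_ae (Eventually.of_forall fun x => ?_)
      simp only [Pi.zero_apply, Complex.ofReal_zero]
      ring
    · have h1 : Integrable (fun x : Space => (A₁ x i : ℂ) * wave (x, 0) (-ξ))
          (volume.restrict Ω) :=
        integrable_mul_wave (ι := fun x : Space => ((x, 0) : SpaceTime))
          ((h₁ i).ofReal (𝕜 := ℂ)) (measurable_id.prodMk measurable_const) (-ξ)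
      refine h1.neg.congr (Eventually.of_forall fun x => ?_)
      simp
    · have h1 : Integrable (fun x : Space => (A₂ x i : ℂ) * wave (x, 0) (-ξ))
          (volume.restrict Ω) :=
        integrable_mul_wave (ι := fun x : Space => ((x, 0) : SpaceTime))
          ((h₂ i).ofReal (𝕜 := ℂ)) (measurable_id.prodMk measurable_const) (-ξ)
      exact h1.const_mul _
  have hdet := det_B₀_ne_zero_of_spectrum h
  have hβ : ∀ ξ, β₁ Ω T A₁ A₂ A₃ ξ - β₁ Ω T A₁ 0 A₃ ξ =
      fun l => if l.1 = 0 then - (wave (0, T) (-ξ) * g ξ.1 l.2) else 0 := by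
    intro ξ
    ext ⟨l, i⟩
    induction l using Fin.cases with
    | zero =>
      simp only [if_true, Pi.sub_apply]
      change -f₀ Ω T A₁ A₂ ξ i - -f₀ Ω T A₁ 0 ξ i = _
      rw [hf0]; ring
    | succ l =>
      simp only [Pi.sub_apply, Fin.succ_ne_zero, if_false]
      fin_cases l <;> exact sub_self _
  have hred : ∀ ξ, reducedRhs B C D (β₁ Ω T A₁ A₂ A₃ ξ - β₁ Ω T A₁ 0 A₃ ξ) =
      - wave (0, T) (-ξ) • g ξ.1 := by
    intro ξ
    rw [hβ]
    ext i
    have hz : (fun _ : Fin m => (0 : ℂ)) = 0 := rfl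
    simp [reducedRhs, hz]
  obtain ⟨c, hdiff⟩ : ∃ c : Space → ℂ, ∀ ξ : SpaceTime,
      w₁Symbol A B C D Ω T A₁ A₂ A₃ k ξ - w₁Symbol A B C D Ω T A₁ 0 A₃ k ξ =
      c ξ.1 * (wave (0, T) (-ξ) * ((B₀ A B C D ξ)⁻¹ *ᵥ g ξ.1) k.2) := by
    have h0 : ∀ (ξ : SpaceTime) i, ((B₁ A B C D ξ)⁻¹ *ᵥ (β₁ Ω T A₁ A₂ A₃ ξ - β₁ Ω T A₁ 0 A₃ ξ))
        (0, i) = wave (0, T) (-ξ) * ((B₀ A B C D ξ)⁻¹ *ᵥ g ξ.1) i := by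
      intro ξ i
      rw [B₁_inv_mulVec_zero (hdet ξ), hred, Matrix.mulVec_smul, Pi.smul_apply, smul_eq_mul]
      ring
    have h1 : ∀ ξ : SpaceTime,
        w₁Symbol A B C D Ω T A₁ A₂ A₃ k ξ - w₁Symbol A B C D Ω T A₁ 0 A₃ k ξ =
        ((B₁ A B C D ξ)⁻¹ *ᵥ (β₁ Ω T A₁ A₂ A₃ ξ - β₁ Ω T A₁ 0 A₃ ξ)) k := by
      intro ξ
      have hm : ξ ∈ {ξ | (B₀ A B C D ξ).det = 0}ᶜ := hdet ξ
      simp only [w₁Symbol, Set.indicator_of_mem hm, Matrix.mulVec_sub, Pi.sub_apply]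
    obtain ⟨l, i⟩ := k
    induction l using Fin.cases with
    | zero => exact ⟨fun _ => 1, fun ξ => by rw [h1, h0, one_mul]⟩
    | succ l =>
      refine ⟨fun ζ => iξ ζ l, fun ξ => ?_⟩
      rw [h1, B₁_inv_mulVec_succ (hdet ξ), h0, hβ]
      simp only [Fin.succ_ne_zero, if_false, sub_zero]
  have hi := hw.integrable_mul_invFourierTest φ
  have hi0 := hw0.integrable_mul_invFourierTest φ
  rw [← sub_eq_zero, w₁, w₁, invFourier, invFourier, ← integral_sub hi hi0]
  refine (integral_prod (μ := (volume : Measure Space)) (ν := (volume : Measure ℝ)) _ (hi.sub hi0)).trans ?_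
  refine integral_eq_zero_of_ae (Eventually.of_forall fun ζ => ?_)
  have hz := congrFun (integral_slice_smul_B₀_inv_eq_zero h φ hφ ζ (g ζ)) k.2
  rw [eval_integral] at hz
  · rw [Pi.zero_apply, ← mul_zero (c ζ)]
    change _ = c ζ * (0 : Fin m → ℂ) k.2
    rw [← hz, ← integral_const_mul]
    refine integral_congr_ae (Eventually.of_forall fun r => ?_)
    simp only [Pi.sub_apply, Pi.smul_apply, smul_eq_mul]
    rw [← sub_mul, hdiff, hwave]
    ring
  · intro i
    exact (integrable_slice_smul_B₀_inv h φ T ζ (g ζ)).eval i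

end Causality
end FirstOrderSystem

namespace FirstOrderSystem

/-! ### Frames adapted to a unit vector -/

/-- The plane in which graphs are parametrized. -/
abbrev Plane := EuclideanSpace ℝ (Fin 2)

/-- An isometric splitting `ℝ² × ℝ ≃ ℝ³`. -/
structure IsFrame (P : (Plane × ℝ) ≃L[ℝ] Space) : Prop where
  inner_eq : ∀ a b, inner ℝ (P a) (P b) = inner ℝ a.1 b.1 + a.2 * b.2
  measurePreserving : MeasurePreserving P

theorem exists_isFrame {ν : Space} (hν : ‖ν‖ = 1) :
    ∃ P : (Plane × ℝ) ≃L[ℝ] Space, IsFrame P ∧ P (0, 1) = ν := by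
  obtain ⟨b, hb⟩ := Orthonormal.exists_orthonormalBasis_extension_of_card_eq (𝕜 := ℝ)
    (E := Space) (ι := Fin 3) (by simp) (v := fun _ => ν) (s := {2}) (by
      refine ⟨fun i => hν, fun i j hij => ?_⟩
      exact absurd (Subsingleton.elim i j) hij)
  have hb2 : b 2 = ν := hb 2 rfl
  let Lf : Plane × ℝ →ₗ[ℝ] Space :=
    { toFun := fun a => a.1 0 • b 0 + a.1 1 • b 1 + a.2 • b 2
      map_add' := fun a c => by
        simp only [Prod.fst_add, Prod.snd_add, PiLp.add_apply, add_smul]; abel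
      map_smul' := fun r a => by
        simp only [Prod.smul_fst, Prod.smul_snd, PiLp.smul_apply, smul_eq_mul, mul_smul,
          smul_add, RingHom.id_apply] }
  have hin : ∀ a c : Plane × ℝ, inner ℝ (Lf a) (Lf c) = inner ℝ a.1 c.1 + a.2 * c.2 := by
    intro a c
    have h1 : ∀ i j, inner ℝ (b i) (b j) = if i = j then (1 : ℝ) else 0 :=
      fun i j => b.inner_eq_ite i j
    simp only [Lf, LinearMap.coe_mk, AddHom.coe_mk, inner_add_left, inner_add_right,
      inner_smul_left, inner_smul_right, h1, PiLp.inner_apply, Fin.sum_univ_two]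
    simp
    ring
  let Li : WithLp 2 (Plane × ℝ) →ₗᵢ[ℝ] Space :=
    { toLinearMap := Lf ∘ₗ (WithLp.linearEquiv 2 ℝ (Plane × ℝ)).toLinearMap
      norm_map' := fun a => by
        have h2 : inner ℝ (Lf (WithLp.ofLp a)) (Lf (WithLp.ofLp a)) = inner ℝ a a := by
          rw [hin, WithLp.prod_inner_apply]
          simp [sq]
        rw [real_inner_self_eq_norm_sq, real_inner_self_eq_norm_sq] at h2
        exact (sq_eq_sq₀ (norm_nonneg _) (norm_nonneg _)).1 h2 }
  let Le := Li.toLinearIsometryEquiv (by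
    rw [(WithLp.linearEquiv 2 ℝ (Plane × ℝ)).finrank_eq]
    simp)
  refine ⟨(WithLp.prodContinuousLinearEquiv 2 ℝ Plane ℝ).symm.trans Le.toContinuousLinearEquiv,
    ⟨?_, ?_⟩, ?_⟩
  · intro a c
    exact hin a c
  · exact Le.measurePreserving.comp (WithLp.volume_preserving_toLp Plane ℝ)
  · change Lf (0, 1) = ν
    simp [Lf, hb2]

/-! ### Comparison of measures -/

theorem measure_le_of_locally_le {X : Type*} [TopologicalSpace X] [SecondCountableTopology X]
    [MeasurableSpace X] [OpensMeasurableSpace X] {μ ν : Measure X}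
    (h : ∀ x, ∃ U ∈ 𝓝 x, ∀ E ⊆ U, MeasurableSet E → μ E ≤ ν E) : μ ≤ ν := by
  choose U hU hle using h
  obtain ⟨t, htc, hcov⟩ := TopologicalSpace.countable_cover_nhds
    (fun x => interior_mem_nhds.2 (hU x))
  rcases isEmpty_or_nonempty X with hX | hX
  · refine Measure.le_iff.2 fun s _ => ?_
    rw [eq_empty_of_isEmpty s]; simp
  have htne : t.Nonempty := by
    rcases t.eq_empty_or_nonempty with rfl | ht
    · obtain ⟨x⟩ := hX
      have : x ∈ (univ : Set X) := mem_univ x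
      rw [← hcov] at this
      simp at this
    · exact ht
  obtain ⟨e, he⟩ := htc.exists_eq_range htne
  have hcov' : ⋃ n, interior (U (e n)) = univ := by
    rw [← hcov, he, biUnion_range]
  refine Measure.le_iff.2 fun s hs => ?_
  have hD : ∀ n, MeasurableSet (disjointed (fun n => interior (U (e n))) n) :=
    MeasurableSet.disjointed fun n => isOpen_interior.measurableSet
  have hdec : s = ⋃ n, s ∩ disjointed (fun n => interior (U (e n))) n := by
    rw [← inter_iUnion, iUnion_disjointed, hcov', inter_univ]
  have hdisj : Pairwise (Function.onFun Disjoint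
      fun n => s ∩ disjointed (fun n => interior (U (e n))) n) := fun i j hij =>
    (disjoint_disjointed _ hij).mono inter_subset_right inter_subset_right
  rw [hdec, measure_iUnion hdisj (fun n => hs.inter (hD n)),
    measure_iUnion hdisj (fun n => hs.inter (hD n))]
  refine ENNReal.tsum_le_tsum fun n => hle (e n) _ ?_ (hs.inter (hD n))
  exact inter_subset_right.trans ((disjointed_subset _ n).trans interior_subset)

theorem hausdorffMeasure_image_le_of_edist_le {X Y Z : Type*} [EMetricSpace Y] [EMetricSpace Z]
    [MeasurableSpace Y] [BorelSpace Y] [MeasurableSpace Z] [BorelSpace Z] {f : X → Y} {g : X → Z}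
    {E : Set X} {K : NNReal} {d : ℝ} (hd : 0 ≤ d)
    (h : ∀ x ∈ E, ∀ y ∈ E, edist (f x) (f y) ≤ K * edist (g x) (g y)) :
    μH[d] (f '' E) ≤ (K : ℝ≥0∞) ^ d * μH[d] (g '' E) := by
  rcases E.eq_empty_or_nonempty with rfl | ⟨x₀, hx₀⟩
  · simp
  have : Nonempty X := ⟨x₀⟩
  have hinv : ∀ x ∈ E, Function.invFunOn g E (g x) ∈ E ∧ g (Function.invFunOn g E (g x)) = g x :=
    fun x hx => ⟨Function.invFunOn_mem ⟨x, hx, rfl⟩, Function.invFunOn_eq ⟨x, hx, rfl⟩⟩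
  have hL : LipschitzOnWith K (f ∘ Function.invFunOn g E) (g '' E) := by
    rintro _ ⟨x, hx, rfl⟩ _ ⟨y, hy, rfl⟩
    have := h _ (hinv x hx).1 _ (hinv y hy).1
    rwa [(hinv x hx).2, (hinv y hy).2] at this
  have himg : f '' E ⊆ (f ∘ Function.invFunOn g E) '' (g '' E) := by
    rintro _ ⟨x, hx, rfl⟩
    refine ⟨g x, ⟨x, hx, rfl⟩, ?_⟩
    have := h _ (hinv x hx).1 x hx
    rw [(hinv x hx).2, edist_self, mul_zero] at this
    exact edist_le_zero.1 this
  exact (measure_mono himg).trans (hL.hausdorffMeasure_image_le hd)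

theorem euclideanHausdorffMeasure_image_le_of_edist_le {X Y Z : Type*} [EMetricSpace Y]
    [EMetricSpace Z] [MeasurableSpace Y] [BorelSpace Y] [MeasurableSpace Z] [BorelSpace Z]
    {f : X → Y} {g : X → Z} {E : Set X} {K : NNReal} {d : ℕ}
    (h : ∀ x ∈ E, ∀ y ∈ E, edist (f x) (f y) ≤ K * edist (g x) (g y)) :
    μHE[d] (f '' E) ≤ (K : ℝ≥0∞) ^ d * μHE[d] (g '' E) := by
  simp_rw [Measure.euclideanHausdorffMeasure_def, Measure.smul_apply, Measure.nnreal_smul_coe_apply]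
  rw [mul_left_comm]
  gcongr
  simpa using hausdorffMeasure_image_le_of_edist_le (d := d) (Nat.cast_nonneg d) h

/-! ### The area of a graph -/

section Graph

variable {P : (Plane × ℝ) ≃L[ℝ] Space} {g : Plane → ℝ}

/-- The graph of `g` in the frame `P`. -/
def graphMap (P : (Plane × ℝ) ≃L[ℝ] Space) (g : Plane → ℝ) (y : Plane) : Space := P (y, g y)

/-- The upward normal of the graph of `g` in the frame `P`, with the area density as its norm. -/
noncomputable def graphNormal (P : (Plane × ℝ) ≃L[ℝ] Space) (g : Plane → ℝ) (y : Plane) : Space :=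
  P (-gradient g y, 1)

theorem IsFrame.norm_sq (hP : IsFrame P) (a : Plane × ℝ) : ‖P a‖ ^ 2 = ‖a.1‖ ^ 2 + a.2 ^ 2 := by
  rw [← real_inner_self_eq_norm_sq, hP.inner_eq, real_inner_self_eq_norm_sq, sq a.2]

theorem IsFrame.norm_fst_le (hP : IsFrame P) (a : Plane × ℝ) : ‖a.1‖ ≤ ‖P a‖ := by
  refine abs_le_of_sq_le_sq' ?_ (norm_nonneg _) |>.2
  rw [hP.norm_sq]; nlinarith [sq_nonneg a.2]

theorem graphNormal_ne_zero (P : (Plane × ℝ) ≃L[ℝ] Space) (g : Plane → ℝ) (y : Plane) :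
    graphNormal P g y ≠ 0 := by
  intro h
  have h1 := (map_eq_zero_iff P P.injective).1 h
  exact one_ne_zero (congrArg Prod.snd h1)

theorem IsFrame.norm_graphNormal_sq (hP : IsFrame P) (g : Plane → ℝ) (y : Plane) :
    ‖graphNormal P g y‖ ^ 2 = 1 + ‖gradient g y‖ ^ 2 := by
  rw [graphNormal, hP.norm_sq]; simp [add_comm]

theorem continuous_gradient {E : Type*} [NormedAddCommGroup E] [InnerProductSpace ℝ E]
    [CompleteSpace E] {g : E → ℝ} (hg : ContDiff ℝ 1 g) : Continuous (gradient g) :=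
  (InnerProductSpace.toDual ℝ E).symm.continuous.comp (hg.continuous_fderiv one_ne_zero)

theorem inner_gradient {E : Type*} [NormedAddCommGroup E] [InnerProductSpace ℝ E]
    [CompleteSpace E] (g : E → ℝ) (x v : E) : inner ℝ (gradient g x) v = fderiv ℝ g x v := by
  rw [gradient, InnerProductSpace.toDual_symm_apply]

theorem continuous_graphNormal (P : (Plane × ℝ) ≃L[ℝ] Space) (hg : ContDiff ℝ 1 g) :
    Continuous (graphNormal P g) :=
  P.continuous.comp ((continuous_gradient hg).neg.prodMk continuous_const)

theorem continuous_graphMap (P : (Plane × ℝ) ≃L[ℝ] Space) (hg : Continuous g) :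
    Continuous (graphMap P g) :=
  P.continuous.comp (continuous_id.prodMk hg)

theorem isClosedEmbedding_graphMap (P : (Plane × ℝ) ≃L[ℝ] Space) (hg : Continuous g) :
    IsClosedEmbedding (graphMap P g) := by
  refine P.toHomeomorph.isClosedEmbedding.comp ?_
  have hinv : Function.LeftInverse Prod.fst fun y => (y, g y) := fun y => rfl
  exact hinv.isClosedEmbedding continuous_fst (continuous_id.prodMk hg)

theorem hasStrictFDerivAt_graphMap (P : (Plane × ℝ) ≃L[ℝ] Space) (hg : ContDiff ℝ 1 g)
    (y : Plane) : HasStrictFDerivAt (graphMap P g)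
      ((P : (Plane × ℝ) →L[ℝ] Space) ∘L ((ContinuousLinearMap.id ℝ Plane).prod (fderiv ℝ g y))) y := by
  have h1 : HasStrictFDerivAt g (fderiv ℝ g y) y := hg.contDiffAt.hasStrictFDerivAt one_ne_zero
  exact (P : (Plane × ℝ) →L[ℝ] Space).hasStrictFDerivAt.comp y ((hasStrictFDerivAt_id y).prodMk h1)

theorem IsFrame.normDet_graph (hP : IsFrame P) (g : Plane → ℝ) (y : Plane) :
    (((P : (Plane × ℝ) →L[ℝ] Space) ∘L ((ContinuousLinearMap.id ℝ Plane).prod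
      (fderiv ℝ g y))) : Plane →ₗ[ℝ] Space).normDet = ‖graphNormal P g y‖ := by
  rw [← sq_eq_sq₀ (LinearMap.normDet_nonneg _) (norm_nonneg _), hP.norm_graphNormal_sq]
  have h := LinearMap.normDet_sq_eq_det_gram (((P : (Plane × ℝ) →L[ℝ] Space) ∘L
    ((ContinuousLinearMap.id ℝ Plane).prod (fderiv ℝ g y))) : Plane →ₗ[ℝ] Space)
    (EuclideanSpace.basisFun (Fin 2) ℝ)
  have h2 : ‖gradient g y‖ ^ 2 = (fderiv ℝ g y (EuclideanSpace.single 0 1)) ^ 2 +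
      (fderiv ℝ g y (EuclideanSpace.single 1 1)) ^ 2 := by
    have h3 : ∀ i, fderiv ℝ g y (EuclideanSpace.single i 1) = gradient g y i := fun i => by
      rw [← inner_gradient, EuclideanSpace.inner_single_right]; simp
    rw [EuclideanSpace.norm_sq_eq, Fin.sum_univ_two, h3, h3]
    simp
  rw [h2]
  refine Eq.trans (by exact_mod_cast h) ?_
  rw [Matrix.det_fin_two]
  simp only [Matrix.gram, Matrix.of_apply, EuclideanSpace.basisFun_apply,
    ContinuousLinearMap.coe_comp, Function.comp_apply,
    ContinuousLinearMap.prod_apply, ContinuousLinearMap.coe_id', id_eq,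
    ContinuousLinearEquiv.coe_coe, hP.inner_eq]
  simp [EuclideanSpace.inner_single_left]
  ring

theorem comap_graphMap (hP : IsFrame P) (hg : ContDiff ℝ 1 g) :
    (μHE[2] : Measure Space).comap (graphMap P g) =
      volume.withDensity fun y => ENNReal.ofReal ‖graphNormal P g y‖ := by
  have hγ : MeasurableEmbedding (graphMap P g) :=
    (isClosedEmbedding_graphMap P hg.continuous).measurableEmbedding
  have hJc := (continuous_graphNormal P hg).norm
  have hJm : Measurable fun y => ENNReal.ofReal ‖graphNormal P g y‖ :=
    ENNReal.measurable_ofReal.comp hJc.measurable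
  have key : ∀ K : NNReal, 1 < K → ∀ y₀ : Plane, ∃ U ∈ 𝓝 y₀, ∀ E ⊆ U, MeasurableSet E →
      (μHE[2] : Measure Space).comap (graphMap P g) E ≤
        (K : ℝ≥0∞) ^ 3 * (volume.withDensity fun y => ENNReal.ofReal ‖graphNormal P g y‖) E ∧
      (volume.withDensity fun y => ENNReal.ofReal ‖graphNormal P g y‖) E ≤
        (K : ℝ≥0∞) ^ 3 * (μHE[2] : Measure Space).comap (graphMap P g) E := by
    intro K hK y₀
    have hK' : (1 : ℝ) < K := hK
    have hK0 : (0 : ℝ) < K := by linarith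
    set L := ((P : (Plane × ℝ) →L[ℝ] Space) ∘L
      ((ContinuousLinearMap.id ℝ Plane).prod (fderiv ℝ g y₀))) with hL
    have hLv : ∀ v, ‖v‖ ≤ ‖L v‖ := fun v => hP.norm_fst_le (v, fderiv ℝ g y₀ v)
    set ε : ℝ := 1 - (K : ℝ)⁻¹ with hε
    have hε0 : 0 < ε := by
      rw [hε, sub_pos]; exact inv_lt_one_of_one_lt₀ hK'
    have hε1 : 1 + ε ≤ K := by
      have : K * (K : ℝ)⁻¹ = 1 := mul_inv_cancel₀ hK0.ne'
      nlinarith [inv_pos.2 hK0]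
    have hε2 : K * (1 - ε) = 1 := by
      rw [hε]; field_simp; ring
    obtain ⟨W, hW, hWa⟩ := (hasStrictFDerivAt_graphMap P hg y₀).approximates_deriv_on_nhds
      (c := ε.toNNReal) (Or.inr (by simpa using hε0))
    have hJ0 : 0 < ‖graphNormal P g y₀‖ := norm_pos_iff.2 (graphNormal_ne_zero P g y₀)
    have hJ1 : ∀ᶠ y in 𝓝 y₀, ‖graphNormal P g y‖ < K * ‖graphNormal P g y₀‖ :=
      hJc.continuousAt.eventually_lt continuousAt_const (by nlinarith)
    have hJ2 : ∀ᶠ y in 𝓝 y₀, ‖graphNormal P g y₀‖ < K * ‖graphNormal P g y‖ :=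
      continuousAt_const.eventually_lt (hJc.continuousAt.const_mul (K : ℝ)) (by nlinarith)
    refine ⟨W ∩ {y | ‖graphNormal P g y‖ < K * ‖graphNormal P g y₀‖ ∧
      ‖graphNormal P g y₀‖ < K * ‖graphNormal P g y‖}, inter_mem hW (hJ1.and hJ2),
      fun E hE hEm => ?_⟩
    have happ : ∀ x ∈ E, ∀ y ∈ E,
        ‖graphMap P g x - graphMap P g y - L (x - y)‖ ≤ ε * ‖L (x - y)‖ := by
      intro x hx y hy
      have := hWa _ (hE hx).1 _ (hE hy).1
      rw [Real.coe_toNNReal _ hε0.le] at this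
      exact this.trans (mul_le_mul_of_nonneg_left (hLv _) hε0.le)
    have h1 : ∀ x ∈ E, ∀ y ∈ E,
        edist (graphMap P g x) (graphMap P g y) ≤ K * edist (L x) (L y) := by
      intro x hx y hy
      have h2 := happ x hx y hy
      have h3 := norm_le_norm_add_norm_sub (L (x - y)) (graphMap P g x - graphMap P g y)
      have h4 : ‖graphMap P g x - graphMap P g y‖ ≤ K * ‖L x - L y‖ := by
        rw [norm_sub_rev (L (x - y))] at h3
        rw [← map_sub]
        nlinarith [norm_nonneg (L (x - y))]
      rw [edist_nndist, edist_nndist, nndist_eq_nnnorm, nndist_eq_nnnorm]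
      exact_mod_cast h4
    have h1' : ∀ x ∈ E, ∀ y ∈ E,
        edist (L x) (L y) ≤ K * edist (graphMap P g x) (graphMap P g y) := by
      intro x hx y hy
      have h2 := happ x hx y hy
      have h3 := norm_le_norm_add_norm_sub (graphMap P g x - graphMap P g y) (L (x - y))
      have h4 : ‖L x - L y‖ ≤ K * ‖graphMap P g x - graphMap P g y‖ := by
        rw [← map_sub]
        have h5 : (1 - ε) * ‖L (x - y)‖ ≤ ‖graphMap P g x - graphMap P g y‖ := by
          linarith
        calc ‖L (x - y)‖ = K * ((1 - ε) * ‖L (x - y)‖) := by rw [← mul_assoc, hε2, one_mul]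
          _ ≤ _ := mul_le_mul_of_nonneg_left h5 hK0.le
      rw [edist_nndist, edist_nndist, nndist_eq_nnnorm, nndist_eq_nnnorm]
      exact_mod_cast h4
    have hLE : μHE[2] (L '' E) = ENNReal.ofReal ‖graphNormal P g y₀‖ * volume E := by
      have := LinearMap.euclideanHausdorffMeasure_image_eq_normDet_mul_volume
        (L : Plane →ₗ[ℝ] Space) E
      rw [hP.normDet_graph, finrank_euclideanSpace_fin] at this
      exact this
    rw [hγ.comap_apply, withDensity_apply _ hEm]
    constructor
    · calc μHE[2] (graphMap P g '' E) ≤ (K : ℝ≥0∞) ^ 2 * μHE[2] (L '' E) :=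
          euclideanHausdorffMeasure_image_le_of_edist_le h1
        _ = (K : ℝ≥0∞) ^ 2 * ∫⁻ _ in E, ENNReal.ofReal ‖graphNormal P g y₀‖ := by
          rw [hLE, setLIntegral_const]
        _ ≤ (K : ℝ≥0∞) ^ 2 * ∫⁻ y in E, K * ENNReal.ofReal ‖graphNormal P g y‖ := by
          refine mul_le_mul' le_rfl ?_
          refine setLIntegral_mono (hJm.const_mul _) fun y hy => ?_
          rw [← ENNReal.ofReal_coe_nnreal, ← ENNReal.ofReal_mul hK0.le]
          exact ENNReal.ofReal_le_ofReal (hE hy).2.2.le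
        _ = _ := by
          rw [lintegral_const_mul _ hJm, ← mul_assoc, ← pow_succ]
    · calc ∫⁻ y in E, ENNReal.ofReal ‖graphNormal P g y‖ ≤
              ∫⁻ _ in E, K * ENNReal.ofReal ‖graphNormal P g y₀‖ := by
            refine setLIntegral_mono measurable_const fun y hy => ?_
            rw [← ENNReal.ofReal_coe_nnreal, ← ENNReal.ofReal_mul hK0.le]
            exact ENNReal.ofReal_le_ofReal (hE hy).2.1.le
        _ = K * μHE[2] (L '' E) := by rw [hLE, setLIntegral_const, mul_assoc]
        _ ≤ K * ((K : ℝ≥0∞) ^ 2 * μHE[2] (graphMap P g '' E)) := by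
          gcongr
          exact euclideanHausdorffMeasure_image_le_of_edist_le h1'
        _ = _ := by rw [← mul_assoc, ← pow_succ']
  have hlim : ∀ μ ν : Measure Plane, (∀ K : NNReal, 1 < K → ∀ y₀ : Plane, ∃ U ∈ 𝓝 y₀, ∀ E ⊆ U,
      MeasurableSet E → μ E ≤ (K : ℝ≥0∞) ^ 3 * ν E) → μ ≤ ν := by
    intro μ ν h
    refine Measure.le_iff.2 fun s hs => ?_
    have hK : ∀ K : NNReal, 1 < K → μ s ≤ (K : ℝ≥0∞) ^ 3 * ν s := by
      intro K hK
      have := measure_le_of_locally_le (μ := μ) (ν := (K : ℝ≥0∞) ^ 3 • ν) (h K hK)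
      simpa using this s
    have ht : Tendsto (fun K : NNReal => (K : ℝ≥0∞) ^ 3 * ν s) (𝓝[>] 1) (𝓝 (1 * ν s)) := by
      refine ENNReal.Tendsto.mul_const ?_ (Or.inl one_ne_zero)
      have hc : Continuous fun K : NNReal => (K : ℝ≥0∞) ^ 3 :=
        (ENNReal.continuous_pow 3).comp ENNReal.continuous_coe
      have := (hc.tendsto 1).mono_left (nhdsWithin_le_nhds (s := Ioi 1))
      simpa using this
    rw [one_mul] at ht
    exact ge_of_tendsto ht (eventually_nhdsWithin_of_forall fun K h => hK K h)
  refine le_antisymm (hlim _ _ fun K hK y₀ => ?_) (hlim _ _ fun K hK y₀ => ?_)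
  · obtain ⟨U, hU, h⟩ := key K hK y₀
    exact ⟨U, hU, fun E hE hEm => (h E hE hEm).1⟩
  · obtain ⟨U, hU, h⟩ := key K hK y₀
    exact ⟨U, hU, fun E hE hEm => (h E hE hEm).2⟩

/-- The area formula for the graph of a `C¹` function. -/
theorem restrict_range_graphMap (hP : IsFrame P) (hg : ContDiff ℝ 1 g) :
    (μHE[2] : Measure Space).restrict (range (graphMap P g)) =
      (volume.withDensity fun y => ENNReal.ofReal ‖graphNormal P g y‖).map (graphMap P g) := by
  rw [← comap_graphMap hP hg,
    (isClosedEmbedding_graphMap P hg.continuous).measurableEmbedding.map_comap]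

end Graph
end FirstOrderSystem

namespace FirstOrderSystem

/-! ### Uniqueness of the outward normal -/

theorem eventually_lt_of_fderiv_neg {E : Type*} [NormedAddCommGroup E] [NormedSpace ℝ E]
    {ρ : E → ℝ} {x v : E} (hρ : DifferentiableAt ℝ ρ x) (h : fderiv ℝ ρ x v < 0) :
    ∀ᶠ t : ℝ in 𝓝[>] 0, ρ (x + t • v) < ρ x := by
  have h1 : HasDerivAt (fun t : ℝ => ρ (x + t • v)) (fderiv ℝ ρ x v) 0 := by
    have h2 : HasDerivAt (fun t : ℝ => x + t • v) v 0 := by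
      simpa using ((hasDerivAt_id (0 : ℝ)).smul_const v).const_add x
    have h3 : HasFDerivAt ρ (fderiv ℝ ρ x) (x + (0 : ℝ) • v) := by simpa using hρ.hasFDerivAt
    exact h3.comp_hasDerivAt 0 h2
  have h2 := (hasDerivAt_iff_tendsto_slope.1 h1).eventually_lt_const h
  have h3 : 𝓝[>] (0 : ℝ) ≤ 𝓝[≠] 0 := nhdsWithin_mono _ fun t ht => ne_of_gt ht
  filter_upwards [h3 h2, self_mem_nhdsWithin] with t ht ht0
  rw [slope_def_field, zero_smul, add_zero, sub_zero, div_lt_iff₀ ht0, zero_mul, sub_neg] at ht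
  exact ht

theorem tendsto_add_smul {E : Type*} [NormedAddCommGroup E] [NormedSpace ℝ E] (x v : E) :
    Tendsto (fun t : ℝ => x + t • v) (𝓝[>] 0) (𝓝 x) := by
  have h : Continuous fun t : ℝ => x + t • v := by fun_prop
  have := (h.tendsto 0).mono_left (nhdsWithin_le_nhds (s := Ioi 0))
  simpa using this

theorem IsOutwardNormal.norm_eq_one {Ω : Set Space} {x ν : Space} (h : IsOutwardNormal Ω x ν) :
    ‖ν‖ = 1 := by
  obtain ⟨ρ, hρ, rfl⟩ := h
  rw [norm_smul, norm_inv, norm_norm, inv_mul_cancel₀ (norm_ne_zero_iff.2 hρ.gradient_ne_zero)]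

theorem IsOutwardNormal.unique {Ω : Set Space} {x ν₁ ν₂ : Space} (h₁ : IsOutwardNormal Ω x ν₁)
    (h₂ : IsOutwardNormal Ω x ν₂) : ν₁ = ν₂ := by
  by_contra hne
  have n1 := h₁.norm_eq_one
  have n2 := h₂.norm_eq_one
  have hlt : inner ℝ ν₁ ν₂ < 1 := by
    rcases lt_or_eq_of_le (real_inner_le_norm ν₁ ν₂) with h | h
    · simpa [n1, n2] using h
    · rw [n1, n2, mul_one] at h
      exact absurd ((inner_eq_one_iff_of_norm_eq_one (𝕜 := ℝ) n1 n2).1 h) hne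
  obtain ⟨ρ₁, hρ₁, rfl⟩ := h₁
  obtain ⟨ρ₂, hρ₂, rfl⟩ := h₂
  set ν₁ := ‖gradient ρ₁ x‖⁻¹ • gradient ρ₁ x with hν₁
  set ν₂ := ‖gradient ρ₂ x‖⁻¹ • gradient ρ₂ x with hν₂
  have hp1 : 0 < ‖gradient ρ₁ x‖ := norm_pos_iff.2 hρ₁.gradient_ne_zero
  have hp2 : 0 < ‖gradient ρ₂ x‖ := norm_pos_iff.2 hρ₂.gradient_ne_zero
  have hg1 : gradient ρ₁ x = ‖gradient ρ₁ x‖ • ν₁ := by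
    rw [hν₁, smul_smul, mul_inv_cancel₀ hp1.ne', one_smul]
  have hg2 : gradient ρ₂ x = ‖gradient ρ₂ x‖ • ν₂ := by
    rw [hν₂, smul_smul, mul_inv_cancel₀ hp2.ne', one_smul]
  have d1 : fderiv ℝ ρ₁ x (ν₂ - ν₁) < 0 := by
    rw [← inner_gradient, hg1, inner_smul_left, inner_sub_right, real_inner_self_eq_norm_sq, n1]
    simp only [conj_trivial]
    nlinarith
  have d2 : fderiv ℝ (-ρ₂) x (ν₂ - ν₁) < 0 := by
    rw [fderiv_neg, neg_apply, ← inner_gradient, hg2, inner_smul_left, inner_sub_right,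
      real_inner_self_eq_norm_sq, n2, real_inner_comm]
    simp only [conj_trivial]
    nlinarith
  have e1 := eventually_lt_of_fderiv_neg (hρ₁.contDiffAt.differentiableAt one_ne_zero) d1
  have e2 := eventually_lt_of_fderiv_neg (hρ₂.contDiffAt.differentiableAt one_ne_zero).neg d2
  have e3 := (tendsto_add_smul x (ν₂ - ν₁)).eventually (hρ₁.mem_iff.and hρ₂.mem_iff)
  obtain ⟨t, ht1, ht2, ht3, ht4⟩ := (e1.and (e2.and e3)).exists
  rw [hρ₁.eq_zero] at ht1
  simp only [Pi.neg_apply, hρ₂.eq_zero, neg_zero, neg_lt_zero] at ht2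
  exact absurd (ht4.1 (ht3.2 ht1)) ht2.not_gt

theorem IsOutwardNormal.outwardNormal_eq {Ω : Set Space} {x ν : Space}
    (h : IsOutwardNormal Ω x ν) : outwardNormal Ω x = ν := by
  have h' : ∃ ν, IsOutwardNormal Ω x ν := ⟨ν, h⟩
  rw [outwardNormal, dif_pos h']
  exact h'.choose_spec.unique h

theorem norm_outwardNormal_le (Ω : Set Space) (x : Space) : ‖outwardNormal Ω x‖ ≤ 1 := by
  by_cases h : ∃ ν, IsOutwardNormal Ω x ν
  · rw [outwardNormal, dif_pos h]
    exact h.choose_spec.norm_eq_one.le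
  · rw [outwardNormal, dif_neg h]
    simp

/-! ### Charts -/

/-- In the open set `V`, and in the coordinates `P`, the domain `Ω` is the subgraph of `g`. -/
structure IsChart (Ω : Set Space) (V : Set Space) (P : (Plane × ℝ) ≃L[ℝ] Space) (g : Plane → ℝ) :
    Prop where
  isFrame : IsFrame P
  contDiff : ContDiff ℝ 1 g
  isOpen : IsOpen V
  mem_iff : ∀ a : Plane × ℝ, P a ∈ V → (P a ∈ Ω ↔ a.2 < g a.1)

theorem IsLocalDefiningFunction.exists_isChart {Ω : Set Space} {x₀ : Space} {ρ : Space → ℝ}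
    (h : IsLocalDefiningFunction Ω x₀ ρ) :
    ∃ V P g, IsChart Ω V P g ∧ x₀ ∈ V ∧ P (0, 1) = ‖gradient ρ x₀‖⁻¹ • gradient ρ x₀ := by
  set ν := ‖gradient ρ x₀‖⁻¹ • gradient ρ x₀ with hν
  have hν1 : ‖ν‖ = 1 := IsOutwardNormal.norm_eq_one ⟨ρ, h, rfl⟩
  obtain ⟨P, hP, hPν⟩ := exists_isFrame hν1
  set F : Plane × ℝ → ℝ := fun a => ρ (P a) with hF
  set a₀ : Plane × ℝ := P.symm x₀ with ha₀
  have hPa : P a₀ = x₀ := P.apply_symm_apply x₀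
  have hFc : ContDiffAt ℝ 1 F a₀ := by
    refine ContDiffAt.comp a₀ (g := ρ) ?_ P.contDiff.contDiffAt
    rw [hPa]; exact h.contDiffAt
  have hF0 : F a₀ = 0 := by rw [hF]; simp only [hPa]; exact h.eq_zero
  have hd : 0 < fderiv ℝ F a₀ (0, 1) := by
    have h1 : HasFDerivAt ρ (fderiv ℝ ρ x₀) (P a₀) := by
      rw [hPa]; exact (h.contDiffAt.differentiableAt one_ne_zero).hasFDerivAt
    have h2 : HasFDerivAt F ((fderiv ℝ ρ x₀).comp (P : (Plane × ℝ) →L[ℝ] Space)) a₀ :=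
      h1.comp a₀ P.hasFDerivAt
    rw [h2.fderiv]
    simp only [ContinuousLinearMap.comp_apply, ContinuousLinearEquiv.coe_coe, hPν]
    have hp : 0 < ‖gradient ρ x₀‖ := norm_pos_iff.2 h.gradient_ne_zero
    rw [← inner_gradient, hν, inner_smul_right, real_inner_self_eq_norm_sq]
    positivity
  have hinv : (fderiv ℝ F a₀ ∘L .inr ℝ Plane ℝ).IsInvertible := by
    refine ⟨ContinuousLinearEquiv.unitsEquivAut ℝ (Units.mk0 _ hd.ne'), ?_⟩
    ext
    simp
  set g := hFc.implicitFunction one_ne_zero hinv with hg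
  have hgc : ContDiffAt ℝ 1 g a₀.1 := hFc.contDiffAt_implicitFunction one_ne_zero hinv
  have hg0 : g a₀.1 = a₀.2 := hFc.implicitFunction_apply_self one_ne_zero hinv
  have hFg : ∀ᶠ y in 𝓝 a₀.1, F (y, g y) = 0 := by
    have := hFc.eventually_apply_implicitFunction one_ne_zero hinv
    rwa [hF0] at this
  -- the function is increasing in the vertical direction
  have hev : ∀ᶠ a in 𝓝 a₀, DifferentiableAt ℝ F a ∧ 0 < fderiv ℝ F a (0, 1) ∧
      (P a ∈ Ω ↔ F a < 0) := by
    have h1 : ∀ᶠ a in 𝓝 a₀, ContDiffAt ℝ 1 F a := hFc.eventually (by simp)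
    have h2 : ContinuousAt (fun a => fderiv ℝ F a (0, 1)) a₀ :=
      (hFc.fderiv_right (m := 0) (by simp)).continuousAt.clm_apply continuousAt_const
    have h3 : ∀ᶠ a in 𝓝 a₀, (P a ∈ Ω ↔ ρ (P a) < 0) := by
      have := P.continuous.tendsto a₀
      rw [hPa] at this
      exact this.eventually h.mem_iff
    filter_upwards [h1, h2.eventually_const_lt hd, h3] with a ha1 ha2 ha3
    exact ⟨ha1.differentiableAt one_ne_zero, ha2, ha3⟩
  obtain ⟨r, hr, hball⟩ := Metric.eventually_nhds_iff_ball.1 hev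
  have hgev : ∀ᶠ y in 𝓝 a₀.1, ContDiffAt ℝ 1 g y := hgc.eventually (by simp)
  have hgr : ∀ᶠ y in 𝓝 a₀.1, g y ∈ Metric.ball a₀.2 r := by
    have := hgc.continuousAt.tendsto
    rw [hg0] at this
    exact this (Metric.ball_mem_nhds _ hr)
  obtain ⟨δ, hδ, hδball⟩ := Metric.eventually_nhds_iff_ball.1 (hgev.and (hgr.and hFg))
  let χ : ContDiffBump a₀.1 := ⟨δ / 3, δ / 2, by positivity, by linarith⟩
  have hχ : ContDiff ℝ 1 fun y => χ y * g y := by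
    rw [contDiff_iff_contDiffAt]
    intro y
    by_cases hy : y ∈ Metric.ball a₀.1 δ
    · exact χ.contDiffAt.mul (hδball y hy).1
    · have h0 : (fun y => χ y * g y) =ᶠ[𝓝 y] fun _ => 0 := by
        have hy' : y ∈ (Metric.closedBall a₀.1 (δ / 2))ᶜ := by
          simp only [Metric.mem_ball, not_lt, mem_compl_iff, Metric.mem_closedBall, not_le] at hy ⊢
          linarith
        filter_upwards [Metric.isClosed_closedBall.isOpen_compl.mem_nhds hy'] with z hz
        have : χ z = 0 := χ.zero_of_le_dist (not_le.1 (fun hle => hz (Metric.mem_closedBall.2 hle))).le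
        rw [this, zero_mul]
      exact contDiffAt_const.congr_of_eventuallyEq h0
  refine ⟨P '' (Metric.ball a₀.1 (min (δ / 3) r) ×ˢ Metric.ball a₀.2 r), P, fun y => χ y * g y,
    ⟨hP, hχ, ?_, ?_⟩, ?_, hPν⟩
  · exact P.toHomeomorph.isOpenMap _ (Metric.isOpen_ball.prod Metric.isOpen_ball)
  · rintro ⟨y, τ⟩ ha
    obtain ⟨a, ⟨ha1, ha2⟩, hae⟩ := ha
    obtain rfl := P.injective hae
    simp only at ha1 ha2
    rw [Metric.mem_ball, lt_min_iff] at ha1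
    have hχ1 : χ y = 1 := χ.one_of_mem_closedBall (Metric.mem_closedBall.2 ha1.1.le)
    have hyδ : y ∈ Metric.ball a₀.1 δ := Metric.mem_ball.2 (by linarith)
    obtain ⟨-, hgy, hFy⟩ := hδball y hyδ
    have hmem : ∀ s ∈ Metric.ball a₀.2 r, (y, s) ∈ Metric.ball a₀ r := fun s hs =>
      max_lt ha1.2 hs
    rw [(hball _ (hmem τ ha2)).2.2, hχ1, one_mul, ← hFy]
    have hder : ∀ s ∈ Metric.ball a₀.2 r,
        HasDerivAt (fun s => F (y, s)) (fderiv ℝ F (y, s) (0, 1)) s := fun s hs =>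
      (hball _ (hmem s hs)).1.hasFDerivAt.comp_hasDerivAt s
        ((hasDerivAt_const s y).prodMk (hasDerivAt_id s))
    have hmono : StrictMonoOn (fun s => F (y, s)) (Metric.ball a₀.2 r) := by
      refine strictMonoOn_of_deriv_pos (convex_ball _ _)
        (fun s hs => (hder s hs).continuousAt.continuousWithinAt) fun s hs => ?_
      have hs' := interior_subset hs
      rw [(hder s hs').deriv]
      exact (hball _ (hmem s hs')).2.1
    exact hmono.lt_iff_lt ha2 hgy
  · refine ⟨a₀, ⟨Metric.mem_ball_self (by positivity), Metric.mem_ball_self hr⟩, hPa⟩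

namespace IsChart

variable {Ω V : Set Space} {P : (Plane × ℝ) ≃L[ℝ] Space} {g : Plane → ℝ}

theorem isLocalDefiningFunction (h : IsChart Ω V P g) {y : Plane} (hy : graphMap P g y ∈ V) :
    IsLocalDefiningFunction Ω (graphMap P g y)
      (fun x => (P.symm x).2 - g (P.symm x).1) ∧
    gradient (fun x => (P.symm x).2 - g (P.symm x).1) (graphMap P g y) = graphNormal P g y := by
  have hsymm : P.symm (graphMap P g y) = (y, g y) := P.symm_apply_apply _
  have hgrad : gradient (fun x => (P.symm x).2 - g (P.symm x).1) (graphMap P g y) =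
      graphNormal P g y := by
    refine HasGradientAt.gradient ?_
    rw [hasGradientAt_iff_hasFDerivAt]
    have h1 : HasFDerivAt g (fderiv ℝ g y) (P.symm (graphMap P g y)).1 := by
      rw [hsymm]
      exact (h.contDiff.differentiable one_ne_zero y).hasFDerivAt
    have h2 : HasFDerivAt (fun x => P.symm x) (P.symm : Space →L[ℝ] Plane × ℝ)
      (graphMap P g y) := P.symm.hasFDerivAt
    have h3 := h2.snd.sub (h1.comp (graphMap P g y) (f := fun x => (P.symm x).1) h2.fst)
    convert! h3 using 1
    ext v
    have h4 := h.isFrame.inner_eq (-gradient g y, 1) (P.symm v)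
    rw [P.apply_symm_apply] at h4
    rw [InnerProductSpace.toDual_apply_apply, graphNormal, h4, inner_neg_left, inner_gradient,
      one_mul]
    simp only [sub_apply, ContinuousLinearMap.comp_apply, ContinuousLinearMap.coe_fst',
      ContinuousLinearMap.coe_snd', ContinuousLinearEquiv.coe_coe]
    ring
  refine ⟨⟨?_, ?_, ?_, ?_⟩, hgrad⟩
  · have hc : ContDiff ℝ 1 fun x => (P.symm x).2 - g (P.symm x).1 :=
      P.symm.contDiff.snd.sub (h.contDiff.comp P.symm.contDiff.fst)
    exact hc.contDiffAt
  · simp only [hsymm, sub_self]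
  · rw [hgrad]; exact graphNormal_ne_zero P g y
  · filter_upwards [h.isOpen.mem_nhds hy] with x hx
    have := h.mem_iff (P.symm x)
    rw [P.apply_symm_apply] at this
    rw [this hx, sub_neg]

theorem outwardNormal_graphMap (h : IsChart Ω V P g) {y : Plane} (hy : graphMap P g y ∈ V) :
    outwardNormal Ω (graphMap P g y) = ‖graphNormal P g y‖⁻¹ • graphNormal P g y := by
  obtain ⟨h1, h2⟩ := h.isLocalDefiningFunction hy
  exact IsOutwardNormal.outwardNormal_eq ⟨_, h1, by rw [h2]⟩

theorem mem_frontier_iff (h : IsChart Ω V P g) {a : Plane × ℝ} (ha : P a ∈ V) :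
    P a ∈ frontier Ω ↔ a.2 = g a.1 := by
  have hc : Continuous fun x : Space => (P.symm x).2 := continuous_snd.comp P.symm.continuous
  have hc' : Continuous fun x : Space => g (P.symm x).1 :=
    h.contDiff.continuous.comp (continuous_fst.comp P.symm.continuous)
  have hmem : ∀ x ∈ V, (x ∈ Ω ↔ (P.symm x).2 < g (P.symm x).1) := fun x hx => by
    simpa using h.mem_iff (P.symm x) (by simpa using hx)
  constructor
  · intro hf
    rcases lt_trichotomy a.2 (g a.1) with hlt | heq | hgt
    · exfalso
      have : P a ∈ interior Ω := by
        rw [mem_interior_iff_mem_nhds]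
        have hl : ∀ᶠ x in 𝓝 (P a), (P.symm x).2 < g (P.symm x).1 :=
          hc.continuousAt.eventually_lt hc'.continuousAt (by simpa using hlt)
        filter_upwards [h.isOpen.mem_nhds ha, hl] with x hx hx'
        exact (hmem x hx).2 hx'
      exact hf.2 this
    · exact heq
    · exfalso
      have hl : ∀ᶠ x in 𝓝 (P a), g (P.symm x).1 < (P.symm x).2 :=
        hc'.continuousAt.eventually_lt hc.continuousAt (by simpa using hgt)
      have hn : ∀ᶠ x in 𝓝 (P a), x ∉ Ω := by
        filter_upwards [h.isOpen.mem_nhds ha, hl] with x hx hx' hxΩ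
        exact absurd ((hmem x hx).1 hxΩ) hx'.not_gt
      exact (mem_closure_iff_frequently.1 hf.1) hn
  · intro heq
    have hgm : P a = graphMap P g a.1 := by rw [graphMap, ← heq]
    refine ⟨?_, fun hi => ?_⟩
    · rw [mem_closure_iff_frequently]
      have ht := tendsto_add_smul (P a) (-P (0, 1))
      have hev : ∀ᶠ t : ℝ in 𝓝[>] 0, P a + t • -P (0, 1) ∈ Ω := by
        filter_upwards [ht (h.isOpen.mem_nhds ha), self_mem_nhdsWithin] with t ht ht0
        refine (hmem _ ht).2 ?_
        have he : P a + t • -P (0, 1) = P (a.1, a.2 - t) := by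
          rw [← map_neg, ← map_smul, ← map_add]
          congr 1
          ext <;> simp [sub_eq_add_neg]
        simp only [he, P.symm_apply_apply, heq]
        linarith [show (0 : ℝ) < t from ht0]
      exact ht.frequently hev.frequently
    · have := (hmem _ ha).1 (interior_subset hi)
      simp [heq] at this

theorem frontier_inter (h : IsChart Ω V P g) : frontier Ω ∩ V = range (graphMap P g) ∩ V := by
  ext x
  obtain ⟨a, rfl⟩ := P.surjective x
  constructor
  · rintro ⟨hf, hV⟩
    exact ⟨⟨a.1, by rw [graphMap, ← (h.mem_frontier_iff hV).1 hf]⟩, hV⟩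
  · rintro ⟨⟨y, hy⟩, hV⟩
    obtain rfl := P.injective hy
    exact ⟨(h.mem_frontier_iff hV).2 rfl, hV⟩

end IsChart
end FirstOrderSystem

namespace FirstOrderSystem

/-! ### Coordinates that flatten the boundary -/

section Shear

variable {P : (Plane × ℝ) ≃L[ℝ] Space} {g : Plane → ℝ}

/-- The coordinates `(y, σ) ↦ P (y, g y - σ)`, with `σ` the depth below the graph of `g`. -/
def graphShear (P : (Plane × ℝ) ≃L[ℝ] Space) (hg : Continuous g) : Plane × ℝ ≃ₜ Space where
  toFun a := P (a.1, g a.1 - a.2)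
  invFun x := ((P.symm x).1, g (P.symm x).1 - (P.symm x).2)
  left_inv a := by simp
  right_inv x := by simp
  continuous_toFun := by fun_prop
  continuous_invFun := by fun_prop

@[simp] theorem graphShear_apply (hg : Continuous g) (a : Plane × ℝ) :
    graphShear P hg a = P (a.1, g a.1 - a.2) := rfl

theorem IsFrame.measurePreserving_graphShear (hP : IsFrame P) (hg : Continuous g) :
    MeasurePreserving (graphShear P hg) := by
  have h1 : MeasurePreserving (fun a : Plane × ℝ => (a.1, g a.1 - a.2)) :=
    (MeasurePreserving.id (volume : Measure Plane)).skew_product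
      (g := fun y s => g y - s) (by
        have : Continuous (Function.uncurry fun (y : Plane) (s : ℝ) => g y - s) := by
          simp only [Function.uncurry_def]; fun_prop
        exact this.measurable)
      (Eventually.of_forall fun y => (Measure.measurePreserving_sub_left volume (g y)).map_eq)
  exact hP.measurePreserving.comp h1

/-- The coordinates `((y, t), σ) ↦ (P (y, g y - σ), t)` of space-time. -/
def timeShear (P : (Plane × ℝ) ≃L[ℝ] Space) (hg : Continuous g) :
    (Plane × ℝ) × ℝ ≃ₜ SpaceTime where
  toFun a := (P (a.1.1, g a.1.1 - a.2), a.1.2)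
  invFun x := (((P.symm x.1).1, x.2), g (P.symm x.1).1 - (P.symm x.1).2)
  left_inv a := by simp
  right_inv x := by simp
  continuous_toFun := by fun_prop
  continuous_invFun := by fun_prop

@[simp] theorem timeShear_apply (hg : Continuous g) (a : (Plane × ℝ) × ℝ) :
    timeShear P hg a = (P (a.1.1, g a.1.1 - a.2), a.1.2) := rfl

theorem IsFrame.measurePreserving_timeShear (hP : IsFrame P) (hg : Continuous g) :
    MeasurePreserving (timeShear P hg) := by
  have h1 : MeasurePreserving (fun a : (Plane × ℝ) × ℝ => (a.1.1, (a.1.2, a.2))) :=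
    volume_preserving_prodAssoc
  have h2 : MeasurePreserving (Prod.map id Prod.swap : Plane × ℝ × ℝ → Plane × ℝ × ℝ) :=
    (MeasurePreserving.id volume).prod Measure.measurePreserving_swap
  have h3 : MeasurePreserving (fun a : Plane × ℝ × ℝ => ((a.1, a.2.1), a.2.2)) :=
    (volume_preserving_prodAssoc (α₁ := Plane) (β₁ := ℝ) (γ₁ := ℝ)).symm
  have h4 : MeasurePreserving (Prod.map (graphShear P hg) id : (Plane × ℝ) × ℝ → Space × ℝ) :=
    (hP.measurePreserving_graphShear hg).prod (MeasurePreserving.id volume)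
  exact h4.comp (h3.comp (h2.comp h1))

end Shear

/-- In the coordinates `(y, σ) ↦ P (y, g y - σ)`, the box of size `r` around `(y₀, 0)` is a chart
of `Ω`. -/
structure IsBoxChart (Ω : Set Space) (P : (Plane × ℝ) ≃L[ℝ] Space) (g : Plane → ℝ)
    (y₀ : Plane) (r : ℝ) : Prop where
  isFrame : IsFrame P
  contDiff : ContDiff ℝ 1 g
  pos : 0 < r
  mem_iff : ∀ y ∈ Metric.ball y₀ r, ∀ σ ∈ Ioo (-r) r, (P (y, g y - σ) ∈ Ω ↔ 0 < σ)

/-- The open set covered by a box chart. -/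
def boxSet (P : (Plane × ℝ) ≃L[ℝ] Space) (g : Plane → ℝ) (y₀ : Plane) (r : ℝ) : Set Space :=
  {x | (P.symm x).1 ∈ Metric.ball y₀ r ∧ g (P.symm x).1 - (P.symm x).2 ∈ Ioo (-r) r}

theorem IsChart.exists_isBoxChart {Ω V : Set Space} {P : (Plane × ℝ) ≃L[ℝ] Space} {g : Plane → ℝ}
    (h : IsChart Ω V P g) {x₀ : Space} (hx₀ : x₀ ∈ frontier Ω) (hV : x₀ ∈ V) {O : Set Space}
    (hO : O ∈ 𝓝 x₀) : ∃ y₀ r, IsBoxChart Ω P g y₀ r ∧ x₀ ∈ boxSet P g y₀ r ∧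
      boxSet P g y₀ r ⊆ O := by
  set e := graphShear P h.contDiff.continuous with he
  have hg0 : (P.symm x₀).2 = g (P.symm x₀).1 :=
    (h.mem_frontier_iff (a := P.symm x₀) (by simpa using hV)).1 (by simpa using hx₀)
  set y₀ := (P.symm x₀).1 with hy₀
  have hex : e (y₀, 0) = x₀ := by
    rw [he, graphShear_apply, sub_zero, ← hg0, hy₀]
    exact P.apply_symm_apply x₀
  have hnhds : e ⁻¹' (V ∩ O) ∈ 𝓝 (y₀, (0 : ℝ)) :=
    e.continuous.continuousAt.preimage_mem_nhds (by
      rw [hex]; exact inter_mem (h.isOpen.mem_nhds hV) hO)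
  obtain ⟨r, hr, hball⟩ := Metric.mem_nhds_iff.1 hnhds
  have hmem : ∀ y ∈ Metric.ball y₀ r, ∀ σ ∈ Ioo (-r) r, P (y, g y - σ) ∈ V ∩ O := by
    intro y hy σ hσ
    have : (y, σ) ∈ Metric.ball (y₀, (0 : ℝ)) r := by
      rw [← ball_prod_same]
      refine ⟨hy, ?_⟩
      rw [Metric.mem_ball]
      rw [Real.dist_eq, sub_zero]
      exact abs_lt.2 hσ
    exact hball this
  refine ⟨y₀, r, ⟨h.isFrame, h.contDiff, hr, fun y hy σ hσ => ?_⟩, ?_, ?_⟩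
  · rw [h.mem_iff _ (hmem y hy σ hσ).1]
    simp
  · refine ⟨Metric.mem_ball_self hr, ?_⟩
    rw [← hy₀, hg0, sub_self]
    exact ⟨by linarith, hr⟩
  · rintro x ⟨hx1, hx2⟩
    have := (hmem _ hx1 _ hx2).2
    simpa using this

theorem isOpen_boxSet {P : (Plane × ℝ) ≃L[ℝ] Space} {g : Plane → ℝ} (hg : Continuous g)
    (y₀ : Plane) (r : ℝ) : IsOpen (boxSet P g y₀ r) := by
  have h1 : Continuous fun x => (P.symm x).1 := by fun_prop
  have h2 : Continuous fun x => g (P.symm x).1 - (P.symm x).2 := by fun_prop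
  exact (Metric.isOpen_ball.preimage h1).inter (isOpen_Ioo.preimage h2)

namespace IsBoxChart

variable {Ω : Set Space} {P : (Plane × ℝ) ≃L[ℝ] Space} {g : Plane → ℝ} {y₀ : Plane} {r : ℝ}

theorem isChart (h : IsBoxChart Ω P g y₀ r) : IsChart Ω (boxSet P g y₀ r) P g where
  isFrame := h.isFrame
  contDiff := h.contDiff
  isOpen := isOpen_boxSet h.contDiff.continuous y₀ r
  mem_iff := fun a ha => by
    obtain ⟨h1, h2⟩ := ha
    rw [P.symm_apply_apply] at h1 h2
    have := h.mem_iff _ h1 _ h2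
    rw [sub_sub_cancel, sub_pos] at this
    exact this

theorem graphMap_mem (h : IsBoxChart Ω P g y₀ r) {y : Plane} :
    graphMap P g y ∈ boxSet P g y₀ r ↔ y ∈ Metric.ball y₀ r := by
  simp [boxSet, graphMap, h.pos]

theorem exists_norm_graphNormal_le (h : IsBoxChart Ω P g y₀ r) :
    ∃ c : ℝ, ∀ y ∈ Metric.ball y₀ r, ‖graphNormal P g y‖ ≤ c := by
  obtain ⟨c, hc⟩ := (isCompact_closedBall y₀ r).exists_bound_of_continuousOn
    (continuous_graphNormal P h.contDiff).continuousOn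
  exact ⟨c, fun y hy => hc y (Metric.ball_subset_closedBall hy)⟩

/-- The surface measure in a box chart. -/
theorem restrict_frontier (h : IsBoxChart Ω P g y₀ r) :
    (μHE[2] : Measure Space).restrict (frontier Ω ∩ boxSet P g y₀ r) =
      ((volume.restrict (Metric.ball y₀ r)).withDensity
        fun y => ENNReal.ofReal ‖graphNormal P g y‖).map (graphMap P g) := by
  have hγ := (isClosedEmbedding_graphMap P h.contDiff.continuous).measurableEmbedding
  have hpre : graphMap P g ⁻¹' boxSet P g y₀ r = Metric.ball y₀ r := by
    ext y; exact h.graphMap_mem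
  rw [h.isChart.frontier_inter, inter_comm,
    ← Measure.restrict_restrict (isOpen_boxSet h.contDiff.continuous y₀ r).measurableSet,
    restrict_range_graphMap h.isFrame h.contDiff, hγ.restrict_map, hpre,
    restrict_withDensity measurableSet_ball]

end IsBoxChart
end FirstOrderSystem

namespace FirstOrderSystem

/-! ### One-sided traces of functions with a square-integrable derivative -/

theorem sq_integral_le {X : Type*} [MeasurableSpace X] {μ : Measure X} [IsFiniteMeasure μ]
    {a : X → ℝ} (ha : Integrable a μ) (ha2 : Integrable (fun x => a x ^ 2) μ) :
    (∫ x, a x ∂μ) ^ 2 ≤ μ.real univ * ∫ x, a x ^ 2 ∂μ := by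
  rcases eq_or_ne (μ.real univ) 0 with h0 | h0
  · have : μ = 0 := by simpa [measureReal_eq_zero_iff] using h0
    simp [this]
  have hpos : 0 < μ.real univ := lt_of_le_of_ne measureReal_nonneg h0.symm
  set c := (μ.real univ)⁻¹ * ∫ x, a x ∂μ with hc
  have h1 : 0 ≤ ∫ x, (a x - c) ^ 2 ∂μ := integral_nonneg fun x => sq_nonneg _
  have h2 : ∫ x, (a x - c) ^ 2 ∂μ =
      (∫ x, a x ^ 2 ∂μ) - 2 * c * (∫ x, a x ∂μ) + μ.real univ * c ^ 2 := by
    have e : ∀ x, (a x - c) ^ 2 = a x ^ 2 - 2 * c * a x + c ^ 2 := fun x => by ring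
    simp only [e]
    have h3 : Integrable (fun x => a x ^ 2 - 2 * c * a x) μ := ha2.sub (ha.const_mul _)
    rw [integral_add h3 (integrable_const _), integral_sub ha2
      (ha.const_mul _), integral_const_mul, integral_const, smul_eq_mul]
  rw [h2] at h1
  have h3 : μ.real univ * c = ∫ x, a x ∂μ := by
    rw [hc, ← mul_assoc, mul_inv_cancel₀ h0, one_mul]
  have h4 : (∫ x, a x ∂μ) ^ 2 = μ.real univ * (2 * c * (∫ x, a x ∂μ) - μ.real univ * c ^ 2) := by
    rw [← h3]; ring
  rw [h4]
  exact mul_le_mul_of_nonneg_left (by linarith) hpos.le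

theorem tendsto_eLpNorm_two_zero {X : Type*} [MeasurableSpace X] {μ : Measure X} {E : Type*}
    [NormedAddCommGroup E] {I : X → ℝ} (hI : Integrable I μ) (hI0 : ∀ x, 0 ≤ I x) {s₀ : ℝ}
    (hs₀ : 0 < s₀) {V : ℝ → X → E}
    (hV : ∀ᵐ x ∂μ, ∀ s ∈ Ioo 0 s₀, ‖V s x‖ ^ 2 ≤ s * I x) :
    Tendsto (fun s => eLpNorm (V s) 2 μ) (𝓝[>] 0) (𝓝 0) := by
  have hJ : MemLp (fun x => √(I x)) 2 μ := by
    rw [memLp_two_iff_integrable_sq (Real.continuous_sqrt.comp_aestronglyMeasurable hI.1)]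
    simpa only [Real.sq_sqrt (hI0 _)] using hI
  have hle : ∀ s ∈ Ioo 0 s₀, eLpNorm (V s) 2 μ ≤
      ENNReal.ofReal (√s) * eLpNorm (fun x => √(I x)) 2 μ := by
    intro s hs
    have h1 : eLpNorm (fun x => √s * √(I x)) 2 μ =
        ENNReal.ofReal (√s) * eLpNorm (fun x => √(I x)) 2 μ := by
      have := eLpNorm_const_smul (√s) (fun x => √(I x)) 2 μ
      rw [Real.enorm_of_nonneg (Real.sqrt_nonneg s)] at this
      exact this
    rw [← h1]
    refine eLpNorm_mono_ae ?_
    filter_upwards [hV] with x hx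
    rw [← Real.sqrt_mul hs.1.le, Real.norm_of_nonneg (Real.sqrt_nonneg _)]
    exact Real.le_sqrt_of_sq_le (hx s hs)
  have hlim : Tendsto (fun s : ℝ => ENNReal.ofReal (√s) * eLpNorm (fun x => √(I x)) 2 μ)
      (𝓝[>] 0) (𝓝 0) := by
    have h1 : Tendsto (fun s : ℝ => ENNReal.ofReal (√s)) (𝓝[>] 0) (𝓝 0) := by
      have hc : Continuous fun s : ℝ => ENNReal.ofReal (√s) :=
        ENNReal.continuous_ofReal.comp Real.continuous_sqrt
      have := (hc.tendsto 0).mono_left (nhdsWithin_le_nhds (s := Ioi 0))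
      simpa using this
    have := ENNReal.Tendsto.mul_const h1 (b := eLpNorm (fun x => √(I x)) 2 μ) (Or.inr hJ.2.ne)
    rwa [zero_mul] at this
  refine tendsto_of_tendsto_of_tendsto_of_le_of_le' tendsto_const_nhds hlim
    (Eventually.of_forall fun s => zero_le) ?_
  filter_upwards [Ioo_mem_nhdsGT hs₀] with s hs using hle s hs

theorem exists_trace {X : Type*} [MeasurableSpace X] {μ : Measure X} [SFinite μ] {s₀ : ℝ}
    (hs₀ : 0 < s₀) {U D : X → ℝ → ℝ}
    (hUm : ∀ s ∈ Ioo 0 s₀, AEStronglyMeasurable (fun x => U x s) μ)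
    (hderiv : ∀ᵐ x ∂μ, ∀ s ∈ Ioo 0 s₀, HasDerivAt (U x) (D x s) s)
    (hU : MemLp (Function.uncurry U) 2 (μ.prod (volume.restrict (Ioo 0 s₀))))
    (hD : MemLp (Function.uncurry D) 2 (μ.prod (volume.restrict (Ioo 0 s₀)))) :
    ∃ G : X → ℝ, MemLp G 2 μ ∧
      Tendsto (fun s => eLpNorm (fun x => U x s - G x) 2 μ) (𝓝[>] 0) (𝓝 0) ∧
      ∀ᵐ x ∂μ, IntegrableOn (D x) (Ioo 0 s₀) ∧ Tendsto (U x) (𝓝[>] 0) (𝓝 (G x)) := by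
  have hD2 := (memLp_two_iff_integrable_sq hD.1).1 hD
  have hU2 := (memLp_two_iff_integrable_sq hU.1).1 hU
  set I : X → ℝ := fun x => ∫ r in Ioo 0 s₀, D x r ^ 2 with hI
  have hIint : Integrable I μ := hD2.integral_prod_left
  have hI0 : ∀ x, 0 ≤ I x := fun x => integral_nonneg fun r => sq_nonneg _
  set s₁ := s₀ / 2 with hs₁
  have hs₁m : s₁ ∈ Ioo 0 s₀ := ⟨by positivity, by rw [hs₁]; linarith⟩
  set G : X → ℝ := fun x => U x s₁ - ∫ r in (0)..s₁, D x r with hG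
  have hgood : ∀ᵐ x ∂μ, IntegrableOn (D x) (Ioo 0 s₀) ∧
      ∀ s ∈ Ioo 0 s₀, (U x s - G x) ^ 2 ≤ s * I x := by
    filter_upwards [hderiv, hD2.prod_right_ae, hD.1.prodMk_left] with x hx1 hx2 hx3
    have hx2' : IntegrableOn (fun r => D x r ^ 2) (Ioo 0 s₀) := hx2
    have hDx : IntegrableOn (D x) (Ioo 0 s₀) :=
      ((memLp_two_iff_integrable_sq hx3).2 hx2).integrable one_le_two
    refine ⟨hDx, fun s hs => ?_⟩
    have hii : ∀ a ∈ Ioo 0 s₀, IntervalIntegrable (D x) volume 0 a := fun a ha => by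
      rw [intervalIntegrable_iff_integrableOn_Ioc_of_le ha.1.le]
      exact hDx.mono_set fun r hr => ⟨hr.1, hr.2.trans_lt ha.2⟩
    have hftc : ∫ r in s₁..s, D x r = U x s - U x s₁ := by
      refine intervalIntegral.integral_eq_sub_of_hasDerivAt (fun r hr => hx1 r ?_)
        ((hii s₁ hs₁m).symm.trans (hii s hs))
      exact (ordConnected_Ioo.uIcc_subset hs₁m hs) hr
    have hadd := intervalIntegral.integral_add_adjacent_intervals (hii s₁ hs₁m)
      ((hii s₁ hs₁m).symm.trans (hii s hs))
    have hUG : U x s - G x = ∫ r in Ioc 0 s, D x r := by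
      rw [← intervalIntegral.integral_of_le hs.1.le, ← hadd, hftc, hG]
      ring
    have hsub : Ioc 0 s ⊆ Ioo 0 s₀ := fun r hr => ⟨hr.1, hr.2.trans_lt hs.2⟩
    rw [hUG]
    refine (sq_integral_le (hDx.mono_set hsub) (hx2'.mono_set hsub)).trans ?_
    rw [measureReal_restrict_apply_univ, Real.volume_real_Ioc_of_le hs.1.le, sub_zero]
    refine mul_le_mul_of_nonneg_left ?_ hs.1.le
    exact setIntegral_mono_set hx2' (Eventually.of_forall fun r => sq_nonneg _)
      (LE.le.eventuallyLE hsub)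
  have hpt : ∀ᵐ x ∂μ, IntegrableOn (D x) (Ioo 0 s₀) ∧ Tendsto (U x) (𝓝[>] 0) (𝓝 (G x)) := by
    filter_upwards [hgood] with x hx
    refine ⟨hx.1, ?_⟩
    rw [tendsto_iff_norm_sub_tendsto_zero]
    have hc : Continuous fun s : ℝ => √(s * I x) := by fun_prop
    have hlim := (hc.tendsto 0).mono_left (nhdsWithin_le_nhds (s := Ioi 0))
    simp only [zero_mul, Real.sqrt_zero] at hlim
    refine tendsto_of_tendsto_of_tendsto_of_le_of_le' tendsto_const_nhds hlim
      (Eventually.of_forall fun s => norm_nonneg _) ?_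
    filter_upwards [Ioo_mem_nhdsGT hs₀] with s hs
    refine Real.le_sqrt_of_sq_le ?_
    rw [Real.norm_eq_abs, sq_abs]
    exact hx.2 s hs
  have hbound : ∀ᵐ x ∂μ, ∀ s ∈ Ioo 0 s₀, ‖U x s - G x‖ ^ 2 ≤ s * I x := by
    filter_upwards [hgood] with x hx s hs
    rw [Real.norm_eq_abs, sq_abs]
    exact hx.2 s hs
  have hGm : AEStronglyMeasurable G μ := by
    have hseq : Tendsto (fun n : ℕ => s₀ / (n + 2)) atTop (𝓝[>] 0) := by
      rw [tendsto_nhdsWithin_iff]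
      refine ⟨?_, Eventually.of_forall fun n => div_pos hs₀ (by positivity)⟩
      exact tendsto_const_nhds.div_atTop
        (tendsto_atTop_add_const_right _ _ tendsto_natCast_atTop_atTop)
    refine aestronglyMeasurable_of_tendsto_ae atTop (f := fun (n : ℕ) x => U x (s₀ / (n + 2)))
      (fun n => hUm _ ⟨div_pos hs₀ (by positivity), ?_⟩) ?_
    · rw [div_lt_iff₀ (by positivity)]
      nlinarith [n.cast_nonneg (α := ℝ)]
    · filter_upwards [hpt] with x hx using hx.2.comp hseq
  refine ⟨G, ?_, tendsto_eLpNorm_two_zero hIint hI0 hs₀ (V := fun s x => U x s - G x) hbound, hpt⟩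
  have hne : (volume.restrict (Ioo (0 : ℝ) s₀)) ≠ 0 := by
    rw [Ne, Measure.restrict_eq_zero, Real.volume_Ioo]
    simpa using hs₀
  have hne' : (ae (volume.restrict (Ioo (0 : ℝ) s₀))).NeBot := ae_neBot.2 hne
  obtain ⟨s, hs, hsm⟩ := (hU2.prod_left_ae.and (ae_restrict_mem measurableSet_Ioo)).exists
  have hUs : MemLp (fun x => U x s) 2 μ := (memLp_two_iff_integrable_sq (hUm s hsm)).2 hs
  have hdiff : MemLp (fun x => U x s - G x) 2 μ := by
    have hJ : MemLp (fun x => √(s * I x)) 2 μ := by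
      rw [memLp_two_iff_integrable_sq
        (Real.continuous_sqrt.comp_aestronglyMeasurable (hIint.const_mul s).1)]
      simpa only [Real.sq_sqrt (mul_nonneg hsm.1.le (hI0 _))] using hIint.const_mul s
    refine hJ.mono' ((hUm s hsm).sub hGm) ?_
    filter_upwards [hbound] with x hx using Real.le_sqrt_of_sq_le (hx s hsm)
  have := hUs.sub hdiff
  refine this.congr_norm hGm (Eventually.of_forall fun x => ?_)
  simp

end FirstOrderSystem

namespace FirstOrderSystem

/-! ### Traces and the divergence theorem in a box chart -/

theorem isOpen_cylinder {Ω : Set Space} (hΩ : IsOpen Ω) (T : ℝ) : IsOpen (cylinder Ω T) :=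
  hΩ.prod isOpen_Ioo

theorem volume_cylinder_lt_top {Ω : Set Space} (hb : Bornology.IsBounded Ω) (T : ℝ) :
    volume (cylinder Ω T) < ∞ :=
  (hb.prod (Metric.isBounded_Ioo 0 T)).measure_lt_top

/-- `u` is `C¹` on `Q` and square integrable together with its derivatives in the directions of
the subspace `W`. -/
structure IsSobolev (Q : Set SpaceTime) (W : Set SpaceTime) (u : SpaceTime → ℝ) : Prop where
  contDiffOn : ContDiffOn ℝ 1 u Q
  memLp : MemLp u 2 (volume.restrict Q)
  memLp_fderiv : ∀ e ∈ W, MemLp (fun p => fderiv ℝ u p e) 2 (volume.restrict Q)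

theorem IsSobolev.hasFDerivAt {Q W : Set SpaceTime} {u : SpaceTime → ℝ} (h : IsSobolev Q W u)
    (hQ : IsOpen Q) {p : SpaceTime} (hp : p ∈ Q) : HasFDerivAt u (fderiv ℝ u p) p :=
  ((h.contDiffOn.contDiffAt (hQ.mem_nhds hp)).differentiableAt one_ne_zero).hasFDerivAt

/-- The derivative of `u φ` by the product rule. -/
noncomputable def mulDeriv (u φ : SpaceTime → ℝ) (p : SpaceTime) : SpaceTime →L[ℝ] ℝ :=
  u p • fderiv ℝ φ p + φ p • fderiv ℝ u p

theorem mulDeriv_apply (u φ : SpaceTime → ℝ) (p e : SpaceTime) :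
    mulDeriv u φ p e = u p * fderiv ℝ φ p e + φ p * fderiv ℝ u p e := rfl

theorem IsSobolev.hasFDerivAt_mul {Q W : Set SpaceTime} {u φ : SpaceTime → ℝ}
    (h : IsSobolev Q W u) (hQ : IsOpen Q) (hφ : Differentiable ℝ φ) {p : SpaceTime} (hp : p ∈ Q) :
    HasFDerivAt (fun p => u p * φ p) (mulDeriv u φ p) p :=
  (h.hasFDerivAt hQ hp).mul (hφ p).hasFDerivAt

theorem hasFDerivAt_mul_of_notMem {u φ : SpaceTime → ℝ} {p : SpaceTime} (hp : p ∉ tsupport φ) :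
    HasFDerivAt (fun p => u p * φ p) (mulDeriv u φ p) p := by
  have h0 : mulDeriv u φ p = 0 := by
    rw [mulDeriv, fderiv_of_notMem_tsupport ℝ hp, image_eq_zero_of_notMem_tsupport hp]
    simp
  rw [h0]
  refine (hasFDerivAt_const (0 : ℝ) p).congr_of_eventuallyEq ?_
  filter_upwards [notMem_tsupport_iff_eventuallyEq.1 hp] with q hq
  rw [hq]
  simp

theorem IsSobolev.integrableOn {Q W : Set SpaceTime} {u : SpaceTime → ℝ} (h : IsSobolev Q W u)
    (hQ : volume Q < ∞) : IntegrableOn u Q :=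
  have : IsFiniteMeasure (volume.restrict Q) := ⟨by simpa using hQ⟩
  h.memLp.integrable one_le_two

theorem IsSobolev.integrableOn_fderiv {Q W : Set SpaceTime} {u : SpaceTime → ℝ}
    (h : IsSobolev Q W u) (hQ : volume Q < ∞) {e : SpaceTime} (he : e ∈ W) :
    IntegrableOn (fun p => fderiv ℝ u p e) Q :=
  have : IsFiniteMeasure (volume.restrict Q) := ⟨by simpa using hQ⟩
  (h.memLp_fderiv e he).integrable one_le_two

section Products

variable {Q W : Set SpaceTime} {u φ : SpaceTime → ℝ} {e : SpaceTime}

theorem IsSobolev.integrableOn_fderiv_mul (h : IsSobolev Q W u) (hQ : volume Q < ∞) (he : e ∈ W)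
    (hφ : ContDiff ℝ 1 φ) (hc : HasCompactSupport φ) :
    IntegrableOn (fun p => fderiv ℝ u p e * φ p) Q :=
  integrable_mul_of_compactSupport_real (h.integrableOn_fderiv hQ he) measurable_id
    hφ.continuous hc

theorem IsSobolev.integrableOn_mul_fderiv (h : IsSobolev Q W u) (hQ : volume Q < ∞)
    (hφ : ContDiff ℝ 1 φ) (hc : HasCompactSupport φ) :
    IntegrableOn (fun p => u p * fderiv ℝ φ p e) Q :=
  integrable_mul_of_compactSupport_real (φ := fun p => fderiv ℝ φ p e) (h.integrableOn hQ)
    measurable_id ((hφ.continuous_fderiv one_ne_zero).clm_apply continuous_const)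
    (hc.fderiv_apply ℝ e)

theorem IsSobolev.integrableOn_mulDeriv (h : IsSobolev Q W u) (hQ : volume Q < ∞) (he : e ∈ W)
    (hφ : ContDiff ℝ 1 φ) (hc : HasCompactSupport φ) :
    IntegrableOn (fun p => mulDeriv u φ p e) Q := by
  refine ((h.integrableOn_mul_fderiv (e := e) hQ hφ hc).add
    (h.integrableOn_fderiv_mul hQ he hφ hc)).congr (Eventually.of_forall fun p => ?_)
  simp only [Pi.add_apply, mulDeriv_apply]
  ring

theorem IsSobolev.integral_mulDeriv (h : IsSobolev Q W u) (hQ : volume Q < ∞) (he : e ∈ W)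
    (hφ : ContDiff ℝ 1 φ) (hc : HasCompactSupport φ) :
    (∫ p in Q, fderiv ℝ u p e * φ p) + ∫ p in Q, u p * fderiv ℝ φ p e =
      ∫ p in Q, mulDeriv u φ p e := by
  rw [← integral_add (h.integrableOn_fderiv_mul hQ he hφ hc)
    (h.integrableOn_mul_fderiv hQ hφ hc)]
  refine integral_congr_ae (Eventually.of_forall fun p => ?_)
  simp only [mulDeriv_apply]
  ring

end Products

/-- The directions in space. -/
def spatial : Set SpaceTime := {e | e.2 = 0}

theorem mk_mem_spatial (e : Space) : ((e, 0) : SpaceTime) ∈ spatial := rfl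

namespace IsBoxChart

variable {Ω : Set Space} {P : (Plane × ℝ) ≃L[ℝ] Space} {g : Plane → ℝ} {y₀ : Plane} {r T : ℝ}
  {u : SpaceTime → ℝ}

theorem timeShear_mem_boxSet (h : IsBoxChart Ω P g y₀ r) {a : (Plane × ℝ) × ℝ} :
    timeShear P h.contDiff.continuous a ∈ boxSet P g y₀ r ×ˢ (univ : Set ℝ) ↔
      a.1.1 ∈ Metric.ball y₀ r ∧ a.2 ∈ Ioo (-r) r := by
  have h1 : g a.1.1 - (g a.1.1 - a.2) = a.2 := sub_sub_cancel _ _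
  simp only [boxSet, mem_prod, mem_ofPred_eq, timeShear_apply, P.symm_apply_apply, h1, mem_univ,
    and_true]

theorem timeShear_mem (h : IsBoxChart Ω P g y₀ r) {y : Plane} (hy : y ∈ Metric.ball y₀ r)
    {t σ : ℝ} (ht : t ∈ Ioo 0 T) (hσ : σ ∈ Ioo 0 r) :
    timeShear P h.contDiff.continuous ((y, t), σ) ∈ cylinder Ω T :=
  ⟨(h.mem_iff y hy σ ⟨by linarith [hσ.1, hσ.2], hσ.2⟩).2 hσ.1, ht⟩

theorem preimage_timeShear (h : IsBoxChart Ω P g y₀ r) :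
    timeShear P h.contDiff.continuous ⁻¹' (cylinder Ω T ∩ boxSet P g y₀ r ×ˢ univ) =
      (Metric.ball y₀ r ×ˢ Ioo 0 T) ×ˢ Ioo 0 r := by
  ext a
  rw [mem_preimage, mem_inter_iff, h.timeShear_mem_boxSet]
  constructor
  · rintro ⟨⟨h1, h2⟩, h3, h4⟩
    exact ⟨⟨h3, h2⟩, (h.mem_iff _ h3 _ h4).1 h1, h4.2⟩
  · rintro ⟨⟨h1, h2⟩, h3⟩
    exact ⟨h.timeShear_mem h1 h2 h3, h1, by linarith [h3.1, h3.2], h3.2⟩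

theorem measurePreserving (h : IsBoxChart Ω P g y₀ r) :
    MeasurePreserving (timeShear P h.contDiff.continuous)
      ((volume.restrict (Metric.ball y₀ r ×ˢ Ioo 0 T)).prod (volume.restrict (Ioo 0 r)))
      (volume.restrict (cylinder Ω T ∩ boxSet P g y₀ r ×ˢ univ)) := by
  rw [Measure.prod_restrict, ← Measure.volume_eq_prod, ← h.preimage_timeShear]
  exact (h.isFrame.measurePreserving_timeShear h.contDiff.continuous).restrict_preimage_emb
    (timeShear P h.contDiff.continuous).measurableEmbedding _

theorem hasFDerivAt_timeShear (h : IsBoxChart Ω P g y₀ r) (y : Plane) (t σ : ℝ) :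
    HasFDerivAt (fun y => timeShear P h.contDiff.continuous ((y, t), σ))
      (((P : (Plane × ℝ) →L[ℝ] Space) ∘L
        ((ContinuousLinearMap.id ℝ Plane).prod (fderiv ℝ g y))).prod 0) y := by
  have h1 : HasFDerivAt g (fderiv ℝ g y) y :=
    (h.contDiff.differentiable one_ne_zero y).hasFDerivAt
  have h2 : HasFDerivAt (fun y => P (y, g y - σ)) ((P : (Plane × ℝ) →L[ℝ] Space) ∘L
      ((ContinuousLinearMap.id ℝ Plane).prod (fderiv ℝ g y))) y :=
    P.hasFDerivAt.comp y ((hasFDerivAt_id y).prodMk (h1.sub_const σ))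
  exact h2.prodMk (hasFDerivAt_const t y)

theorem hasDerivAt_timeShear (h : IsBoxChart Ω P g y₀ r) (p : Plane × ℝ) (σ : ℝ) :
    HasDerivAt (fun σ => timeShear P h.contDiff.continuous (p, σ))
      (-((P (0, 1), 0) : SpaceTime)) σ := by
  have h1 : HasDerivAt (fun σ => ((p.1, g p.1 - σ) : Plane × ℝ)) (0, -1) σ :=
    (hasDerivAt_const σ p.1).prodMk ((hasDerivAt_id σ).const_sub _)
  have h2 := (P : (Plane × ℝ) →L[ℝ] Space).hasFDerivAt.comp_hasDerivAt σ h1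
  have h3 := h2.prodMk (hasDerivAt_const σ p.2)
  convert! h3 using 1
  have : ((0, -1) : Plane × ℝ) = -(0, 1) := by simp
  rw [this, map_neg]
  simp

/-- The trace of `u` on the part of the boundary in a box chart. -/
theorem exists_trace (h : IsBoxChart Ω P g y₀ r) (hΩ : IsOpen Ω)
    (hu : IsSobolev (cylinder Ω T) spatial u) :
    ∃ G : Plane × ℝ → ℝ, MemLp G 2 (volume.restrict (Metric.ball y₀ r ×ˢ Ioo 0 T)) ∧
      Tendsto (fun s => eLpNorm
        (fun p => u (timeShear P h.contDiff.continuous (p, s)) - G p) 2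
        (volume.restrict (Metric.ball y₀ r ×ˢ Ioo 0 T))) (𝓝[>] 0) (𝓝 0) ∧
      ∀ᵐ p ∂(volume.restrict (Metric.ball y₀ r ×ˢ Ioo 0 T)),
        Tendsto (fun s => u (timeShear P h.contDiff.continuous (p, s))) (𝓝[>] 0) (𝓝 (G p)) := by
  set Θ := timeShear P h.contDiff.continuous with hΘ
  have hQ := isOpen_cylinder hΩ T
  have hmeas : MeasurableSet (Metric.ball y₀ r ×ˢ Ioo (0 : ℝ) T) :=
    measurableSet_ball.prod measurableSet_Ioo
  have hmp := h.measurePreserving (T := T)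
  have hle : volume.restrict (cylinder Ω T ∩ boxSet P g y₀ r ×ˢ univ) ≤
      volume.restrict (cylinder Ω T) := Measure.restrict_mono inter_subset_left le_rfl
  have key := FirstOrderSystem.exists_trace h.pos
    (μ := volume.restrict (Metric.ball y₀ r ×ˢ Ioo 0 T))
    (U := fun p s => u (Θ (p, s)))
    (D := fun p s => fderiv ℝ u (Θ (p, s)) (-((P (0, 1), 0) : SpaceTime))) (fun s hs => by
      refine ContinuousOn.aestronglyMeasurable ?_ hmeas
      exact hu.contDiffOn.continuousOn.comp
        (Θ.continuous.comp (Continuous.prodMk_left s)).continuousOn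
        fun p hp => h.timeShear_mem hp.1 hp.2 hs) (by
      filter_upwards [ae_restrict_mem hmeas] with p hp s hs
      exact (hu.hasFDerivAt hQ (h.timeShear_mem hp.1 hp.2 hs)).comp_hasDerivAt s
        (h.hasDerivAt_timeShear p s))
    ((hu.memLp.mono_measure hle).comp_measurePreserving hmp)
    (((hu.memLp_fderiv (-((P (0, 1), 0) : SpaceTime)) (by simp [spatial])).mono_measure
      hle).comp_measurePreserving hmp)
  obtain ⟨G, hG1, hG2, hG3⟩ := key
  exact ⟨G, hG1, hG2, hG3.mono fun p hp => hp.2⟩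

/-- The divergence theorem for test functions supported in a box chart. -/
theorem integral_mulDeriv_eq (h : IsBoxChart Ω P g y₀ r) (hΩ : IsOpen Ω)
    (hb : Bornology.IsBounded Ω) (hu : IsSobolev (cylinder Ω T) spatial u) {G : Plane × ℝ → ℝ}
    (hG : ∀ᵐ p ∂(volume.restrict (Metric.ball y₀ r ×ˢ Ioo 0 T)),
      Tendsto (fun s => u (timeShear P h.contDiff.continuous (p, s))) (𝓝[>] 0) (𝓝 (G p)))
    {φ : SpaceTime → ℝ} (hφ : ContDiff ℝ 1 φ) (hc : HasCompactSupport φ)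
    (hs : tsupport φ ⊆ boxSet P g y₀ r ×ˢ univ) (e : Space) :
    ∫ p in cylinder Ω T, mulDeriv u φ p (e, 0) =
      ∫ p in Metric.ball y₀ r ×ˢ Ioo 0 T,
        G p * φ (graphMap P g p.1, p.2) * inner ℝ (graphNormal P g p.1) e := by
  set Θ := timeShear P h.contDiff.continuous with hΘ
  have hQ := isOpen_cylinder hΩ T
  have hQf := volume_cylinder_lt_top hb T
  have hmeas : MeasurableSet (Metric.ball y₀ r ×ˢ Ioo (0 : ℝ) T) :=
    measurableSet_ball.prod measurableSet_Ioo
  have hmp := h.measurePreserving (T := T)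
  have hφd : Differentiable ℝ φ := hφ.differentiable one_ne_zero
  set ν := P (0, 1) with hν
  obtain ⟨a₀, ha₀⟩ := P.surjective e
  -- the derivative in the tangential direction with the same horizontal part as `e`
  set A : (Plane × ℝ) × ℝ → ℝ := fun a =>
    mulDeriv u φ (Θ a) (P (a₀.1, fderiv ℝ g a.1.1 a₀.1), 0) with hA
  have hdec : ∀ a : (Plane × ℝ) × ℝ, mulDeriv u φ (Θ a) (e, 0) =
      A a + inner ℝ (graphNormal P g a.1.1) e * mulDeriv u φ (Θ a) (ν, 0) := by
    intro a
    have h1 : inner ℝ (graphNormal P g a.1.1) e = a₀.2 - fderiv ℝ g a.1.1 a₀.1 := by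
      rw [← ha₀, graphNormal, h.isFrame.inner_eq, inner_neg_left, inner_gradient]
      ring
    have h2 : ((e, 0) : SpaceTime) = (P (a₀.1, fderiv ℝ g a.1.1 a₀.1), 0) +
        inner ℝ (graphNormal P g a.1.1) e • ((ν, 0) : SpaceTime) := by
      rw [h1, ← ha₀, hν]
      ext1
      · simp only [Prod.fst_add, Prod.smul_fst]
        rw [← map_smul, ← map_add]
        congr 1
        ext <;> simp
      · simp
    rw [hA]
    conv_lhs => rw [h2]
    rw [map_add, map_smul, smul_eq_mul]
  have hint : ∀ e' : Space, Integrable (fun a => mulDeriv u φ (Θ a) (e', 0))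
      ((volume.restrict (Metric.ball y₀ r ×ˢ Ioo 0 T)).prod (volume.restrict (Ioo 0 r))) := by
    intro e'
    have h1 := (hu.integrableOn_mulDeriv hQf (mk_mem_spatial e') hφ hc).mono_set
      (inter_subset_left (t := boxSet P g y₀ r ×ˢ univ))
    exact hmp.integrable_comp_of_integrable h1
  obtain ⟨c, hcN⟩ := h.exists_norm_graphNormal_le
  have hNm : Continuous fun a : (Plane × ℝ) × ℝ => inner ℝ (graphNormal P g a.1.1) e :=
    ((continuous_graphNormal P h.contDiff).comp
      (continuous_fst.comp continuous_fst)).inner continuous_const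
  have hintN : Integrable (fun a => inner ℝ (graphNormal P g a.1.1) e *
      mulDeriv u φ (Θ a) (ν, 0))
      ((volume.restrict (Metric.ball y₀ r ×ˢ Ioo 0 T)).prod (volume.restrict (Ioo 0 r))) := by
    refine (hint ν).bdd_mul (c := c * ‖e‖) hNm.aestronglyMeasurable ?_
    rw [Measure.prod_restrict]
    filter_upwards [ae_restrict_mem (hmeas.prod measurableSet_Ioo)] with a ha
    exact (norm_inner_le_norm _ _).trans
      (mul_le_mul_of_nonneg_right (hcN _ ha.1.1) (norm_nonneg _))
  have hintA : Integrable A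
      ((volume.restrict (Metric.ball y₀ r ×ˢ Ioo 0 T)).prod (volume.restrict (Ioo 0 r))) := by
    refine ((hint e).sub hintN).congr (Eventually.of_forall fun a => ?_)
    simp only [Pi.sub_apply, hdec a]
    ring
  have hnot : ∀ {y : Plane} {t σ : ℝ}, y ∉ Metric.ball y₀ r → Θ ((y, t), σ) ∉ tsupport φ :=
    fun hy hm => hy (h.timeShear_mem_boxSet.1 (hs hm)).1
  -- tangential derivatives integrate to zero
  have hA0 : ∫ a, A a ∂((volume.restrict (Metric.ball y₀ r ×ˢ Ioo 0 T)).prod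
      (volume.restrict (Ioo 0 r))) = 0 := by
    rw [integral_prod_symm _ hintA]
    refine integral_eq_zero_of_ae ?_
    filter_upwards [hintA.prod_left_ae, ae_restrict_mem measurableSet_Ioo] with σ hσi hσ
    rw [Measure.volume_eq_prod, ← Measure.prod_restrict] at hσi ⊢
    rw [integral_prod_symm _ hσi]
    refine integral_eq_zero_of_ae ?_
    filter_upwards [hσi.prod_left_ae, ae_restrict_mem measurableSet_Ioo] with t hti ht
    have hd : ∀ y, HasFDerivAt (fun y => u (Θ ((y, t), σ)) * φ (Θ ((y, t), σ)))
        ((mulDeriv u φ (Θ ((y, t), σ))).comp (((P : (Plane × ℝ) →L[ℝ] Space) ∘L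
        ((ContinuousLinearMap.id ℝ Plane).prod (fderiv ℝ g y))).prod 0)) y := by
      intro y
      have hd' : HasFDerivAt (fun p => u p * φ p) (mulDeriv u φ (Θ ((y, t), σ)))
          (Θ ((y, t), σ)) := by
        by_cases hy : y ∈ Metric.ball y₀ r
        · exact hu.hasFDerivAt_mul hQ hφd (h.timeShear_mem hy ht hσ)
        · exact hasFDerivAt_mul_of_notMem (hnot hy)
      exact hd'.comp y (h.hasFDerivAt_timeShear y t σ)
    have hAd : ∀ y, A ((y, t), σ) =
        fderiv ℝ (fun y => u (Θ ((y, t), σ)) * φ (Θ ((y, t), σ))) y a₀.1 := by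
      intro y
      rw [(hd y).fderiv]
      rfl
    have hA0' : ∀ y ∉ Metric.ball y₀ r, A ((y, t), σ) = 0 := by
      intro y hy
      have hy' := hnot (t := t) (σ := σ) hy
      rw [hA]
      simp only [mulDeriv_apply, fderiv_of_notMem_tsupport ℝ hy',
        image_eq_zero_of_notMem_tsupport hy']
      simp
    have hcont : Continuous fun y => u (Θ ((y, t), σ)) * φ (Θ ((y, t), σ)) :=
      continuous_iff_continuousAt.2 fun y => (hd y).continuousAt
    have hcs : HasCompactSupport fun y => u (Θ ((y, t), σ)) * φ (Θ ((y, t), σ)) := by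
      refine HasCompactSupport.of_support_subset_isCompact (isCompact_closedBall y₀ r) ?_
      intro y hy
      by_contra hy'
      refine hy ?_
      have : y ∉ Metric.ball y₀ r := fun hm => hy' (Metric.ball_subset_closedBall hm)
      simp only [image_eq_zero_of_notMem_tsupport (hnot (t := t) (σ := σ) this), mul_zero]
    rw [setIntegral_eq_integral_of_forall_compl_eq_zero hA0']
    have hAi : Integrable fun y => A ((y, t), σ) :=
      (integrableOn_iff_integrable_of_support_subset
        (fun y hy => by_contra fun hy' => hy (hA0' y hy'))).1 hti
    simp only [hAd] at hAi ⊢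
    have := integral_mul_fderiv_eq_neg_fderiv_mul_of_integrable (μ := (volume : Measure Plane))
      (f := fun _ => (1 : ℝ)) (g := fun y => u (Θ ((y, t), σ)) * φ (Θ ((y, t), σ))) (v := a₀.1)
      (by simp) (by simpa using hAi) (by simpa using hcont.integrable_of_hasCompactSupport hcs)
      (fun _ _ => differentiableAt_const _) (fun y _ => (hd y).differentiableAt)
    simpa using this
  have hL : ∫ p in cylinder Ω T, mulDeriv u φ p (e, 0) =
      ∫ a, mulDeriv u φ (Θ a) (e, 0) ∂((volume.restrict (Metric.ball y₀ r ×ˢ Ioo 0 T)).prod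
        (volume.restrict (Ioo 0 r))) := by
    rw [hmp.integral_comp Θ.measurableEmbedding (fun p => mulDeriv u φ p (e, 0))]
    refine setIntegral_eq_of_subset_of_forall_sdiff_eq_zero hQ.measurableSet inter_subset_left ?_
    rintro p ⟨hp1, hp2⟩
    have : p ∉ tsupport φ := fun hm => hp2 ⟨hp1, hs hm⟩
    rw [mulDeriv_apply, fderiv_of_notMem_tsupport ℝ this, image_eq_zero_of_notMem_tsupport this]
    simp
  rw [hL]
  simp only [hdec]
  rw [integral_add hintA hintN, hA0, zero_add, integral_prod _ hintN]
  refine integral_congr_ae ?_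
  filter_upwards [hG, (hint ν).prod_right_ae, ae_restrict_mem hmeas] with p hp hpi hpm
  rw [integral_const_mul, mul_comm]
  congr 1
  have hd : ∀ σ ∈ Ioo 0 r, HasDerivAt (fun σ => -(u (Θ (p, σ)) * φ (Θ (p, σ))))
      (mulDeriv u φ (Θ (p, σ)) (ν, 0)) σ := by
    intro σ hσ
    have h1 := ((hu.hasFDerivAt_mul hQ hφd (h.timeShear_mem hpm.1 hpm.2 hσ)).comp_hasDerivAt σ
      (h.hasDerivAt_timeShear p σ)).fun_neg
    rw [map_neg, neg_neg] at h1
    exact h1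
  have hφ0 : Tendsto (fun σ => φ (Θ (p, σ))) (𝓝[>] 0) (𝓝 (φ (graphMap P g p.1, p.2))) := by
    have h1 : Continuous fun σ => φ (Θ (p, σ)) :=
      hφ.continuous.comp (Θ.continuous.comp (Continuous.prodMk_right p))
    have h2 := (h1.tendsto 0).mono_left (nhdsWithin_le_nhds (s := Ioi 0))
    have h3 : Θ (p, 0) = (graphMap P g p.1, p.2) := by
      simp [hΘ, graphMap]
    rwa [h3] at h2
  have hφr : Tendsto (fun σ => -(u (Θ (p, σ)) * φ (Θ (p, σ)))) (𝓝[<] r) (𝓝 0) := by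
    have h1 : Θ (p, r) ∉ tsupport φ := fun hm =>
      lt_irrefl r (h.timeShear_mem_boxSet.1 (hs hm)).2.2
    have h2 : Tendsto (fun σ => Θ (p, σ)) (𝓝[<] r) (𝓝 (Θ (p, r))) :=
      ((Θ.continuous.comp (Continuous.prodMk_right p)).tendsto r).mono_left nhdsWithin_le_nhds
    refine tendsto_const_nhds.congr' ?_
    filter_upwards [h2.eventually (notMem_tsupport_iff_eventuallyEq.1 h1)] with σ hσ
    rw [hσ]
    simp
  have := intervalIntegral.integral_eq_sub_of_hasDerivAt_of_tendsto h.pos hd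
    ((intervalIntegrable_iff_integrableOn_Ioo_of_le h.pos.le).2 hpi) (hp.mul hφ0).neg hφr
  rw [intervalIntegral.integral_of_le h.pos.le, integral_Ioc_eq_integral_Ioo] at this
  rw [this]
  ring

end IsBoxChart
end FirstOrderSystem

namespace FirstOrderSystem

/-! ### Lateral traces -/

/-- The measure `dS dt` on the part of the lateral boundary over `V`. -/
noncomputable def lateralPart (Ω : Set Space) (T : ℝ) (V : Set Space) : Measure SpaceTime :=
  ((μHE[2] : Measure Space).restrict (frontier Ω ∩ V)).prod (volume.restrict (Ioo 0 T))

/-- `G` is the trace of `u` on the part of the lateral boundary over `V`, in the sense of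
translates along `ν` and in the sense of the divergence theorem. -/
structure HasTrace (Ω : Set Space) (T : ℝ) (u : SpaceTime → ℝ) (V : Set Space) (ν : Space)
    (G : SpaceTime → ℝ) : Prop where
  memLp : MemLp G 2 (lateralPart Ω T V)
  aestronglyMeasurable : ∀ᶠ s : ℝ in 𝓝[>] 0,
    AEStronglyMeasurable (fun p : SpaceTime => u (p.1 - s • ν, p.2)) (lateralPart Ω T V)
  tendsto : Tendsto (fun s : ℝ => eLpNorm (fun p : SpaceTime => u (p.1 - s • ν, p.2) - G p) 2
    (lateralPart Ω T V)) (𝓝[>] 0) (𝓝 0)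
  gauss : ∀ φ : SpaceTime → ℝ, ContDiff ℝ 1 φ → HasCompactSupport φ → tsupport φ ⊆ V ×ˢ univ →
    ∀ e : Space, ∫ p in cylinder Ω T, mulDeriv u φ p (e, 0) =
      ∫ p, G p * φ p * inner ℝ (outwardNormal Ω p.1) e ∂(lateralPart Ω T V)

namespace IsBoxChart

variable {Ω : Set Space} {P : (Plane × ℝ) ≃L[ℝ] Space} {g : Plane → ℝ} {y₀ : Plane} {r T : ℝ}
  {u : SpaceTime → ℝ}

theorem lateralPart_eq (h : IsBoxChart Ω P g y₀ r) :
    lateralPart Ω T (boxSet P g y₀ r) =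
      ((volume.restrict (Metric.ball y₀ r ×ˢ Ioo 0 T)).withDensity
        fun p => ENNReal.ofReal ‖graphNormal P g p.1‖).map (Prod.map (graphMap P g) id) := by
  have hJm : Measurable fun y => ENNReal.ofReal ‖graphNormal P g y‖ :=
    ENNReal.measurable_ofReal.comp (continuous_graphNormal P h.contDiff).norm.measurable
  rw [lateralPart, h.restrict_frontier]
  conv_lhs => rw [← Measure.map_id (μ := volume.restrict (Ioo 0 T))]
  rw [Measure.map_prod_map _ _ (continuous_graphMap P h.contDiff.continuous).measurable
    measurable_id, prod_withDensity_left hJm, Measure.prod_restrict, ← Measure.volume_eq_prod]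

theorem measurableEmbedding (h : IsBoxChart Ω P g y₀ r) :
    MeasurableEmbedding (Prod.map (graphMap P g) (id : ℝ → ℝ)) :=
  (isClosedEmbedding_graphMap P h.contDiff.continuous).measurableEmbedding.prodMap
    MeasurableEmbedding.id

theorem exists_hasTrace (h : IsBoxChart Ω P g y₀ r) (hΩ : IsOpen Ω) (hb : Bornology.IsBounded Ω)
    (hu : IsSobolev (cylinder Ω T) spatial u) :
    ∃ G, HasTrace Ω T u (boxSet P g y₀ r) (P (0, 1)) G := by
  obtain ⟨G, hG1, hG2, hG3⟩ := h.exists_trace hΩ hu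
  have hmeas : MeasurableSet (Metric.ball y₀ r ×ˢ Ioo (0 : ℝ) T) :=
    measurableSet_ball.prod measurableSet_Ioo
  set μ₀ : Measure (Plane × ℝ) := volume.restrict (Metric.ball y₀ r ×ˢ Ioo 0 T) with hμ₀
  have hemb := h.measurableEmbedding
  have hJm : Measurable fun p : Plane × ℝ => ENNReal.ofReal ‖graphNormal P g p.1‖ :=
    ENNReal.measurable_ofReal.comp
      ((continuous_graphNormal P h.contDiff).norm.measurable.comp measurable_fst)
  obtain ⟨c, hc⟩ := h.exists_norm_graphNormal_le
  have hle : μ₀.withDensity (fun p => ENNReal.ofReal ‖graphNormal P g p.1‖) ≤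
      ENNReal.ofReal c • μ₀ := by
    rw [← withDensity_const]
    refine withDensity_mono ?_
    filter_upwards [ae_restrict_mem hmeas] with p hp
    exact ENNReal.ofReal_le_ofReal (hc _ hp.1)
  set G' : SpaceTime → ℝ := fun x => G ((P.symm x.1).1, x.2) with hG'
  have hGG : G' ∘ Prod.map (graphMap P g) id = G := by
    ext p
    simp [hG', graphMap]
  have hshift : ∀ (s : ℝ) (p : Plane × ℝ), u ((Prod.map (graphMap P g) id p).1 - s • P (0, 1),
      (Prod.map (graphMap P g) id p).2) = u (timeShear P h.contDiff.continuous (p, s)) := by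
    intro s p
    have : P (p.1, g p.1 - s) = graphMap P g p.1 - s • P (0, 1) := by
      rw [graphMap, ← map_smul, ← map_sub]
      congr 1
      ext <;> simp
    rw [timeShear_apply, this]
    rfl
  refine ⟨G', ⟨?_, ?_, ?_, ?_⟩⟩
  · rw [h.lateralPart_eq, hemb.memLp_map_measure_iff, hGG]
    exact (hG1.smul_measure ENNReal.ofReal_ne_top).mono_measure hle
  · filter_upwards [Ioo_mem_nhdsGT h.pos] with s hs
    rw [h.lateralPart_eq, hemb.aestronglyMeasurable_map_iff]
    simp only [Function.comp_def, hshift]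
    have h1 : AEStronglyMeasurable (fun p => u (timeShear P h.contDiff.continuous (p, s))) μ₀ := by
      refine ContinuousOn.aestronglyMeasurable ?_ hmeas
      exact hu.contDiffOn.continuousOn.comp
        ((timeShear P h.contDiff.continuous).continuous.comp
          (Continuous.prodMk_left s)).continuousOn
        fun p hp => h.timeShear_mem hp.1 hp.2 hs
    exact h1.mono_ac (withDensity_absolutelyContinuous _ _)
  · rw [h.lateralPart_eq]
    simp only [hemb.eLpNorm_map_measure]
    have hlim : Tendsto (fun s : ℝ => ENNReal.ofReal c ^ (1 / (2 : ℝ≥0∞)).toReal *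
        eLpNorm (fun p => u (timeShear P h.contDiff.continuous (p, s)) - G p) 2 μ₀)
        (𝓝[>] 0) (𝓝 0) := by
      have := ENNReal.Tendsto.const_mul hG2
        (a := ENNReal.ofReal c ^ (1 / (2 : ℝ≥0∞)).toReal)
        (Or.inr (ENNReal.rpow_ne_top_of_nonneg ENNReal.toReal_nonneg ENNReal.ofReal_ne_top))
      rwa [mul_zero] at this
    refine tendsto_of_tendsto_of_tendsto_of_le_of_le tendsto_const_nhds hlim
      (fun s => zero_le) fun s => ?_
    refine (eLpNorm_mono_measure _ hle).trans ?_
    rw [eLpNorm_smul_measure_of_ne_top (by simp), smul_eq_mul]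
    refine le_of_eq ?_
    congr 2
    ext p
    simp only [Function.comp_apply, hshift]
    rw [← congrFun hGG p]
    rfl
  · intro φ hφ hφc hφs e
    rw [h.integral_mulDeriv_eq hΩ hb hu hG3 hφ hφc hφs e, h.lateralPart_eq, hemb.integral_map,
      integral_withDensity_eq_integral_toReal_smul hJm
        (Eventually.of_forall fun _ => ENNReal.ofReal_lt_top)]
    refine integral_congr_ae ?_
    filter_upwards [ae_restrict_mem hmeas] with p hp
    have h1 : (Prod.map (graphMap P g) id p).1 = graphMap P g p.1 := rfl
    have h2 : Prod.map (graphMap P g) id p = (graphMap P g p.1, p.2) := rfl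
    rw [h1, h.isChart.outwardNormal_graphMap (h.graphMap_mem.2 hp.1),
      ENNReal.toReal_ofReal (norm_nonneg _), smul_eq_mul, inner_smul_left, ← congrFun hGG p,
      Function.comp_apply, h2]
    simp only [conj_trivial]
    have h3 : ‖graphNormal P g p.1‖ ≠ 0 := norm_ne_zero_iff.2 (graphNormal_ne_zero P g p.1)
    field_simp

theorem continuousOn_outwardNormal (h : IsBoxChart Ω P g y₀ r) :
    ContinuousOn (outwardNormal Ω) (frontier Ω ∩ boxSet P g y₀ r) := by
  have hN := continuous_graphNormal P h.contDiff
  have h1 : Continuous fun y => ‖graphNormal P g y‖⁻¹ • graphNormal P g y :=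
    (hN.norm.inv₀ fun y => norm_ne_zero_iff.2 (graphNormal_ne_zero P g y)).smul hN
  have h2 : Continuous fun x : Space =>
      ‖graphNormal P g (P.symm x).1‖⁻¹ • graphNormal P g (P.symm x).1 :=
    h1.comp (continuous_fst.comp P.symm.continuous)
  refine h2.continuousOn.congr ?_
  intro x hx
  rw [h.isChart.frontier_inter] at hx
  obtain ⟨⟨y, rfl⟩, hx2⟩ := hx
  rw [h.isChart.outwardNormal_graphMap hx2]
  simp [graphMap]

end IsBoxChart

theorem IsLocalDefiningFunction.mem_frontier {Ω : Set Space} {x : Space} {ρ : Space → ℝ}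
    (h : IsLocalDefiningFunction Ω x ρ) : x ∈ frontier Ω := by
  have hx : x ∉ Ω := fun hx => by
    have := (h.mem_iff.self_of_nhds).1 hx
    rw [h.eq_zero] at this
    exact lt_irrefl _ this
  refine ⟨?_, fun hi => hx (interior_subset hi)⟩
  have hd : fderiv ℝ ρ x (-gradient ρ x) < 0 := by
    rw [map_neg, ← inner_gradient, real_inner_self_eq_norm_sq, neg_lt_zero]
    have := norm_pos_iff.2 h.gradient_ne_zero
    positivity
  have ht := tendsto_add_smul x (-gradient ρ x)
  have hev : ∀ᶠ t : ℝ in 𝓝[>] 0, x + t • -gradient ρ x ∈ Ω := by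
    filter_upwards [ht.eventually h.mem_iff,
      eventually_lt_of_fderiv_neg (h.contDiffAt.differentiableAt one_ne_zero) hd] with t h1 h2
    rw [h.eq_zero] at h2
    exact h1.2 h2
  rw [mem_closure_iff_frequently]
  exact ht.frequently hev.frequently

/-- Every regular boundary point has arbitrarily small neighbourhoods over which functions with
square integrable derivatives have traces. -/
theorem IsOutwardNormal.exists_hasTrace {Ω : Set Space} (hΩ : IsOpen Ω)
    (hb : Bornology.IsBounded Ω) {x₀ ν : Space} (h : IsOutwardNormal Ω x₀ ν) (T : ℝ) {O : Set Space}
    (hO : O ∈ 𝓝 x₀) : ∃ V ⊆ O, IsOpen V ∧ x₀ ∈ V ∧ ContinuousOn (outwardNormal Ω) (frontier Ω ∩ V) ∧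
      ∀ u, IsSobolev (cylinder Ω T) spatial u → ∃ G, HasTrace Ω T u V ν G := by
  obtain ⟨ρ, hρ, rfl⟩ := h
  obtain ⟨V, P, g, hch, hV, hP⟩ := hρ.exists_isChart
  obtain ⟨y₀, r, hbox, hmem, hsub⟩ := hch.exists_isBoxChart hρ.mem_frontier hV hO
  refine ⟨boxSet P g y₀ r, hsub, isOpen_boxSet hbox.contDiff.continuous y₀ r, hmem,
    hbox.continuousOn_outwardNormal, fun u hu => ?_⟩
  rw [← hP]
  exact hbox.exists_hasTrace hΩ hb hu

theorem ae_eq_of_tendsto_eLpNorm_sub {X : Type*} [MeasurableSpace X] {μ : Measure X}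
    {l : Filter ℝ} [l.NeBot] {U : ℝ → X → ℝ} {G G' : X → ℝ}
    (hU : ∀ᶠ s in l, AEStronglyMeasurable (U s) μ) (hG : AEStronglyMeasurable G μ)
    (hG' : AEStronglyMeasurable G' μ)
    (h : Tendsto (fun s => eLpNorm (fun x => U s x - G x) 2 μ) l (𝓝 0))
    (h' : Tendsto (fun s => eLpNorm (fun x => U s x - G' x) 2 μ) l (𝓝 0)) : G =ᵐ[μ] G' := by
  have h1 : eLpNorm (G - G') 2 μ ≤ 0 := by
    have hsum := h'.add h
    rw [add_zero] at hsum
    refine ge_of_tendsto hsum ?_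
    filter_upwards [hU] with s hs
    have : G - G' = (fun x => U s x - G' x) - fun x => U s x - G x := by
      ext p; simp
    rw [this]
    exact eLpNorm_sub_le (hs.sub hG') (hs.sub hG) one_le_two
  have h2 := (eLpNorm_eq_zero_iff (hG.sub hG') two_ne_zero).1 (le_antisymm h1 zero_le)
  filter_upwards [h2] with x hx
  exact sub_eq_zero.1 hx

theorem HasTrace.ae_eq {Ω : Set Space} {T : ℝ} {u : SpaceTime → ℝ} {V : Set Space} {ν : Space}
    {G G' : SpaceTime → ℝ} (h : HasTrace Ω T u V ν G)
    (hG' : AEStronglyMeasurable G' (lateralPart Ω T V))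
    (ht : Tendsto (fun s : ℝ => eLpNorm (fun p : SpaceTime => u (p.1 - s • ν, p.2) - G' p) 2
      (lateralPart Ω T V)) (𝓝[>] 0) (𝓝 0)) : G =ᵐ[lateralPart Ω T V] G' :=
  ae_eq_of_tendsto_eLpNorm_sub h.aestronglyMeasurable h.memLp.1 hG' h.tendsto ht

end FirstOrderSystem

namespace FirstOrderSystem
open scoped ContDiff Manifold

/-! ### Localization -/

theorem eq_zero_of_locally_eq_zero {E : Type*} [NormedAddCommGroup E] [NormedSpace ℝ E]
    [FiniteDimensional ℝ E] {L : (E → ℝ) → ℝ}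
    (hadd : ∀ φ ψ : E → ℝ, ContDiff ℝ ∞ φ → HasCompactSupport φ → ContDiff ℝ ∞ ψ →
      HasCompactSupport ψ → L (fun x => φ x + ψ x) = L φ + L ψ) {φ : E → ℝ} (hφ : ContDiff ℝ ∞ φ)
    (hc : HasCompactSupport φ)
    (h : ∀ x ∈ tsupport φ, ∃ U : Set E, IsOpen U ∧ x ∈ U ∧ ∀ ψ : E → ℝ, ContDiff ℝ ∞ ψ →
      HasCompactSupport ψ → tsupport ψ ⊆ tsupport φ ∩ U → L ψ = 0) : L φ = 0 := by
  have h0 : L (fun _ => 0) = 0 := by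
    have := hadd (fun _ => 0) (fun _ => 0) contDiff_const HasCompactSupport.zero contDiff_const
      HasCompactSupport.zero
    simpa using this
  choose! U hUo hxU hU using h
  obtain ⟨t, htK, htc⟩ := hc.isCompact.elim_nhds_subcover U
    fun x hx => (hUo x hx).mem_nhds (hxU x hx)
  obtain ⟨f, hf⟩ := SmoothPartitionOfUnity.exists_isSubordinate 𝓘(ℝ, E) (isClosed_tsupport φ)
    (fun i : t => U i) (fun i => hUo _ (htK _ i.2)) (by
      intro x hx
      obtain ⟨i, hi, hxi⟩ := mem_iUnion₂.1 (htc hx)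
      exact mem_iUnion.2 ⟨⟨i, hi⟩, hxi⟩)
  have hfs : ∀ i : t, ContDiff ℝ ∞ fun x => f i x * φ x := fun i =>
    (contMDiff_iff_contDiff.1 (f i).contMDiff).mul hφ
  have hfc : ∀ i : t, HasCompactSupport fun x => f i x * φ x := fun i => hc.mul_left
  have hsum : φ = fun x => ∑ i : t, f i x * φ x := by
    ext x
    rw [← Finset.sum_mul]
    by_cases hx : x ∈ tsupport φ
    · have := f.sum_eq_one hx
      rw [finsum_eq_sum_of_fintype] at this
      rw [this, one_mul]
    · rw [image_eq_zero_of_notMem_tsupport hx, mul_zero]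
  have key : ∀ s : Finset t, ContDiff ℝ ∞ (fun x => ∑ i ∈ s, f i x * φ x) ∧
      HasCompactSupport (fun x => ∑ i ∈ s, f i x * φ x) ∧
      L (fun x => ∑ i ∈ s, f i x * φ x) = 0 := by
    classical
    intro s
    induction s using Finset.induction_on with
    | empty => simpa using ⟨contDiff_const, HasCompactSupport.zero, h0⟩
    | insert a s ha ih =>
      simp only [Finset.sum_insert ha]
      refine ⟨(hfs a).add ih.1, (hfc a).add ih.2.1, ?_⟩
      rw [hadd _ _ (hfs a) (hfc a) ih.1 ih.2.1, ih.2.2, add_zero]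
      refine hU a (htK _ a.2) _ (hfs a) (hfc a) (subset_inter ?_ ?_)
      · exact tsupport_mul_subset_right
      · exact tsupport_mul_subset_left.trans (hf a)
  rw [hsum]
  exact (key Finset.univ).2.2

/-! ### Cutoff functions near a set of finite length -/

theorem exists_ball_cover {S : Set Space} (hS : IsCompact S) (h1 : μH[1] S < ⊤) :
    ∃ C : ℝ, ∀ δ > 0, ∃ (F : Finset ℕ) (x : ℕ → Space) (r : ℕ → ℝ),
      (∀ n ∈ F, x n ∈ S ∧ 0 < r n ∧ r n ≤ δ) ∧ S ⊆ ⋃ n ∈ F, Metric.ball (x n) (r n) ∧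
        ∑ n ∈ F, r n ≤ C := by
  refine ⟨(μH[1] S + 1).toReal + 1, fun δ hδ => ?_⟩
  have hlt : μH[1] S < μH[1] S + 1 := ENNReal.lt_add_right h1.ne one_ne_zero
  have hlt' := hlt
  conv_lhs at hlt' => rw [Measure.hausdorffMeasure_apply]
  have h2 := (le_iSup₂ (f := fun (r : ℝ≥0∞) (_ : 0 < r) => ⨅ (t : ℕ → Set Space)
    (_ : S ⊆ ⋃ n, t n) (_ : ∀ n, Metric.ediam (t n) ≤ r),
      ∑' n, ⨆ _ : (t n).Nonempty, Metric.ediam (t n) ^ (1 : ℝ)) (ENNReal.ofReal (δ / 2))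
    (by simpa using hδ)).trans_lt hlt'
  simp only [iInf_lt_iff] at h2
  obtain ⟨t, hcov, hdiam, hsum⟩ := h2
  set ε : ℕ → ℝ := fun n => min (δ / 2) ((1 / 2) ^ n / 2) with hε
  have hε0 : ∀ n, 0 < ε n := fun n => lt_min (by positivity) (by positivity)
  have hdt : ∀ n, Metric.ediam (t n) ≠ ⊤ := fun n =>
    ((hdiam n).trans_lt ENNReal.ofReal_lt_top).ne
  choose! x hx using fun n (h : (t n ∩ S).Nonempty) => h
  set r : ℕ → ℝ := fun n => Metric.diam (t n) + ε n with hr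
  have hr0 : ∀ n, 0 < r n := fun n => add_pos_of_nonneg_of_pos Metric.diam_nonneg (hε0 n)
  obtain ⟨F, hF⟩ := hS.elim_finite_subcover
    (fun n => {y | (t n ∩ S).Nonempty ∧ y ∈ Metric.ball (x n) (r n)}) (fun n => by
      by_cases hn : (t n ∩ S).Nonempty
      · have he : {y | (t n ∩ S).Nonempty ∧ y ∈ Metric.ball (x n) (r n)} =
            Metric.ball (x n) (r n) := by
          ext y; simp [hn]
        rw [he]
        exact Metric.isOpen_ball
      · simp only [hn, false_and]; exact isOpen_empty) (by
      intro y hy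
      obtain ⟨n, hn⟩ := mem_iUnion.1 (hcov hy)
      have hne : (t n ∩ S).Nonempty := ⟨y, hn, hy⟩
      refine mem_iUnion.2 ⟨n, hne, ?_⟩
      have := Metric.dist_le_diam_of_mem' (hdt n) hn (hx n hne).1
      exact Metric.mem_ball.2 (by linarith [hε0 n]))
  classical
  refine ⟨F.filter fun n => (t n ∩ S).Nonempty, x, r, ?_, ?_, ?_⟩
  · intro n hn
    refine ⟨(hx n (Finset.mem_filter.1 hn).2).2, hr0 n, ?_⟩
    have h3 : Metric.diam (t n) ≤ δ / 2 := by
      rw [Metric.diam]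
      exact ENNReal.toReal_le_of_le_ofReal (by positivity) (hdiam n)
    have h4 : ε n ≤ δ / 2 := min_le_left _ _
    simp only [hr]
    linarith
  · intro y hy
    obtain ⟨n, hn, hne, hyn⟩ := mem_iUnion₂.1 (hF hy)
    exact mem_iUnion₂.2 ⟨n, Finset.mem_filter.2 ⟨hn, hne⟩, hyn⟩
  · simp only [hr]
    rw [Finset.sum_add_distrib]
    refine add_le_add ?_ ?_
    · have h3 : ∑ n ∈ F.filter (fun n => (t n ∩ S).Nonempty), Metric.diam (t n) =
          (∑ n ∈ F.filter (fun n => (t n ∩ S).Nonempty), Metric.ediam (t n)).toReal := by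
        rw [ENNReal.toReal_sum fun n _ => hdt n]
        rfl
      rw [h3]
      refine ENNReal.toReal_mono (ENNReal.add_ne_top.2 ⟨h1.ne, by simp⟩) ?_
      refine le_trans ?_ hsum.le
      refine le_trans (Finset.sum_le_sum fun n hn => ?_) (ENNReal.sum_le_tsum _)
      have hne : (t n).Nonempty := (Finset.mem_filter.1 hn).2.mono inter_subset_left
      rw [iSup_pos hne, ENNReal.rpow_one]
    · refine (Finset.sum_le_sum fun n _ => min_le_right (δ / 2) _).trans ?_
      have h4 : ∀ n : ℕ, ((1 : ℝ) / 2) ^ n / 2 = 1 / 2 / 2 ^ n := fun n => by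
        rw [one_div_pow]; field_simp
      simp only [h4]
      refine ((summable_geometric_two' (1 : ℝ)).sum_le_tsum _ fun n _ => by positivity).trans ?_
      exact (tsum_geometric_two' (1 : ℝ)).le

/-- A profile for cutoff functions. -/
theorem exists_profile : ∃ (θ : ℝ → ℝ) (c : ℝ), ContDiff ℝ ∞ θ ∧ (∀ s, 0 ≤ θ s ∧ θ s ≤ 1) ∧
    θ 0 = 1 ∧ (∀ s, 1 ≤ s → θ s = 0) ∧ 0 ≤ c ∧ ∀ s, 0 ≤ s → deriv θ s ^ 2 * s ≤ c := by
  have hsm : ContDiff ℝ ∞ fun s : ℝ => Real.smoothTransition (1 - s) :=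
    Real.smoothTransition.contDiff.comp (contDiff_const.sub contDiff_id)
  have hcont : Continuous fun s : ℝ => deriv (fun s => Real.smoothTransition (1 - s)) s ^ 2 * s :=
    ((hsm.continuous_deriv (by simp)).pow 2).mul continuous_id
  obtain ⟨c, hc⟩ := isCompact_Icc.exists_bound_of_continuousOn (s := Icc (0 : ℝ) 1)
    hcont.continuousOn
  refine ⟨fun s => Real.smoothTransition (1 - s), max c 0, hsm, fun s =>
    ⟨Real.smoothTransition.nonneg _, Real.smoothTransition.le_one _⟩, by simp,
    fun s hs => Real.smoothTransition.zero_of_nonpos (by linarith), le_max_right _ _,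
    fun s hs => ?_⟩
  by_cases h1 : s ≤ 1
  · exact (le_abs_self _).trans ((hc s ⟨hs, h1⟩).trans (le_max_left _ _))
  · have h0 : deriv (fun s => Real.smoothTransition (1 - s)) s = 0 := by
      have : (fun s : ℝ => Real.smoothTransition (1 - s)) =ᶠ[𝓝 s] fun _ => 0 := by
        filter_upwards [lt_mem_nhds (not_le.1 h1)] with z hz
        exact Real.smoothTransition.zero_of_nonpos (by linarith)
      rw [this.deriv_eq]
      simp
    rw [h0]
    simp

/-- Cutoff functions near a compact set of finite length, with bounded energy. -/
theorem exists_cutoff {S : Set Space} (hS : IsCompact S) (h1 : μH[1] S < ⊤) :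
    ∃ C : ℝ, ∀ δ > 0, ∃ η : Space → ℝ, ContDiff ℝ ∞ η ∧ (∀ x, 0 ≤ η x ∧ η x ≤ 1) ∧
      (∀ x ∈ S, η =ᶠ[𝓝 x] fun _ => 0) ∧ (∀ x ∉ Metric.thickening δ S, η =ᶠ[𝓝 x] fun _ => 1) ∧
      Integrable (fun x => ‖fderiv ℝ η x‖ ^ 2) ∧ ∫ x, ‖fderiv ℝ η x‖ ^ 2 ≤ C := by
  obtain ⟨C, hC⟩ := exists_ball_cover hS h1
  obtain ⟨θ, c, hθ, hθ01, hθ0, hθ1, hc0, hθc⟩ := exists_profile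
  let b : ContDiffBump (0 : Space) := ⟨1, 2, one_pos, one_lt_two⟩
  have hb : ContDiff ℝ ∞ b := b.contDiff
  set K : ℝ := ∫ x, ‖fderiv ℝ b x‖ ^ 2 with hK
  have hbc : Continuous fun x => ‖fderiv ℝ b x‖ ^ 2 := (hb.continuous_fderiv (by simp)).norm.pow 2
  have hbi : Integrable fun x => ‖fderiv ℝ b x‖ ^ 2 := by
    refine hbc.integrable_of_hasCompactSupport ?_
    have := (b.hasCompactSupport.fderiv ℝ).norm
    exact this.comp_left (g := fun s : ℝ => s ^ 2) (by simp)
  have hK0 : 0 ≤ K := integral_nonneg fun x => sq_nonneg _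
  refine ⟨4 * c * (K * C), fun δ hδ => ?_⟩
  obtain ⟨F, z, r, hzr, hcov, hsum⟩ := hC (δ / 3) (by positivity)
  set χ : ℕ → Space → ℝ := fun n x => b ((r n)⁻¹ • (x - z n)) with hχ
  have hχs : ∀ n, ContDiff ℝ ∞ (χ n) := fun n =>
    hb.comp ((contDiff_id.sub contDiff_const).const_smul _)
  have hχd : ∀ n x, fderiv ℝ (χ n) x = (r n)⁻¹ • fderiv ℝ b ((r n)⁻¹ • (x - z n)) := by
    intro n x
    have h2 : HasFDerivAt (fun x => (r n)⁻¹ • (x - z n))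
        ((r n)⁻¹ • ContinuousLinearMap.id ℝ Space) x :=
      ((hasFDerivAt_id x).sub_const (z n)).const_smul (r n)⁻¹
    have h3 := ((hb.differentiable (by simp)) ((r n)⁻¹ • (x - z n))).hasFDerivAt.comp x h2
    refine h3.fderiv.trans ?_
    ext v
    simp
  have hχi : ∀ n ∈ F, Integrable (fun x => ‖fderiv ℝ (χ n) x‖ ^ 2) ∧
      ∫ x, ‖fderiv ℝ (χ n) x‖ ^ 2 = r n * K := by
    intro n hn
    have hr := (hzr n hn).2.1
    have e : ∀ x, ‖fderiv ℝ (χ n) x‖ ^ 2 =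
        (r n)⁻¹ ^ 2 * ‖fderiv ℝ b ((r n)⁻¹ • (x - z n))‖ ^ 2 := by
      intro x
      rw [hχd, norm_smul, mul_pow, norm_inv, Real.norm_of_nonneg hr.le]
    simp only [e]
    have h2 : Integrable fun x => ‖fderiv ℝ b ((r n)⁻¹ • x)‖ ^ 2 :=
      hbi.comp_smul (inv_ne_zero hr.ne')
    refine ⟨(h2.comp_sub_right (z n)).const_mul _, ?_⟩
    rw [integral_const_mul, integral_sub_right_eq_self (fun x => ‖fderiv ℝ b ((r n)⁻¹ • x)‖ ^ 2),
      Measure.integral_comp_inv_smul volume (fun x => ‖fderiv ℝ b x‖ ^ 2), ← hK,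
      finrank_euclideanSpace_fin, abs_of_pos (by positivity), smul_eq_mul]
    field_simp
  set M : Space → ℝ := fun x => ∑ n ∈ F, χ n x ^ 2 with hM
  have hMs : ContDiff ℝ ∞ M := ContDiff.sum fun n _ => (hχs n).pow 2
  have hM0 : ∀ x, 0 ≤ M x := fun x => Finset.sum_nonneg fun n _ => sq_nonneg _
  have hMd : ∀ x, ‖fderiv ℝ M x‖ ≤ 2 * ∑ n ∈ F, χ n x * ‖fderiv ℝ (χ n) x‖ := by
    intro x
    have h2 : HasFDerivAt M (∑ n ∈ F, (2 * χ n x) • fderiv ℝ (χ n) x) x := by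
      refine HasFDerivAt.fun_sum fun n _ => ?_
      have := ((hχs n).differentiable (by simp) x).hasFDerivAt.pow 2
      convert! this using 1
      ext; simp
    rw [h2.fderiv, Finset.mul_sum]
    refine norm_sum_le_of_le _ fun n _ => ?_
    rw [norm_smul, Real.norm_of_nonneg (mul_nonneg zero_le_two b.nonneg), mul_assoc]
  have hηd : ∀ x, ‖fderiv ℝ (fun x => θ (M x)) x‖ ^ 2 ≤
      4 * c * ∑ n ∈ F, ‖fderiv ℝ (χ n) x‖ ^ 2 := by
    intro x
    have h2 : HasFDerivAt (fun x => θ (M x)) (deriv θ (M x) • fderiv ℝ M x) x :=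
      ((hθ.differentiable (by simp)) (M x)).hasDerivAt.comp_hasFDerivAt x
        ((hMs.differentiable (by simp)) x).hasFDerivAt
    rw [h2.fderiv, norm_smul, mul_pow, Real.norm_eq_abs, sq_abs]
    have h3 : ‖fderiv ℝ M x‖ ^ 2 ≤ 4 * (M x * ∑ n ∈ F, ‖fderiv ℝ (χ n) x‖ ^ 2) := by
      refine (pow_le_pow_left₀ (norm_nonneg _) (hMd x) 2).trans ?_
      rw [mul_pow]
      have := Finset.sum_mul_sq_le_sq_mul_sq F (fun n => χ n x) fun n => ‖fderiv ℝ (χ n) x‖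
      linarith
    have h4 : 0 ≤ ∑ n ∈ F, ‖fderiv ℝ (χ n) x‖ ^ 2 := Finset.sum_nonneg fun n _ => sq_nonneg _
    calc deriv θ (M x) ^ 2 * ‖fderiv ℝ M x‖ ^ 2
        ≤ deriv θ (M x) ^ 2 * (4 * (M x * ∑ n ∈ F, ‖fderiv ℝ (χ n) x‖ ^ 2)) :=
          mul_le_mul_of_nonneg_left h3 (sq_nonneg _)
      _ = 4 * (deriv θ (M x) ^ 2 * M x) * ∑ n ∈ F, ‖fderiv ℝ (χ n) x‖ ^ 2 := by ring
      _ ≤ 4 * c * ∑ n ∈ F, ‖fderiv ℝ (χ n) x‖ ^ 2 :=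
          mul_le_mul_of_nonneg_right
            (mul_le_mul_of_nonneg_left (hθc _ (hM0 x)) (by norm_num)) h4
  have hηs : ContDiff ℝ ∞ fun x => θ (M x) := hθ.comp hMs
  have hsumi : Integrable fun x => 4 * c * ∑ n ∈ F, ‖fderiv ℝ (χ n) x‖ ^ 2 :=
    (integrable_finsetSum F fun n hn => (hχi n hn).1).const_mul _
  have hηi : Integrable fun x => ‖fderiv ℝ (fun x => θ (M x)) x‖ ^ 2 := by
    refine hsumi.mono' ((hηs.continuous_fderiv (by simp)).norm.pow 2).aestronglyMeasurable
      (Eventually.of_forall fun x => ?_)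
    rw [Real.norm_of_nonneg (sq_nonneg _)]
    exact hηd x
  refine ⟨fun x => θ (M x), hηs, fun x => hθ01 _, ?_, ?_, hηi, ?_⟩
  · intro x hx
    obtain ⟨n, hn, hxn⟩ := mem_iUnion₂.1 (hcov hx)
    filter_upwards [Metric.isOpen_ball.mem_nhds hxn] with y hy
    refine hθ1 _ ?_
    have hr := (hzr n hn).2.1
    have h2 : χ n y = 1 := by
      refine b.one_of_mem_closedBall ?_
      rw [mem_closedBall_zero_iff, norm_smul, norm_inv, Real.norm_of_nonneg hr.le, ← dist_eq_norm,
        inv_mul_le_iff₀ hr, mul_one]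
      exact hy.le
    have h3 := Finset.single_le_sum (f := fun n => χ n y ^ 2) (fun n _ => sq_nonneg _) hn
    simpa only [h2, one_pow] using h3
  · intro x hx
    have hev : ∀ n ∈ F, ∀ᶠ y in 𝓝 x, χ n y = 0 := by
      intro n hn
      obtain ⟨hz, hr, hrδ⟩ := hzr n hn
      have hd : 2 * r n < dist x (z n) := by
        have : δ ≤ dist x (z n) := by
          by_contra hlt
          exact hx (Metric.mem_thickening_iff.2 ⟨z n, hz, not_le.1 hlt⟩)
        linarith
      have hcd : Continuous fun y => dist y (z n) := continuous_id.dist continuous_const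
      filter_upwards [hcd.continuousAt.eventually_const_lt hd] with y hy
      refine b.zero_of_le_dist ?_
      rw [dist_zero_right, norm_smul, norm_inv, Real.norm_of_nonneg hr.le, ← dist_eq_norm,
        le_inv_mul_iff₀ hr]
      change r n * 2 ≤ _
      linarith
    filter_upwards [(Filter.eventually_all_finset F).2 hev] with y hy
    have : M y = 0 := Finset.sum_eq_zero fun n hn => by rw [hy n hn]; simp
    rw [this, hθ0]
  · refine (integral_mono hηi hsumi hηd).trans ?_
    rw [integral_const_mul, integral_finsetSum F fun n hn => (hχi n hn).1,
      Finset.sum_congr rfl fun n hn => (hχi n hn).2, ← Finset.sum_mul, mul_comm K C]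
    exact mul_le_mul_of_nonneg_left (mul_le_mul_of_nonneg_right hsum hK0) (by positivity)

end FirstOrderSystem

namespace FirstOrderSystem
open scoped ContDiff

/-! ### The divergence theorem on the whole cylinder -/

theorem integral_fderiv_apply_eq_zero {E : Type*} [NormedAddCommGroup E] [NormedSpace ℝ E]
    [FiniteDimensional ℝ E] [MeasurableSpace E] [BorelSpace E] {μ : Measure E}
    [μ.IsAddHaarMeasure] {w : E → ℝ} (hd : Differentiable ℝ w) (hc : HasCompactSupport w) {v : E}
    (hi : Integrable (fun x => fderiv ℝ w x v) μ) : ∫ x, fderiv ℝ w x v ∂μ = 0 := by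
  have := integral_mul_fderiv_eq_neg_fderiv_mul_of_integrable (μ := μ)
    (f := fun _ => (1 : ℝ)) (g := w) (v := v)
    (by simp) (by simpa using hi) (by simpa using hd.continuous.integrable_of_hasCompactSupport hc)
    (fun _ _ => differentiableAt_const _) (fun y _ => hd y)
  simpa using this

theorem tendsto_integral_mul_zero {X : Type*} [MeasurableSpace X] {μ : Measure X}
    {a b : ℕ → X → ℝ} {C : ℝ} (ha : ∀ n, Integrable (fun x => a n x ^ 2) μ)
    (hb : ∀ n, Integrable (fun x => b n x ^ 2) μ)
    (hb' : ∀ n, ∫ x, b n x ^ 2 ∂μ ≤ C)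
    (ha' : Tendsto (fun n => ∫ x, a n x ^ 2 ∂μ) atTop (𝓝 0)) :
    Tendsto (fun n => ∫ x, a n x * b n x ∂μ) atTop (𝓝 0) := by
  set I : ℕ → ℝ := fun n => ∫ x, a n x ^ 2 ∂μ with hI
  have hI0 : ∀ n, 0 ≤ I n := fun n => integral_nonneg fun x => sq_nonneg _
  set s : ℕ → ℝ := fun n => √(I n) + 1 / ((n : ℝ) + 1) with hs
  have hs0 : ∀ n, 0 < s n := fun n => add_pos_of_nonneg_of_pos (Real.sqrt_nonneg _) (by positivity)
  have hsl : Tendsto s atTop (𝓝 0) := by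
    have h1 : Tendsto (fun n => √(I n)) atTop (𝓝 0) := by
      have := (Real.continuous_sqrt.tendsto 0).comp ha'
      rwa [Real.sqrt_zero] at this
    have := h1.add (tendsto_one_div_add_atTop_nhds_zero_nat (𝕜 := ℝ))
    rwa [add_zero] at this
  have hlim : Tendsto (fun n => (s n + s n * C) / 2) atTop (𝓝 0) := by
    simpa using (hsl.add (hsl.mul_const C)).div_const 2
  refine squeeze_zero_norm (fun n => ?_) hlim
  have hpt : ∀ x, ‖a n x * b n x‖ ≤ (1 / 2) * ((s n)⁻¹ * a n x ^ 2 + s n * b n x ^ 2) := by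
    intro x
    have h1 : 0 ≤ (s n)⁻¹ * (|a n x| - s n * |b n x|) ^ 2 :=
      mul_nonneg (inv_nonneg.2 (hs0 n).le) (sq_nonneg _)
    have h2 : (s n)⁻¹ * (|a n x| - s n * |b n x|) ^ 2 =
        (s n)⁻¹ * a n x ^ 2 + s n * b n x ^ 2 - 2 * (|a n x| * |b n x|) := by
      have := (hs0 n).ne'
      rw [← sq_abs (a n x), ← sq_abs (b n x)]
      field_simp
      ring
    rw [norm_mul, Real.norm_eq_abs, Real.norm_eq_abs]
    linarith
  have h1 : Integrable (fun x => (s n)⁻¹ * a n x ^ 2) μ := (ha n).const_mul _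
  have h2 : Integrable (fun x => s n * b n x ^ 2) μ := (hb n).const_mul _
  refine (norm_integral_le_of_norm_le ((h1.add h2).const_mul (1 / 2))
    (Eventually.of_forall hpt)).trans ?_
  simp only [Pi.add_apply]
  rw [integral_const_mul, integral_add h1 h2, integral_const_mul, integral_const_mul]
  have h3 : (s n)⁻¹ * I n ≤ s n := by
    rw [inv_mul_le_iff₀ (hs0 n)]
    have h4 : √(I n) ≤ s n := le_add_of_nonneg_right (by positivity)
    calc I n = √(I n) * √(I n) := (Real.mul_self_sqrt (hI0 n)).symm
      _ ≤ s n * s n := mul_self_le_mul_self (Real.sqrt_nonneg _) h4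
  have h5 := mul_le_mul_of_nonneg_left (hb' n) (hs0 n).le
  simp only [hI] at h3
  linarith

section Global

variable {Ω : Set Space} {T : ℝ} {u : SpaceTime → ℝ}

theorem IsSobolev.integral_mulDeriv_eq_zero (hu : IsSobolev (cylinder Ω T) spatial u)
    (hΩ : IsOpen Ω) (hb : Bornology.IsBounded Ω) {φ : SpaceTime → ℝ} (hφ : ContDiff ℝ 1 φ)
    (hc : HasCompactSupport φ) (hs : tsupport φ ⊆ Ω ×ˢ univ) (e : Space) :
    ∫ p in cylinder Ω T, mulDeriv u φ p (e, 0) = 0 := by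
  have hQ := isOpen_cylinder hΩ T
  have hi := hu.integrableOn_mulDeriv (volume_cylinder_lt_top hb T) (mk_mem_spatial e) hφ hc
  rw [IntegrableOn, cylinder, Measure.volume_eq_prod, ← Measure.prod_restrict] at hi
  rw [cylinder, Measure.volume_eq_prod, ← Measure.prod_restrict, integral_prod_symm _ hi]
  refine integral_eq_zero_of_ae ?_
  filter_upwards [hi.prod_left_ae, ae_restrict_mem measurableSet_Ioo] with t hti ht
  have hnot : ∀ {x}, x ∉ Ω → (x, t) ∉ tsupport φ := fun hx hm => hx (hs hm).1
  have hd : ∀ x, HasFDerivAt (fun x => u (x, t) * φ (x, t))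
      ((mulDeriv u φ (x, t)).comp (ContinuousLinearMap.inl ℝ Space ℝ)) x := by
    intro x
    have hd' : HasFDerivAt (fun p => u p * φ p) (mulDeriv u φ (x, t)) (x, t) := by
      by_cases hx : x ∈ Ω
      · exact hu.hasFDerivAt_mul hQ (hφ.differentiable one_ne_zero) ⟨hx, ht⟩
      · exact hasFDerivAt_mul_of_notMem (hnot hx)
    exact hd'.comp x (hasFDerivAt_prodMk_left (𝕜 := ℝ) x t)
  have hfd : ∀ x, mulDeriv u φ (x, t) (e, 0) =
      fderiv ℝ (fun x => u (x, t) * φ (x, t)) x e := fun x => by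
    rw [(hd x).fderiv]; rfl
  have h0 : ∀ x ∉ Ω, mulDeriv u φ (x, t) (e, 0) = 0 := by
    intro x hx
    rw [mulDeriv_apply, fderiv_of_notMem_tsupport ℝ (hnot hx),
      image_eq_zero_of_notMem_tsupport (hnot hx)]
    simp
  have hcs : HasCompactSupport fun x => u (x, t) * φ (x, t) := by
    refine HasCompactSupport.of_support_subset_isCompact (hc.isCompact.image continuous_fst) ?_
    intro x hx
    refine ⟨(x, t), ?_, rfl⟩
    by_contra hm
    exact hx (by simp [image_eq_zero_of_notMem_tsupport hm])
  rw [setIntegral_eq_integral_of_forall_compl_eq_zero h0]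
  have hi' : Integrable fun x => mulDeriv u φ (x, t) (e, 0) :=
    (integrableOn_iff_integrable_of_support_subset
      (fun y hy => by_contra fun hy' => hy (h0 y hy'))).1 hti
  simp only [hfd] at hi' ⊢
  exact integral_fderiv_apply_eq_zero (fun x => (hd x).differentiableAt) hcs hi'

/-! ### The field of normals -/

theorem euclideanHausdorffMeasure_two_eq_zero {S : Set Space} (h : μH[1] S < ⊤) :
    (μHE[2] : Measure Space) S = 0 := by
  have h1 := (Measure.hausdorffMeasure_zero_or_top (X := Space) one_lt_two S).resolve_right h.ne
  rw [Measure.euclideanHausdorffMeasure_def, Measure.smul_apply, Measure.nnreal_smul_coe_apply]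
  have h2 : μH[((2 : ℕ) : ℝ)] S = 0 := by simpa using h1
  rw [h2, mul_zero]

theorem HasPiecewiseSmoothBoundary.aestronglyMeasurable_outwardNormal
    (h : HasPiecewiseSmoothBoundary Ω) (hΩ : IsOpen Ω) (hb : Bornology.IsBounded Ω) :
    AEStronglyMeasurable (outwardNormal Ω) ((μHE[2] : Measure Space).restrict (frontier Ω)) := by
  obtain ⟨S, hSf, hSc, hS1, hreg⟩ := h.regular
  have h0 := euclideanHausdorffMeasure_two_eq_zero hS1
  have hcont : ContinuousOn (outwardNormal Ω) (frontier Ω \ S) := by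
    intro x hx
    obtain ⟨ρ, hρ⟩ := hreg x hx
    obtain ⟨V, -, hVo, hxV, hc, -⟩ := IsOutwardNormal.exists_hasTrace hΩ hb ⟨ρ, hρ, rfl⟩ 0 univ_mem
    have h1 := hc x ⟨hx.1, hxV⟩
    exact ((continuousWithinAt_inter (hVo.mem_nhds hxV)).1 h1).mono sdiff_subset
  have h2 := hcont.aestronglyMeasurable (μ := (μHE[2] : Measure Space))
    (isClosed_frontier.measurableSet.diff hSc.measurableSet)
  rwa [Measure.restrict_congr_set (sdiff_null_ae_eq_self h0)] at h2

theorem lateralMeasure_restrict (Ω : Set Space) (T : ℝ) (h : HasPiecewiseSmoothBoundary Ω)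
    {V : Set Space} (hV : MeasurableSet V) :
    (lateralMeasure Ω T).restrict (V ×ˢ univ) = lateralPart Ω T V := by
  have : IsFiniteMeasure ((μHE[2] : Measure Space).restrict (frontier Ω)) :=
    ⟨by simpa using h.finite_area⟩
  rw [lateralMeasure, lateralPart, ← Measure.prod_restrict, Measure.restrict_univ,
    Measure.restrict_restrict hV, inter_comm]

theorem HasPiecewiseSmoothBoundary.isFiniteMeasure (h : HasPiecewiseSmoothBoundary Ω) (T : ℝ) :
    IsFiniteMeasure (lateralMeasure Ω T) := by
  have : IsFiniteMeasure ((μHE[2] : Measure Space).restrict (frontier Ω)) :=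
    ⟨by simpa using h.finite_area⟩
  unfold lateralMeasure
  infer_instance

theorem HasPiecewiseSmoothBoundary.integrable_mul_inner (h : HasPiecewiseSmoothBoundary Ω)
    (hΩ : IsOpen Ω) (hb : Bornology.IsBounded Ω) {A : SpaceTime → ℝ}
    (hA : Integrable A (lateralMeasure Ω T)) (e : Space) :
    Integrable (fun p => A p * inner ℝ (outwardNormal Ω p.1) e) (lateralMeasure Ω T) := by
  have : IsFiniteMeasure ((μHE[2] : Measure Space).restrict (frontier Ω)) :=
    ⟨by simpa using h.finite_area⟩
  refine hA.mul_bdd (c := ‖e‖) ?_ (Eventually.of_forall fun p => ?_)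
  · have h1 := (h.aestronglyMeasurable_outwardNormal hΩ hb).inner
      (aestronglyMeasurable_const (b := e)) (𝕜 := ℝ)
    exact h1.comp_quasiMeasurePreserving Measure.quasiMeasurePreserving_fst
  · refine (norm_inner_le_norm _ _).trans ?_
    calc ‖outwardNormal Ω p.1‖ * ‖e‖ ≤ 1 * ‖e‖ :=
          mul_le_mul_of_nonneg_right (norm_outwardNormal_le _ _) (norm_nonneg _)
      _ = ‖e‖ := one_mul _

end Global
end FirstOrderSystem

namespace FirstOrderSystem
open scoped ContDiff

section Global

variable {Ω : Set Space} {T : ℝ} {u : SpaceTime → ℝ}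

theorem HasPiecewiseSmoothBoundary.lateralPart_mono (h : HasPiecewiseSmoothBoundary Ω)
    {V V₀ : Set Space} (hV : MeasurableSet V) (hVV : V ⊆ V₀) :
    lateralPart Ω T V ≤ lateralPart Ω T V₀ := by
  have : IsFiniteMeasure ((μHE[2] : Measure Space).restrict (frontier Ω ∩ V₀)) :=
    ⟨by simpa using (measure_mono inter_subset_left).trans_lt h.finite_area⟩
  have h1 : lateralPart Ω T V = (lateralPart Ω T V₀).restrict (V ×ˢ univ) := by
    rw [lateralPart, lateralPart, ← Measure.prod_restrict, Measure.restrict_univ,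
      Measure.restrict_restrict hV]
    congr 2
    ext x
    constructor
    · rintro ⟨h1, h2⟩; exact ⟨h2, h1, hVV h2⟩
    · rintro ⟨h1, h2, -⟩; exact ⟨h2, h1⟩
  rw [h1]
  exact Measure.restrict_le_self

theorem mulDeriv_add {φ ψ : SpaceTime → ℝ} {p : SpaceTime} (hφ : DifferentiableAt ℝ φ p)
    (hψ : DifferentiableAt ℝ ψ p) (e : SpaceTime) :
    mulDeriv u (fun x => φ x + ψ x) p e = mulDeriv u φ p e + mulDeriv u ψ p e := by
  simp only [mulDeriv_apply, fderiv_fun_add hφ hψ, add_apply]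
  ring

theorem mulDeriv_mul {φ ψ : SpaceTime → ℝ} {p : SpaceTime} (hφ : DifferentiableAt ℝ φ p)
    (hψ : DifferentiableAt ℝ ψ p) (e : SpaceTime) :
    mulDeriv u (fun x => ψ x * φ x) p e =
      mulDeriv u φ p e * ψ p + u p * φ p * fderiv ℝ ψ p e := by
  simp only [mulDeriv_apply, fderiv_fun_mul hψ hφ, add_apply, smul_apply, smul_eq_mul]
  ring

theorem integral_mul_outwardNormal_eq_zero {A φ : SpaceTime → ℝ} {e : Space}
    (h : ∀ x ∈ frontier Ω, ∀ t, φ (x, t) = 0) :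
    ∫ p, A p * φ p * inner ℝ (outwardNormal Ω p.1) e ∂(lateralMeasure Ω T) = 0 := by
  refine integral_eq_zero_of_ae ?_
  have h1 : ∀ᵐ p ∂(lateralMeasure Ω T), p.1 ∈ frontier Ω :=
    Measure.quasiMeasurePreserving_fst.ae (ae_restrict_mem isClosed_frontier.measurableSet)
  filter_upwards [h1] with p hp
  rw [show p = (p.1, p.2) from rfl, h _ hp]
  simp

/-- The divergence theorem for test functions supported away from the singular set of the
boundary. -/
theorem integral_mulDeriv_eq_of_regular (h : HasPiecewiseSmoothBoundary Ω) (hΩ : IsOpen Ω)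
    (hb : Bornology.IsBounded Ω) (hu : IsSobolev (cylinder Ω T) spatial u) {A : SpaceTime → ℝ}
    (hA : MemLp A 2 (lateralMeasure Ω T))
    (htr : ∀ x₀ ν : Space, IsOutwardNormal Ω x₀ ν → ∃ V ∈ 𝓝 x₀,
      Tendsto (fun s : ℝ => eLpNorm (fun p : SpaceTime => u (p.1 - s • ν, p.2) - A p) 2
        (lateralPart Ω T V)) (𝓝[>] 0) (𝓝 0))
    {φ : SpaceTime → ℝ} (hφ : ContDiff ℝ ∞ φ) (hc : HasCompactSupport φ)
    (hreg : ∀ p ∈ tsupport φ, p.1 ∈ frontier Ω → ∃ ρ, IsLocalDefiningFunction Ω p.1 ρ)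
    (e : Space) :
    ∫ p in cylinder Ω T, mulDeriv u φ p (e, 0) =
      ∫ p, A p * φ p * inner ℝ (outwardNormal Ω p.1) e ∂(lateralMeasure Ω T) := by
  have hfin := h.isFiniteMeasure T
  have hQf := volume_cylinder_lt_top hb T
  have h1φ : ∀ {ψ : SpaceTime → ℝ}, ContDiff ℝ ∞ ψ → ContDiff ℝ 1 ψ := fun hψ =>
    hψ.of_le (by exact_mod_cast le_top)
  have hAn := h.integrable_mul_inner hΩ hb (hA.integrable one_le_two) e
  have hAi : ∀ {ψ : SpaceTime → ℝ}, ContDiff ℝ ∞ ψ → HasCompactSupport ψ →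
      Integrable (fun p => A p * ψ p * inner ℝ (outwardNormal Ω p.1) e) (lateralMeasure Ω T) := by
    intro ψ hψ hψc
    refine (integrable_mul_of_compactSupport_real hAn measurable_id hψ.continuous hψc).congr
      (Eventually.of_forall fun p => ?_)
    simp only [id]
    ring
  rw [← sub_eq_zero]
  refine eq_zero_of_locally_eq_zero (L := fun φ => (∫ p in cylinder Ω T, mulDeriv u φ p (e, 0)) -
    ∫ p, A p * φ p * inner ℝ (outwardNormal Ω p.1) e ∂(lateralMeasure Ω T)) ?_ hφ hc ?_
  · intro ψ χ hψ hψc hχ hχc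
    simp only [mulDeriv_add (hψ.differentiable (by simp) _) (hχ.differentiable (by simp) _),
      mul_add, add_mul]
    rw [integral_add (hu.integrableOn_mulDeriv hQf (mk_mem_spatial e) (h1φ hψ) hψc)
      (hu.integrableOn_mulDeriv hQf (mk_mem_spatial e) (h1φ hχ) hχc),
      integral_add (hAi hψ hψc) (hAi hχ hχc)]
    ring
  · rintro ⟨x, t⟩ hxt
    by_cases hxf : x ∈ frontier Ω
    · obtain ⟨ρ, hρ⟩ := hreg _ hxt hxf
      have hn : IsOutwardNormal Ω x (‖gradient ρ x‖⁻¹ • gradient ρ x) := ⟨ρ, hρ, rfl⟩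
      obtain ⟨V₀, hV₀, ht⟩ := htr _ _ hn
      obtain ⟨V, hVV, hVo, hxV, -, hG⟩ := hn.exists_hasTrace hΩ hb T hV₀
      obtain ⟨G, hG⟩ := hG u hu
      have hle := h.lateralPart_mono (T := T) hVo.measurableSet hVV
      have hrestr := lateralMeasure_restrict Ω T h hVo.measurableSet
      have hae : G =ᵐ[lateralPart Ω T V] A := by
        refine hG.ae_eq (hA.1.mono_measure ?_) ?_
        · rw [← hrestr]; exact Measure.restrict_le_self
        · exact tendsto_of_tendsto_of_tendsto_of_le_of_le tendsto_const_nhds ht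
            (fun s => zero_le) fun s => eLpNorm_mono_measure _ hle
      refine ⟨V ×ˢ univ, hVo.prod isOpen_univ, ⟨hxV, mem_univ t⟩, fun ψ hψ hψc hs => ?_⟩
      have hs' := hs.trans inter_subset_right
      rw [hG.gauss ψ (h1φ hψ) hψc hs' e, sub_eq_zero]
      calc ∫ p, G p * ψ p * inner ℝ (outwardNormal Ω p.1) e ∂(lateralPart Ω T V)
          = ∫ p, A p * ψ p * inner ℝ (outwardNormal Ω p.1) e ∂(lateralPart Ω T V) := by
            refine integral_congr_ae ?_
            filter_upwards [hae] with p hp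
            rw [hp]
        _ = _ := by
          rw [← hrestr]
          refine setIntegral_eq_integral_of_forall_compl_eq_zero fun p hp => ?_
          rw [image_eq_zero_of_notMem_tsupport fun hm => hp (hs' hm)]
          simp
    · by_cases hxΩ : x ∈ Ω
      · refine ⟨Ω ×ˢ univ, hΩ.prod isOpen_univ, ⟨hxΩ, mem_univ t⟩, fun ψ hψ hψc hs => ?_⟩
        have hs' := hs.trans inter_subset_right
        rw [hu.integral_mulDeriv_eq_zero hΩ hb (h1φ hψ) hψc hs' e,
          integral_mul_outwardNormal_eq_zero, sub_zero]
        intro y hy s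
        refine image_eq_zero_of_notMem_tsupport fun hm => ?_
        rw [hΩ.frontier_eq] at hy
        exact hy.2 (hs' hm).1
      · have hxc : x ∉ closure Ω := fun hcl => hxf ⟨hcl, fun hi => hxΩ (interior_subset hi)⟩
        refine ⟨(closure Ω)ᶜ ×ˢ univ, isClosed_closure.isOpen_compl.prod isOpen_univ,
          ⟨hxc, mem_univ t⟩, fun ψ hψ hψc hs => ?_⟩
        have hs' := hs.trans inter_subset_right
        rw [integral_mul_outwardNormal_eq_zero, sub_zero]
        · refine setIntegral_eq_zero_of_forall_eq_zero fun p hp => ?_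
          have hp' : p ∉ tsupport ψ := fun hm => (hs' hm).1 (subset_closure hp.1)
          rw [mulDeriv_apply, fderiv_of_notMem_tsupport ℝ hp', image_eq_zero_of_notMem_tsupport hp']
          simp
        · intro y hy s
          exact image_eq_zero_of_notMem_tsupport fun hm => (hs' hm).1 hy.1

/-- The divergence theorem on the cylinder over a domain with piecewise smooth boundary. -/
theorem integral_mulDeriv_eq (h : HasPiecewiseSmoothBoundary Ω) (hΩ : IsOpen Ω)
    (hb : Bornology.IsBounded Ω) (hT : 0 < T) (hu : IsSobolev (cylinder Ω T) spatial u)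
    {A : SpaceTime → ℝ} (hA : MemLp A 2 (lateralMeasure Ω T))
    (htr : ∀ x₀ ν : Space, IsOutwardNormal Ω x₀ ν → ∃ V ∈ 𝓝 x₀,
      Tendsto (fun s : ℝ => eLpNorm (fun p : SpaceTime => u (p.1 - s • ν, p.2) - A p) 2
        (lateralPart Ω T V)) (𝓝[>] 0) (𝓝 0))
    {φ : SpaceTime → ℝ} (hφ : ContDiff ℝ ∞ φ) (hc : HasCompactSupport φ) (e : Space) :
    ∫ p in cylinder Ω T, mulDeriv u φ p (e, 0) =
      ∫ p, A p * φ p * inner ℝ (outwardNormal Ω p.1) e ∂(lateralMeasure Ω T) := by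
  have hfin := h.isFiniteMeasure T
  have hfin' : IsFiniteMeasure ((μHE[2] : Measure Space).restrict (frontier Ω)) :=
    ⟨by simpa using h.finite_area⟩
  have hQ := isOpen_cylinder hΩ T
  have hQf := volume_cylinder_lt_top hb T
  have hφ1 : ContDiff ℝ 1 φ := hφ.of_le (by exact_mod_cast le_top)
  have hφd : Differentiable ℝ φ := hφ1.differentiable one_ne_zero
  obtain ⟨S, hSf, hSc, hS1, hreg⟩ := h.regular
  have hScpt : IsCompact S := hb.isCompact_closure.of_isClosed_subset hSc
    (hSf.trans frontier_subset_closure)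
  obtain ⟨C, hC⟩ := exists_cutoff hScpt hS1
  choose! η hηs hη01 hηS hη1 hηi hηC using hC
  set δ : ℕ → ℝ := fun n => 1 / ((n : ℝ) + 1) with hδ
  have hδ0 : ∀ n, 0 < δ n := fun n => by positivity
  have hδl : Tendsto δ atTop (𝓝 0) := tendsto_one_div_add_atTop_nhds_zero_nat
  set χ : ℕ → SpaceTime → ℝ := fun n p => η (δ n) p.1 with hχ
  have hχs : ∀ n, ContDiff ℝ ∞ (χ n) := fun n => (hηs _ (hδ0 n)).comp contDiff_fst
  have hχd : ∀ n p, fderiv ℝ (χ n) p (e, 0) = fderiv ℝ (η (δ n)) p.1 e := by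
    intro n p
    have h1 := ((hηs _ (hδ0 n)).differentiable (by simp) p.1).hasFDerivAt.comp p
      (hasFDerivAt_fst (𝕜 := ℝ))
    refine (DFunLike.congr_fun h1.fderiv _).trans ?_
    rfl
  have hχ1 : ∀ n p, ‖χ n p‖ ≤ 1 := fun n p => by
    rw [Real.norm_of_nonneg (hη01 _ (hδ0 n) _).1]; exact (hη01 _ (hδ0 n) _).2
  have hev : ∀ x ∉ S, ∀ᶠ n in atTop, x ∉ Metric.thickening (δ n) S := by
    intro x hx
    obtain ⟨ε, hε, hball⟩ := Metric.isOpen_iff.1 hSc.isOpen_compl x hx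
    filter_upwards [hδl.eventually_lt_const hε] with n hn hm
    obtain ⟨z, hz, hd⟩ := Metric.mem_thickening_iff.1 hm
    refine hball (Metric.mem_ball.2 ?_) hz
    rw [dist_comm]
    exact hd.trans hn
  have hχl : ∀ p : SpaceTime, p.1 ∉ S → Tendsto (fun n => χ n p) atTop (𝓝 1) := by
    intro p hp
    refine tendsto_const_nhds.congr' ?_
    filter_upwards [hev _ hp] with n hn
    exact ((hη1 _ (hδ0 n) _ hn).self_of_nhds).symm
  have hQS : ∀ p ∈ cylinder Ω T, p.1 ∉ S := by
    intro p hp hS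
    have := hSf hS
    rw [hΩ.frontier_eq] at this
    exact this.2 hp.1
  -- the identity for the truncated test functions
  have hident : ∀ n, ∫ p in cylinder Ω T, mulDeriv u (fun p => χ n p * φ p) p (e, 0) =
      ∫ p, A p * (χ n p * φ p) * inner ℝ (outwardNormal Ω p.1) e ∂(lateralMeasure Ω T) := by
    intro n
    refine integral_mulDeriv_eq_of_regular h hΩ hb hu hA htr ((hχs n).mul hφ) hc.mul_left ?_ e
    intro p hp hpf
    refine hreg p.1 ⟨hpf, fun hpS => ?_⟩
    refine notMem_tsupport_iff_eventuallyEq.2 ?_ hp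
    filter_upwards [continuous_fst.continuousAt.eventually (hηS _ (hδ0 n) _ hpS)] with q hq
    have : χ n q = 0 := hq
    simp only [this, zero_mul]
    rfl
  have hDi : IntegrableOn (fun p => mulDeriv u φ p (e, 0)) (cylinder Ω T) :=
    hu.integrableOn_mulDeriv hQf (mk_mem_spatial e) hφ1 hc
  have hDi' : ∀ n, IntegrableOn (fun p => mulDeriv u φ p (e, 0) * χ n p) (cylinder Ω T) := fun n =>
    hDi.mul_bdd (c := 1) (hχs n).continuous.aestronglyMeasurable
      (Eventually.of_forall (hχ1 n))
  have hsplit : ∀ n, ∫ p in cylinder Ω T, mulDeriv u (fun p => χ n p * φ p) p (e, 0) =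
      (∫ p in cylinder Ω T, mulDeriv u φ p (e, 0) * χ n p) +
        ∫ p in cylinder Ω T, u p * φ p * fderiv ℝ (η (δ n)) p.1 e := by
    intro n
    have e1 : ∀ p, mulDeriv u (fun p => χ n p * φ p) p (e, 0) =
        mulDeriv u φ p (e, 0) * χ n p + u p * φ p * fderiv ℝ (η (δ n)) p.1 e := fun p => by
      rw [mulDeriv_mul (hφd p) ((hχs n).differentiable (by simp) p), hχd]
    have h1 := hu.integrableOn_mulDeriv hQf (mk_mem_spatial e)
      (((hχs n).mul hφ).of_le (by exact_mod_cast le_top : (1 : ℕ∞ω) ≤ (∞ : ℕ∞ω))) hc.mul_left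
    simp only [e1] at h1 ⊢
    refine integral_add (hDi' n) ((h1.sub (hDi' n)).congr (Eventually.of_forall fun p => ?_))
    simp
  have l1 : Tendsto (fun n => ∫ p in cylinder Ω T, mulDeriv u φ p (e, 0) * χ n p) atTop
      (𝓝 (∫ p in cylinder Ω T, mulDeriv u φ p (e, 0))) := by
    refine tendsto_integral_of_dominated_convergence (fun p => ‖mulDeriv u φ p (e, 0)‖)
      (fun n => (hDi' n).1) hDi.norm (fun n => Eventually.of_forall fun p => ?_) ?_
    · rw [norm_mul]
      exact mul_le_of_le_one_right (norm_nonneg _) (hχ1 n p)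
    · filter_upwards [ae_restrict_mem hQ.measurableSet] with p hp
      have := (hχl p (hQS p hp)).const_mul (mulDeriv u φ p (e, 0))
      rwa [mul_one] at this
  have hAn : Integrable (fun p => A p * φ p * inner ℝ (outwardNormal Ω p.1) e)
      (lateralMeasure Ω T) := by
    refine (integrable_mul_of_compactSupport_real
      (h.integrable_mul_inner hΩ hb (hA.integrable one_le_two) e) measurable_id
      hφ.continuous hc).congr (Eventually.of_forall fun p => ?_)
    simp only [id]
    ring
  have l2 : Tendsto (fun n => ∫ p, A p * (χ n p * φ p) * inner ℝ (outwardNormal Ω p.1) e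
      ∂(lateralMeasure Ω T)) atTop
      (𝓝 (∫ p, A p * φ p * inner ℝ (outwardNormal Ω p.1) e ∂(lateralMeasure Ω T))) := by
    have e1 : ∀ n p, A p * (χ n p * φ p) * inner ℝ (outwardNormal Ω p.1) e =
        A p * φ p * inner ℝ (outwardNormal Ω p.1) e * χ n p := fun n p => by ring
    simp only [e1]
    refine tendsto_integral_of_dominated_convergence
      (fun p => ‖A p * φ p * inner ℝ (outwardNormal Ω p.1) e‖)
      (fun n => hAn.1.mul (hχs n).continuous.aestronglyMeasurable) hAn.norm
      (fun n => Eventually.of_forall fun p => ?_) ?_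
    · rw [norm_mul _ (χ n p)]
      exact mul_le_of_le_one_right (norm_nonneg _) (hχ1 n p)
    · have h0 : ∀ᵐ x ∂((μHE[2] : Measure Space).restrict (frontier Ω)), x ∉ S := by
        refine ae_restrict_of_ae ?_
        exact measure_eq_zero_iff_ae_notMem.1 (euclideanHausdorffMeasure_two_eq_zero hS1)
      filter_upwards [Measure.quasiMeasurePreserving_fst.ae h0] with p hp
      have := (hχl p hp).const_mul (A p * φ p * inner ℝ (outwardNormal Ω p.1) e)
      rwa [mul_one] at this
  -- the error term tends to zero by the energy bound
  have l3 : Tendsto (fun n => ∫ p in cylinder Ω T, u p * φ p * fderiv ℝ (η (δ n)) p.1 e) atTop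
      (𝓝 0) := by
    obtain ⟨cφ, hcφ⟩ := hc.exists_bound_of_continuous hφ.continuous
    have hu2 : IntegrableOn (fun p => u p ^ 2) (cylinder Ω T) :=
      (memLp_two_iff_integrable_sq hu.memLp.1).1 hu.memLp
    have huφ : IntegrableOn (fun p => (u p * φ p) ^ 2) (cylinder Ω T) := by
      have := hu2.mul_bdd (c := cφ ^ 2) (g := fun p => φ p ^ 2)
        (hφ.continuous.pow 2).aestronglyMeasurable (Eventually.of_forall fun p => by
          rw [norm_pow]; exact pow_le_pow_left₀ (norm_nonneg _) (hcφ p) 2)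
      refine this.congr (Eventually.of_forall fun p => ?_)
      simp only
      ring
    set R : ℕ → Set SpaceTime := fun n => Metric.thickening (δ n) S ×ˢ univ with hR
    have hRm : ∀ n, MeasurableSet (R n) := fun n =>
      Metric.isOpen_thickening.measurableSet.prod MeasurableSet.univ
    have e1 : ∀ n p, u p * φ p * fderiv ℝ (η (δ n)) p.1 e =
        (R n).indicator (fun p => u p * φ p) p * fderiv ℝ (η (δ n)) p.1 e := by
      intro n p
      by_cases hp : p ∈ R n
      · rw [indicator_of_mem hp]
      · have hp' : p.1 ∉ Metric.thickening (δ n) S := fun hm => hp ⟨hm, mem_univ _⟩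
        rw [(hη1 _ (hδ0 n) _ hp').fderiv_eq]
        simp
    simp only [e1]
    have e2 : ∀ n p, (R n).indicator (fun p => u p * φ p) p ^ 2 =
        (R n).indicator (fun p => (u p * φ p) ^ 2) p := by
      intro n p
      by_cases hp : p ∈ R n
      · simp only [indicator_of_mem hp]
      · simp only [indicator_of_notMem hp]; simp
    have hbi : ∀ n, IntegrableOn (fun p : SpaceTime => ‖fderiv ℝ (η (δ n)) p.1‖ ^ 2)
        (cylinder Ω T) ∧ ∫ p in cylinder Ω T, ‖fderiv ℝ (η (δ n)) p.1‖ ^ 2 ≤ T * C := by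
      intro n
      have hi := (hηi _ (hδ0 n)).integrableOn (s := Ω)
      have h1 : Integrable (fun p : Space × ℝ => ‖fderiv ℝ (η (δ n)) p.1‖ ^ 2)
          ((volume.restrict Ω).prod (volume.restrict (Ioo 0 T))) := Integrable.comp_fst hi _
      refine ⟨?_, ?_⟩
      · rw [IntegrableOn, cylinder, Measure.volume_eq_prod, ← Measure.prod_restrict]
        exact h1
      · rw [cylinder, Measure.volume_eq_prod, ← Measure.prod_restrict, integral_prod_symm _ h1]
        change ∫ _ in Ioo 0 T, (∫ x in Ω, ‖fderiv ℝ (η (δ n)) x‖ ^ 2) ≤ T * C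
        rw [setIntegral_const, Real.volume_real_Ioo_of_le hT.le, sub_zero, smul_eq_mul]
        refine mul_le_mul_of_nonneg_left ?_ hT.le
        exact (setIntegral_le_integral (hηi _ (hδ0 n))
          (Eventually.of_forall fun x => sq_nonneg _)).trans (hηC _ (hδ0 n))
    have hcont : ∀ n, Continuous fun p : SpaceTime => fderiv ℝ (η (δ n)) p.1 e := fun n =>
      (((hηs _ (hδ0 n)).continuous_fderiv (by simp)).comp continuous_fst).clm_apply
        continuous_const
    have hble : ∀ n (p : SpaceTime), (fderiv ℝ (η (δ n)) p.1 e) ^ 2 ≤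
        ‖fderiv ℝ (η (δ n)) p.1‖ ^ 2 * ‖e‖ ^ 2 := by
      intro n p
      rw [← mul_pow, ← sq_abs]
      exact pow_le_pow_left₀ (abs_nonneg _) ((fderiv ℝ (η (δ n)) p.1).le_opNorm e) 2
    have hbi2 : ∀ n, IntegrableOn (fun p : SpaceTime => (fderiv ℝ (η (δ n)) p.1 e) ^ 2)
        (cylinder Ω T) := fun n =>
      ((hbi n).1.mul_const (‖e‖ ^ 2)).mono' ((hcont n).pow 2).aestronglyMeasurable
        (Eventually.of_forall fun p => by
          rw [Real.norm_of_nonneg (sq_nonneg _)]; exact hble n p)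
    refine tendsto_integral_mul_zero (C := T * C * ‖e‖ ^ 2) ?_ hbi2 ?_ ?_
    · intro n
      simp only [e2]
      exact huφ.indicator (hRm n)
    · intro n
      refine (integral_mono (hbi2 n) ((hbi n).1.mul_const (‖e‖ ^ 2)) (hble n)).trans ?_
      rw [integral_mul_const]
      exact mul_le_mul_of_nonneg_right (hbi n).2 (sq_nonneg _)
    · simp only [e2]
      rw [← integral_zero SpaceTime ℝ (μ := volume.restrict (cylinder Ω T))]
      refine tendsto_integral_of_dominated_convergence (fun p => (u p * φ p) ^ 2)
        (fun n => (huφ.indicator (hRm n)).1) huφ (fun n => Eventually.of_forall fun p => ?_) ?_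
      · by_cases hp : p ∈ R n
        · rw [indicator_of_mem hp, Real.norm_of_nonneg (sq_nonneg _)]
        · rw [indicator_of_notMem hp, norm_zero]; exact sq_nonneg _
      · filter_upwards [ae_restrict_mem hQ.measurableSet] with p hp
        refine tendsto_const_nhds.congr' ?_
        filter_upwards [hev _ (hQS p hp)] with n hn
        rw [indicator_of_notMem fun hm => hn hm.1]
  have lhs := l1.add l3
  rw [add_zero] at lhs
  refine tendsto_nhds_unique (lhs.congr fun n => ?_) l2
  rw [← hsplit, hident]

end Global
end FirstOrderSystem

namespace FirstOrderSystem
open scoped ContDiff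

/-! ### Traces on the bottom and the top of the cylinder -/

theorem measurePreserving_reflect_cylinder (Ω : Set Space) (T : ℝ) :
    MeasurePreserving (fun p : SpaceTime => (p.1, T - p.2)) (volume.restrict (cylinder Ω T))
      (volume.restrict (cylinder Ω T)) := by
  have h1 := (Measure.measurePreserving_sub_left (volume : Measure ℝ) T).restrict_preimage
    (s := Ioo 0 T) measurableSet_Ioo
  rw [preimage_const_sub_Ioo, sub_self, sub_zero] at h1
  rw [cylinder, Measure.volume_eq_prod, ← Measure.prod_restrict]
  exact (MeasurePreserving.id (volume.restrict Ω)).prod h1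

theorem tendsto_sub_left_nhdsLT (T : ℝ) : Tendsto (fun t => T - t) (𝓝[<] T) (𝓝[>] 0) := by
  refine tendsto_nhdsWithin_iff.2 ⟨?_, ?_⟩
  · have : Tendsto (fun t => T - t) (𝓝 T) (𝓝 (T - T)) := (continuous_const.sub continuous_id).tendsto T
    rw [sub_self] at this
    exact this.mono_left nhdsWithin_le_nhds
  · filter_upwards [self_mem_nhdsWithin] with t ht
    exact sub_pos.2 (mem_Iio.1 ht)

theorem hasDerivAt_mk_right (x : Space) (t : ℝ) :
    HasDerivAt (fun s : ℝ => ((x, s) : SpaceTime)) (0, 1) t :=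
  (hasDerivAt_const t x).prodMk (hasDerivAt_id t)

/-- `g₀` and `g₁` are the traces of `u` at `t = 0` and `t = T`. -/
structure HasTimeTraces (Ω : Set Space) (T : ℝ) (u : SpaceTime → ℝ) (g₀ g₁ : Space → ℝ) :
    Prop where
  memLp_initial : MemLp g₀ 2 (volume.restrict Ω)
  memLp_terminal : MemLp g₁ 2 (volume.restrict Ω)
  initial : Tendsto (fun t : ℝ => eLpNorm (fun x => u (x, t) - g₀ x) 2 (volume.restrict Ω))
    (𝓝[>] 0) (𝓝 0)
  terminal : Tendsto (fun t : ℝ => eLpNorm (fun x => u (x, t) - g₁ x) 2 (volume.restrict Ω))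
    (𝓝[<] T) (𝓝 0)
  integral_mulDeriv : ∀ φ : SpaceTime → ℝ, ContDiff ℝ 1 φ → HasCompactSupport φ →
    ∫ p in cylinder Ω T, mulDeriv u φ p (0, 1) =
      (∫ x in Ω, g₁ x * φ (x, T)) - ∫ x in Ω, g₀ x * φ (x, 0)

section Time

variable {Ω : Set Space} {T : ℝ} {W : Set SpaceTime} {u : SpaceTime → ℝ}

theorem IsSobolev.aestronglyMeasurable_slice (hu : IsSobolev (cylinder Ω T) W u) (hΩ : IsOpen Ω)
    {t : ℝ} (ht : t ∈ Ioo 0 T) :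
    AEStronglyMeasurable (fun x => u (x, t)) (volume.restrict Ω) :=
  (hu.contDiffOn.continuousOn.comp (by fun_prop : ContinuousOn (fun x : Space => (x, t)) Ω)
    fun _ hx => ⟨hx, ht⟩).aestronglyMeasurable hΩ.measurableSet

theorem IsSobolev.hasDerivAt_slice (hu : IsSobolev (cylinder Ω T) W u) (hΩ : IsOpen Ω)
    {x : Space} (hx : x ∈ Ω) {t : ℝ} (ht : t ∈ Ioo 0 T) :
    HasDerivAt (fun s => u (x, s)) (fderiv ℝ u (x, t) (0, 1)) t :=
  (hu.hasFDerivAt (isOpen_cylinder hΩ T) (p := (x, t)) ⟨hx, ht⟩).comp_hasDerivAt t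
    (hasDerivAt_mk_right x t)

theorem IsSobolev.exists_hasTimeTraces (hu : IsSobolev (cylinder Ω T) W u)
    (hW : ((0, 1) : SpaceTime) ∈ W) (hΩ : IsOpen Ω) (hb : Bornology.IsBounded Ω) (hT : 0 < T) :
    ∃ g₀ g₁, HasTimeTraces Ω T u g₀ g₁ := by
  have hprod : (volume.restrict Ω).prod (volume.restrict (Ioo 0 T)) =
      (volume : Measure SpaceTime).restrict (cylinder Ω T) := by
    rw [cylinder, Measure.volume_eq_prod, ← Measure.prod_restrict]
  have hfin : IsFiniteMeasure (volume.restrict Ω) := ⟨by simpa using hb.measure_lt_top⟩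
  have hQ := volume_cylinder_lt_top hb T
  have hrefl := measurePreserving_reflect_cylinder Ω T
  have hmem : ∀ {s}, s ∈ Ioo 0 T → T - s ∈ Ioo 0 T := fun hs =>
    ⟨by linarith [hs.2], by linarith [hs.1]⟩
  obtain ⟨g₀, h0m, h0t, h0⟩ := exists_trace (μ := volume.restrict Ω) hT
    (U := fun x s => u (x, s)) (D := fun x s => fderiv ℝ u (x, s) (0, 1))
    (fun s hs => hu.aestronglyMeasurable_slice hΩ hs)
    ((ae_restrict_mem hΩ.measurableSet).mono fun x hx s hs => hu.hasDerivAt_slice hΩ hx hs)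
    (by rw [hprod]; exact hu.memLp) (by rw [hprod]; exact hu.memLp_fderiv _ hW)
  obtain ⟨g₁, h1m, h1t, h1⟩ := exists_trace (μ := volume.restrict Ω) hT
    (U := fun x s => u (x, T - s)) (D := fun x s => -fderiv ℝ u (x, T - s) (0, 1))
    (fun s hs => hu.aestronglyMeasurable_slice hΩ (hmem hs))
    ((ae_restrict_mem hΩ.measurableSet).mono fun x hx s hs =>
      (hu.hasDerivAt_slice hΩ hx (hmem hs)).comp_const_sub T s)
    (by rw [hprod]; exact hu.memLp.comp_measurePreserving hrefl)
    (by rw [hprod]; exact ((hu.memLp_fderiv _ hW).comp_measurePreserving hrefl).neg)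
  refine ⟨g₀, g₁, h0m, h1m, h0t, ?_, fun φ hφ hc => ?_⟩
  · refine (h1t.comp (tendsto_sub_left_nhdsLT T)).congr fun t => ?_
    simp only [Function.comp_apply, sub_sub_cancel]
  have hi := hu.integrableOn_mulDeriv hQ hW hφ hc
  have hgi : ∀ {g : Space → ℝ} (_ : MemLp g 2 (volume.restrict Ω)) (t : ℝ),
      Integrable (fun x => g x * φ (x, t)) (volume.restrict Ω) := fun hg t =>
    integrable_mul_of_compactSupport_real (ι := fun x : Space => ((x, t) : SpaceTime))
      (hg.integrable one_le_two)
      (by fun_prop) hφ.continuous hc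
  rw [IntegrableOn, ← hprod] at hi
  rw [← hprod, integral_prod _ hi, ← integral_sub (hgi h1m T) (hgi h0m 0)]
  refine integral_congr_ae ?_
  filter_upwards [h0, h1, hi.prod_right_ae, ae_restrict_mem hΩ.measurableSet]
    with x hx0 hx1 hxi hx
  have hφc : ∀ a : ℝ, Tendsto (fun s => φ (x, s)) (𝓝 a) (𝓝 (φ (x, a))) := fun a =>
    (hφ.continuous.comp (by fun_prop : Continuous fun s : ℝ => ((x, s) : SpaceTime))).tendsto a
  have key := intervalIntegral.integral_eq_sub_of_hasDerivAt_of_tendsto (a := 0) (b := T)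
    (f := fun s => u (x, s) * φ (x, s)) (f' := fun s => mulDeriv u φ (x, s) (0, 1)) hT
    (fun s hs => (hu.hasFDerivAt_mul (isOpen_cylinder hΩ T) (hφ.differentiable one_ne_zero)
      (p := (x, s)) ⟨hx, hs⟩).comp_hasDerivAt s (hasDerivAt_mk_right x s))
    ((intervalIntegrable_iff_integrableOn_Ioo_of_le hT.le).2 hxi)
    (hx0.2.mul ((hφc 0).mono_left nhdsWithin_le_nhds))
    (((hx1.2.comp (tendsto_sub_left_nhdsLT T)).congr fun t => by
      simp only [Function.comp_apply, sub_sub_cancel]).mul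
        ((hφc T).mono_left nhdsWithin_le_nhds))
  rwa [intervalIntegral.integral_of_le hT.le, integral_Ioc_eq_integral_Ioo] at key

theorem HasTimeTraces.ae_eq {g₀ g₁ a₀ a₁ : Space → ℝ} (h : HasTimeTraces Ω T u g₀ g₁)
    (hu : IsSobolev (cylinder Ω T) W u) (hΩ : IsOpen Ω) (hT : 0 < T)
    (h0 : AEStronglyMeasurable a₀ (volume.restrict Ω))
    (h1 : AEStronglyMeasurable a₁ (volume.restrict Ω))
    (ht0 : Tendsto (fun t : ℝ => eLpNorm (fun x => u (x, t) - a₀ x) 2 (volume.restrict Ω))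
      (𝓝[>] 0) (𝓝 0))
    (ht1 : Tendsto (fun t : ℝ => eLpNorm (fun x => u (x, t) - a₁ x) 2 (volume.restrict Ω))
      (𝓝[<] T) (𝓝 0)) :
    g₀ =ᵐ[volume.restrict Ω] a₀ ∧ g₁ =ᵐ[volume.restrict Ω] a₁ :=
  ⟨ae_eq_of_tendsto_eLpNorm_sub (mem_of_superset (Ioo_mem_nhdsGT hT) fun _ ht =>
      hu.aestronglyMeasurable_slice hΩ ht) h.memLp_initial.1 h0 h.initial ht0,
    ae_eq_of_tendsto_eLpNorm_sub (mem_of_superset (Ioo_mem_nhdsLT hT) fun _ ht =>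
      hu.aestronglyMeasurable_slice hΩ ht) h.memLp_terminal.1 h1 h.terminal ht1⟩

end Time

end FirstOrderSystem

namespace FirstOrderSystem
open scoped ContDiff

/-! ### Continuous functions with continuous weak derivatives -/

section Regularity

open scoped Convolution

variable {E : Type*} [NormedAddCommGroup E] [NormedSpace ℝ E] [FiniteDimensional ℝ E]
  [MeasurableSpace E] [BorelSpace E] {μ : Measure E} [μ.IsAddHaarMeasure]

theorem hasFDerivAt_convolution_of_weak {Q K : Set E} {u : E → ℝ} {L : E → E →L[ℝ] ℝ}
    (hKQ : K ⊆ Q) (hK : IsCompact K) (hQ : MeasurableSet Q) (hu : ContinuousOn u K)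
    (hL : ContinuousOn L K)
    (hw : ∀ e : E, ∀ φ : E → ℝ, ContDiff ℝ ∞ φ → HasCompactSupport φ → tsupport φ ⊆ Q →
      (∫ q in Q, L q e * φ q ∂μ) + ∫ q in Q, u q * fderiv ℝ φ q e ∂μ = 0)
    (ρ : ContDiffBump (0 : E)) {p : E} (hp : Metric.closedBall p ρ.rOut ⊆ K) :
    HasFDerivAt (ρ.normed μ ⋆[ContinuousLinearMap.lsmul ℝ ℝ, μ] K.indicator u)
      ((ρ.normed μ ⋆[ContinuousLinearMap.lsmul ℝ ℝ, μ] K.indicator L) p) p := by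
  have hui : LocallyIntegrable (K.indicator u) μ :=
    ((integrable_indicator_iff hK.measurableSet).2 (hu.integrableOn_compact hK)).locallyIntegrable
  have hLi : LocallyIntegrable (K.indicator L) μ :=
    ((integrable_indicator_iff hK.measurableSet).2 (hL.integrableOn_compact hK)).locallyIntegrable
  have hρc : HasCompactSupport (ρ.normed μ) := ρ.hasCompactSupport_normed
  have hρs : ContDiff ℝ ∞ (ρ.normed μ) := ρ.contDiff_normed
  have hρ1 : ContDiff ℝ 1 (ρ.normed μ) := ρ.contDiff_normed
  have h1 := hρc.hasFDerivAt_convolution_left (ContinuousLinearMap.lsmul ℝ ℝ) hρ1 hui p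
  convert! h1 using 1
  have i1 := ((hρc.convolutionExists_left (ContinuousLinearMap.lsmul ℝ ℝ) hρs.continuous
    hLi p).integrable_swap)
  have i2 := (((hρc.fderiv ℝ).convolutionExists_left
    ((ContinuousLinearMap.lsmul ℝ ℝ).precompL E) (hρ1.continuous_fderiv one_ne_zero)
    hui p).integrable_swap)
  ext e
  rw [convolution_eq_swap, convolution_eq_swap, ContinuousLinearMap.integral_apply i1,
    ContinuousLinearMap.integral_apply i2]
  set χ : E → ℝ := fun q => ρ.normed μ (p - q) with hχ
  have hχs : ContDiff ℝ ∞ χ := hρs.comp (contDiff_const.sub contDiff_id)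
  have hzero : ∀ q ∉ K, q ∉ tsupport χ := by
    intro q hq hq'
    have hsub : tsupport χ ⊆ Metric.closedBall p ρ.rOut := by
      refine closure_minimal (fun r hr => ?_) Metric.isClosed_closedBall
      have : p - r ∈ Function.support (ρ.normed μ) := hr
      rw [ρ.support_normed_eq, mem_ball_zero_iff, ← dist_eq_norm, dist_comm] at this
      exact this.le
    exact hq (hp (hsub hq'))
  have hχc : HasCompactSupport χ := by
    refine HasCompactSupport.of_support_subset_isCompact hK fun q hq => ?_
    by_contra h
    exact hzero q h (subset_tsupport _ hq)
  have hd : ∀ q, fderiv ℝ χ q e = -fderiv ℝ (ρ.normed μ) (p - q) e := fun q => by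
    have h2 : HasFDerivAt χ _ q := ((hρ1.differentiable one_ne_zero (p - q)).hasFDerivAt).comp q
      ((hasFDerivAt_id q).const_sub p)
    rw [h2.fderiv]
    simp
  have key := hw e χ hχs hχc fun q hq => hKQ (by by_contra h; exact hzero q h hq)
  have e1 : ∫ q in Q, L q e * χ q ∂μ =
      ∫ q, ((ContinuousLinearMap.lsmul ℝ ℝ (ρ.normed μ (p - q))) (K.indicator L q)) e ∂μ := by
    rw [← integral_indicator hQ]
    refine integral_congr_ae (Eventually.of_forall fun q => ?_)
    by_cases hq : q ∈ K
    · simp [hq, hKQ hq, hχ, mul_comm]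
    · have : χ q = 0 := image_eq_zero_of_notMem_tsupport (hzero q hq)
      simp [indicator, hq, this]
  have e2 : ∫ q in Q, u q * fderiv ℝ χ q e ∂μ =
      -∫ q, (((ContinuousLinearMap.lsmul ℝ ℝ).precompL E) (fderiv ℝ (ρ.normed μ) (p - q))
        (K.indicator u q)) e ∂μ := by
    rw [← integral_indicator hQ, ← integral_neg]
    refine integral_congr_ae (Eventually.of_forall fun q => ?_)
    by_cases hq : q ∈ K
    · simp [hq, hKQ hq, hd, mul_comm]
    · have : fderiv ℝ χ q = 0 := fderiv_of_notMem_tsupport ℝ (hzero q hq)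
      simp [indicator, hq, this]
  rw [e1, e2] at key
  exact add_neg_eq_zero.1 key

theorem tendstoUniformlyOn_normed_convolution {F : Type*} [NormedAddCommGroup F]
    [NormedSpace ℝ F] [CompleteSpace F] {g : E → F} {K S : Set E} (hK : IsCompact K)
    (hg : ContinuousOn g K) {ρ : ℕ → ContDiffBump (0 : E)}
    (hρ0 : Tendsto (fun n => (ρ n).rOut) atTop (𝓝 0))
    (hS : ∀ n, ∀ p ∈ S, Metric.closedBall p (ρ n).rOut ⊆ K) :
    TendstoUniformlyOn (fun n =>
      ((ρ n).normed μ ⋆[ContinuousLinearMap.lsmul ℝ ℝ, μ] K.indicator g)) g atTop S := by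
  have hmeas : AEStronglyMeasurable (K.indicator g) μ :=
    (aestronglyMeasurable_indicator_iff hK.measurableSet).2
      (hg.aestronglyMeasurable hK.measurableSet)
  rw [Metric.tendstoUniformlyOn_iff]
  intro ε hε
  obtain ⟨δ, hδ, hδε⟩ := Metric.uniformContinuousOn_iff.1
    (hK.uniformContinuousOn_of_continuous hg) (ε / 2) (by positivity)
  filter_upwards [hρ0.eventually_lt_const hδ] with n hn p hp
  have hpK : p ∈ K := hS n p hp (Metric.mem_closedBall_self (ρ n).rOut_pos.le)
  have := (ρ n).dist_normed_convolution_le (μ := μ) (x₀ := p) (ε := ε / 2) hmeas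
    fun x hx => by
      have hxK : x ∈ K := hS n p hp (Metric.ball_subset_closedBall hx)
      rw [indicator_of_mem hxK, indicator_of_mem hpK]
      exact (hδε x hxK p hpK ((Metric.mem_ball.1 hx).trans hn)).le
  rw [indicator_of_mem hpK] at this
  rw [dist_comm]
  linarith

/-- A continuous function with continuous weak derivative is differentiable. -/
theorem hasFDerivAt_of_weak {Q : Set E} {u : E → ℝ} {L : E → E →L[ℝ] ℝ} (hQ : IsOpen Q)
    (hu : ContinuousOn u Q) (hL : ContinuousOn L Q)
    (hw : ∀ e : E, ∀ φ : E → ℝ, ContDiff ℝ ∞ φ → HasCompactSupport φ → tsupport φ ⊆ Q →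
      (∫ q in Q, L q e * φ q ∂μ) + ∫ q in Q, u q * fderiv ℝ φ q e ∂μ = 0) {p₀ : E}
    (hp₀ : p₀ ∈ Q) : HasFDerivAt u (L p₀) p₀ := by
  obtain ⟨R, hR, hRQ⟩ := Metric.nhds_basis_closedBall.mem_iff.1 (hQ.mem_nhds hp₀)
  set K := Metric.closedBall p₀ R with hKdef
  have hK : IsCompact K := isCompact_closedBall p₀ R
  let ρ : ℕ → ContDiffBump (0 : E) := fun n =>
    ⟨R / 4 / (n + 1), R / 2 / (n + 1), by positivity, by gcongr; linarith⟩
  have hρ0 : Tendsto (fun n => (ρ n).rOut) atTop (𝓝 0) :=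
    tendsto_const_div_atTop_nhds_zero_nat (R / 2) |>.comp (tendsto_add_atTop_nat 1) |>.congr
      fun n => by simp [ρ]
  have hρR : ∀ n, (ρ n).rOut ≤ R / 2 := fun n => by
    refine div_le_self (by positivity) ?_
    have : (0 : ℝ) ≤ n := n.cast_nonneg
    linarith
  have hball : ∀ n, ∀ p ∈ Metric.ball p₀ (R / 2), Metric.closedBall p (ρ n).rOut ⊆ K := by
    intro n p hp q hq
    rw [Metric.mem_ball] at hp
    rw [Metric.mem_closedBall] at hq ⊢
    linarith [dist_triangle q p p₀, hρR n]
  refine hasFDerivAt_of_tendstoUniformlyOn (l := atTop) Metric.isOpen_ball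
    (tendstoUniformlyOn_normed_convolution hK (hL.mono hRQ) hρ0 hball)
    (fun n p hp => hasFDerivAt_convolution_of_weak hRQ hK hQ.measurableSet (hu.mono hRQ)
      (hL.mono hRQ) hw (ρ n) (hball n p hp))
    (fun p hp =>
      (tendstoUniformlyOn_normed_convolution hK (hu.mono hRQ) hρ0 hball).tendsto_at hp)
    (Metric.mem_ball_self (by positivity))

end Regularity

end FirstOrderSystem

namespace FirstOrderSystem
open scoped ContDiff

/-! ### Identification of traces by the divergence theorem -/

section Identification

variable {Ω : Set Space} {T : ℝ} {W : Set SpaceTime} {u : SpaceTime → ℝ}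

theorem eq_zero_of_forall_mul_inner_single {c : ℝ} {n : Space} (hn : n ≠ 0)
    (h : ∀ k : Fin 3, c * inner ℝ n (EuclideanSpace.single k 1) = 0) : c = 0 := by
  by_contra hc
  refine hn ?_
  ext k
  simpa [hc, EuclideanSpace.inner_single_right] using h k

theorem HasPiecewiseSmoothBoundary.ae_outwardNormal_ne_zero (h : HasPiecewiseSmoothBoundary Ω)
    (T : ℝ) (V : Set Space) : ∀ᵐ p ∂(lateralPart Ω T V), outwardNormal Ω p.1 ≠ 0 := by
  obtain ⟨S, hSf, hSc, hS1, hreg⟩ := h.regular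
  have h0 := euclideanHausdorffMeasure_two_eq_zero hS1
  have h1 : ∀ᵐ x ∂((μHE[2] : Measure Space).restrict (frontier Ω ∩ V)),
      outwardNormal Ω x ≠ 0 := by
    refine ae_restrict_of_ae_restrict_of_subset inter_subset_left ?_
    rw [ae_restrict_iff' isClosed_frontier.measurableSet]
    filter_upwards [compl_mem_ae_iff.2 h0] with x hxS hx
    obtain ⟨ρ, hρ⟩ := hreg x ⟨hx, hxS⟩
    have hn : IsOutwardNormal Ω x (‖gradient ρ x‖⁻¹ • gradient ρ x) := ⟨ρ, hρ, rfl⟩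
    rw [hn.outwardNormal_eq, ← norm_ne_zero_iff, hn.norm_eq_one]
    exact one_ne_zero
  exact Measure.quasiMeasurePreserving_fst.ae h1

theorem lateralPart_le (h : HasPiecewiseSmoothBoundary Ω) {V : Set Space} (hV : MeasurableSet V) :
    lateralPart Ω T V ≤ lateralMeasure Ω T := by
  rw [← lateralMeasure_restrict Ω T h hV]
  exact Measure.restrict_le_self

theorem HasTrace.ae_eq_of_weak {V : Set Space} {ν : Space} {G A : SpaceTime → ℝ}
    (hG : HasTrace Ω T u V ν G) (h : HasPiecewiseSmoothBoundary Ω) (hΩ : IsOpen Ω)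
    (hb : Bornology.IsBounded Ω) (hV : IsOpen V) (hA : MemLp A 2 (lateralMeasure Ω T))
    (hw : ∀ (k : Fin 3) (φ : SpaceTime → ℝ), ContDiff ℝ ∞ φ → HasCompactSupport φ →
      ∫ p in cylinder Ω T, mulDeriv u φ p (EuclideanSpace.single k 1, 0) =
        ∫ p, A p * φ p * inner ℝ (outwardNormal Ω p.1) (EuclideanSpace.single k 1)
          ∂(lateralMeasure Ω T)) : G =ᵐ[lateralPart Ω T V] A := by
  have hfin := h.isFiniteMeasure T
  have hle := lateralPart_le (T := T) h hV.measurableSet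
  have hfin' : IsFiniteMeasure (lateralPart Ω T V) := isFiniteMeasure_of_le _ hle
  have hres := lateralMeasure_restrict Ω T h hV.measurableSet
  have hUm : MeasurableSet (V ×ˢ (univ : Set ℝ)) := hV.measurableSet.prod MeasurableSet.univ
  have hbdd : ∀ {g : SpaceTime → ℝ} (_ : Integrable g (lateralPart Ω T V)) (e : Space),
      Integrable (fun p => g p * inner ℝ (outwardNormal Ω p.1) e) (lateralPart Ω T V) := by
    intro g hg e
    refine hg.mul_bdd (c := ‖e‖) ?_ (Eventually.of_forall fun p => ?_)
    · have h1 := (h.aestronglyMeasurable_outwardNormal hΩ hb).inner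
        (aestronglyMeasurable_const (b := e)) (𝕜 := ℝ)
      exact (h1.comp_quasiMeasurePreserving Measure.quasiMeasurePreserving_fst).mono_measure hle
    · refine (norm_inner_le_norm _ _).trans ?_
      exact mul_le_of_le_one_left (norm_nonneg _) (norm_outwardNormal_le Ω p.1)
  have hGi := hG.memLp.integrable one_le_two
  have hAi : Integrable A (lateralPart Ω T V) := (hA.integrable one_le_two).mono_measure hle
  have hcomp : ∀ k : Fin 3, ∀ᵐ p ∂(lateralPart Ω T V),
      (G p - A p) * inner ℝ (outwardNormal Ω p.1) (EuclideanSpace.single k 1) = 0 := by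
    intro k
    set e : Space := EuclideanSpace.single k 1
    have hF := hbdd (hGi.sub hAi) e
    have h1 := (hV.prod isOpen_univ).ae_eq_zero_of_integral_contDiff_smul_eq_zero
      (hF.locallyIntegrable.locallyIntegrableOn (V ×ˢ (univ : Set ℝ))) fun φ hφ hc hs => by
        have hg := (hG.gauss φ (hφ.of_le (by exact_mod_cast le_top)) hc hs e).symm.trans
          (hw k φ hφ hc)
        have h2 : ∫ p, A p * φ p * inner ℝ (outwardNormal Ω p.1) e ∂(lateralMeasure Ω T) =
            ∫ p, A p * φ p * inner ℝ (outwardNormal Ω p.1) e ∂(lateralPart Ω T V) := by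
          rw [← hres]
          refine (setIntegral_eq_integral_of_forall_compl_eq_zero fun p hp => ?_).symm
          rw [image_eq_zero_of_notMem_tsupport fun h => hp (hs h)]
          simp
        rw [h2] at hg
        have hint : ∀ {g : SpaceTime → ℝ} (_ : Integrable g (lateralPart Ω T V)),
            Integrable (fun p => g p * φ p * inner ℝ (outwardNormal Ω p.1) e)
              (lateralPart Ω T V) := fun hg =>
          hbdd (integrable_mul_of_compactSupport_real hg measurable_id hφ.continuous hc) e
        rw [← sub_eq_zero, ← integral_sub (hint hGi) (hint hAi)] at hg
        rw [← hg]
        refine integral_congr_ae (Eventually.of_forall fun p => ?_)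
        simp only [smul_eq_mul, Pi.sub_apply]
        ring
    rw [← hres] at h1 ⊢
    filter_upwards [h1, ae_restrict_mem hUm] with p hp hpU
    exact hp hpU
  filter_upwards [ae_all_iff.2 hcomp, h.ae_outwardNormal_ne_zero T V] with p hp hn
  exact sub_eq_zero.1 (eq_zero_of_forall_mul_inner_single hn hp)

theorem ae_eq_of_forall_integral_mul {g a : Space → ℝ} (hg : Integrable g (volume.restrict Ω))
    (ha : Integrable a (volume.restrict Ω))
    (h : ∀ η : Space → ℝ, ContDiff ℝ ∞ η → HasCompactSupport η →
      ∫ x in Ω, g x * η x = ∫ x in Ω, a x * η x) : g =ᵐ[volume.restrict Ω] a :=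
  ae_eq_of_integral_contDiff_smul_eq hg.locallyIntegrable ha.locallyIntegrable
    fun η hη hc => by simpa only [smul_eq_mul, mul_comm] using h η hη hc

theorem exists_product_test {s t : ℝ} (hst : s ≠ t) {η : Space → ℝ}
    (hη : ContDiff ℝ ∞ η) (hc : HasCompactSupport η) :
    ∃ φ : SpaceTime → ℝ, ContDiff ℝ ∞ φ ∧ HasCompactSupport φ ∧ (∀ x, φ (x, t) = η x) ∧
      ∀ x, φ (x, s) = 0 := by
  have hd : 0 < dist s t := dist_pos.2 hst
  let b : ContDiffBump t := ⟨dist s t / 2, dist s t, by positivity, by linarith⟩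
  refine ⟨fun p => η p.1 * b p.2, (hη.comp contDiff_fst).mul (b.contDiff.comp contDiff_snd), ?_,
    fun x => ?_, fun x => ?_⟩
  · refine HasCompactSupport.of_support_subset_isCompact
      (hc.isCompact.prod b.hasCompactSupport.isCompact) fun p hp => ?_
    have := mul_ne_zero_iff.1 hp
    exact ⟨subset_tsupport _ this.1, subset_tsupport _ this.2⟩
  · simp only [b.one_of_mem_closedBall (Metric.mem_closedBall_self b.rIn_pos.le), mul_one]
  · simp only [b.zero_of_le_dist (x := s) le_rfl, mul_zero]

theorem HasTimeTraces.ae_eq_of_weak {g₀ g₁ a₀ a₁ : Space → ℝ} (h : HasTimeTraces Ω T u g₀ g₁)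
    (hb : Bornology.IsBounded Ω) (hT : 0 < T) (h0 : Integrable a₀ (volume.restrict Ω))
    (h1 : Integrable a₁ (volume.restrict Ω))
    (hw : ∀ φ : SpaceTime → ℝ, ContDiff ℝ ∞ φ → HasCompactSupport φ →
      ∫ p in cylinder Ω T, mulDeriv u φ p (0, 1) =
        (∫ x in Ω, a₁ x * φ (x, T)) - ∫ x in Ω, a₀ x * φ (x, 0)) :
    g₀ =ᵐ[volume.restrict Ω] a₀ ∧ g₁ =ᵐ[volume.restrict Ω] a₁ := by
  have hfin : IsFiniteMeasure (volume.restrict Ω) := ⟨by simpa using hb.measure_lt_top⟩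
  have key : ∀ φ : SpaceTime → ℝ, ContDiff ℝ ∞ φ → HasCompactSupport φ →
      (∫ x in Ω, g₁ x * φ (x, T)) - ∫ x in Ω, g₀ x * φ (x, 0) =
        (∫ x in Ω, a₁ x * φ (x, T)) - ∫ x in Ω, a₀ x * φ (x, 0) := fun φ hφ hc =>
    (h.integral_mulDeriv φ (hφ.of_le (by exact_mod_cast le_top)) hc).symm.trans (hw φ hφ hc)
  refine ⟨ae_eq_of_forall_integral_mul (h.memLp_initial.integrable one_le_two) h0
    fun η hη hc => ?_, ae_eq_of_forall_integral_mul (h.memLp_terminal.integrable one_le_two) h1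
    fun η hη hc => ?_⟩
  · obtain ⟨φ, hφ, hφc, hφ1, hφ0⟩ := exists_product_test hT.ne' hη hc
    simpa [hφ1, hφ0] using key φ hφ hφc
  · obtain ⟨φ, hφ, hφc, hφ1, hφ0⟩ := exists_product_test hT.ne hη hc
    simpa [hφ1, hφ0] using key φ hφ hφc

end Identification

end FirstOrderSystem

namespace FirstOrderSystem
open scoped ContDiff

/-! ### One component: classical derivatives and traces versus weak identities -/

/-- The linear form with partial derivatives `v` in space and `r` in time. -/
noncomputable def gradientMap (v : Fin 3 → ℝ) (r : ℝ) : SpaceTime →L[ℝ] ℝ :=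
  (∑ k, v k • (EuclideanSpace.proj k).comp (ContinuousLinearMap.fst ℝ Space ℝ)) +
    r • ContinuousLinearMap.snd ℝ Space ℝ

theorem gradientMap_apply (v : Fin 3 → ℝ) (r : ℝ) (e : SpaceTime) :
    gradientMap v r e = (∑ k, v k * e.1 k) + r * e.2 := by
  simp [gradientMap]

@[simp] theorem gradientMap_single (v : Fin 3 → ℝ) (r : ℝ) (k : Fin 3) :
    gradientMap v r (EuclideanSpace.single k 1, 0) = v k := by
  simp [gradientMap_apply]

@[simp] theorem gradientMap_time (v : Fin 3 → ℝ) (r : ℝ) : gradientMap v r (0, 1) = r := by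
  simp [gradientMap_apply]

theorem eq_gradientMap (M : SpaceTime →L[ℝ] ℝ) :
    M = gradientMap (fun k => M (EuclideanSpace.single k 1, 0)) (M (0, 1)) := by
  refine ContinuousLinearMap.ext fun e => ?_
  have he : e = (∑ k, e.1 k • ((EuclideanSpace.single k 1, 0) : SpaceTime)) +
      e.2 • ((0, 1) : SpaceTime) := by
    refine Prod.ext ?_ ?_
    · ext j
      fin_cases j <;> simp [Fin.sum_univ_three]
    · simp [Fin.sum_univ_three]
  rw [gradientMap_apply]
  conv_lhs => rw [he]
  simp only [map_add, map_sum, map_smul, smul_eq_mul, mul_comm]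

theorem continuousOn_gradientMap {Q : Set SpaceTime} {v : Fin 3 → SpaceTime → ℝ}
    {r : SpaceTime → ℝ} (hv : ∀ k, ContinuousOn (v k) Q) (hr : ContinuousOn r Q) :
    ContinuousOn (fun p => gradientMap (fun k => v k p) (r p)) Q := by
  unfold gradientMap
  exact (continuousOn_finsetSum _ fun k _ => (hv k).smul continuousOn_const).add
    (hr.smul continuousOn_const)

theorem integrable_sum_smul_add {X F : Type*} [MeasurableSpace X] [NormedAddCommGroup F]
    [NormedSpace ℝ F] {μ : Measure X} {v : Fin 3 → X → ℝ} {r : X → ℝ}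
    (hv : ∀ k, Integrable (v k) μ) (hr : Integrable r μ) (c : Fin 3 → F) (d : F) :
    Integrable (fun p => (∑ k, v k p • c k) + r p • d) μ :=
  (integrable_finsetSum _ fun k _ => (hv k).smul_const (c k)).add (hr.smul_const d)

theorem integrable_gradientMap {X : Type*} [MeasurableSpace X] {μ : Measure X} {v : Fin 3 → X → ℝ}
    {r : X → ℝ} (hv : ∀ k, Integrable (v k) μ) (hr : Integrable r μ) :
    Integrable (fun p => gradientMap (fun k => v k p) (r p)) μ :=
  integrable_sum_smul_add hv hr (fun k =>
    (EuclideanSpace.proj k : Space →L[ℝ] ℝ).comp (ContinuousLinearMap.fst ℝ Space ℝ))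
    (ContinuousLinearMap.snd ℝ Space ℝ)

theorem isSobolev_of_hasFDerivAt {Q : Set SpaceTime} (hQ : IsOpen Q) {u r : SpaceTime → ℝ}
    {v : Fin 3 → SpaceTime → ℝ}
    (hd : ∀ p ∈ Q, HasFDerivAt u (gradientMap (fun k => v k p) (r p)) p)
    (hvc : ∀ k, ContinuousOn (v k) Q) (hrc : ContinuousOn r Q)
    (hu : MemLp u 2 (volume.restrict Q)) (hv : ∀ k, MemLp (v k) 2 (volume.restrict Q))
    (hr : MemLp r 2 (volume.restrict Q)) : IsSobolev Q univ u := by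
  refine ⟨?_, hu, fun e _ => ?_⟩
  · rw [show (1 : ℕ∞ω) = 0 + 1 from rfl, contDiffOn_succ_iff_fderiv_of_isOpen hQ, contDiffOn_zero]
    exact ⟨fun p hp => (hd p hp).differentiableAt.differentiableWithinAt, by simp,
      (continuousOn_gradientMap hvc hrc).congr fun p hp => (hd p hp).fderiv⟩
  · have h1 : MemLp (fun p => gradientMap (fun k => v k p) (r p) e) 2 (volume.restrict Q) := by
      simp only [gradientMap_apply]
      exact (memLp_finsetSum _ fun k _ => (hv k).mul_const _).add (hr.mul_const _)
    refine h1.ae_eq ?_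
    filter_upwards [ae_restrict_mem hQ.measurableSet] with p hp
    rw [(hd p hp).fderiv]

theorem IsSobolev.mono {Q W W' : Set SpaceTime} {u : SpaceTime → ℝ} (h : IsSobolev Q W u)
    (hW : W' ⊆ W) : IsSobolev Q W' u :=
  ⟨h.contDiffOn, h.memLp, fun e he => h.memLp_fderiv e (hW he)⟩

theorem IsSobolev.weakIdentity_iff {Q W : Set SpaceTime} {u v : SpaceTime → ℝ} {e : SpaceTime}
    {b : (SpaceTime → ℝ) → ℝ} (h : IsSobolev Q W u) (hQ : IsOpen Q) (hQ' : volume Q < ⊤)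
    (he : e ∈ W) (hv : ∀ p ∈ Q, fderiv ℝ u p e = v p) :
    WeakIdentity Q e u v b ↔ ∀ φ : SpaceTime → ℝ, ContDiff ℝ ∞ φ → HasCompactSupport φ →
      ∫ p in Q, mulDeriv u φ p e = b φ := by
  refine forall_congr' fun φ => forall_congr' fun hφ => forall_congr' fun hc => ?_
  have h1 : ∫ p in Q, fderiv ℝ u p e * φ p = ∫ p in Q, v p * φ p :=
    setIntegral_congr_fun hQ.measurableSet fun p hp => by simp only [hv p hp]
  rw [← h.integral_mulDeriv hQ' he (hφ.of_le (by exact_mod_cast le_top)) hc, h1]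

/-- The boundary term in time of the divergence theorem. -/
noncomputable def timeBoundary (Ω : Set Space) (T : ℝ) (a₀ a₁ : Space → ℝ) (φ : SpaceTime → ℝ) :
    ℝ :=
  (∫ x in Ω, a₁ x * φ (x, T)) - ∫ x in Ω, a₀ x * φ (x, 0)

/-- The lateral boundary term of the divergence theorem. -/
noncomputable def lateralBoundary (Ω : Set Space) (T : ℝ) (a : SpaceTime → ℝ) (e : Space)
    (φ : SpaceTime → ℝ) : ℝ :=
  ∫ p, a p * φ p * inner ℝ (outwardNormal Ω p.1) e ∂(lateralMeasure Ω T)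

section Scalar

variable {Ω : Set Space} {T : ℝ} {u r : SpaceTime → ℝ} {v : Fin 3 → SpaceTime → ℝ}
  {a₀ a₁ : Space → ℝ} {a : SpaceTime → ℝ}

theorem weakIdentity_of_traces (h : HasPiecewiseSmoothBoundary Ω) (hΩ : IsOpen Ω)
    (hb : Bornology.IsBounded Ω) (hT : 0 < T) (hu : IsSobolev (cylinder Ω T) univ u)
    (hd : ∀ p ∈ cylinder Ω T, HasFDerivAt u (gradientMap (fun k => v k p) (r p)) p)
    (ha₀ : AEStronglyMeasurable a₀ (volume.restrict Ω))
    (ha₁ : AEStronglyMeasurable a₁ (volume.restrict Ω)) (ha : MemLp a 2 (lateralMeasure Ω T))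
    (ht0 : Tendsto (fun t : ℝ => eLpNorm (fun x => u (x, t) - a₀ x) 2 (volume.restrict Ω))
      (𝓝[>] 0) (𝓝 0))
    (ht1 : Tendsto (fun t : ℝ => eLpNorm (fun x => u (x, t) - a₁ x) 2 (volume.restrict Ω))
      (𝓝[<] T) (𝓝 0))
    (htr : ∀ x₀ ν : Space, IsOutwardNormal Ω x₀ ν → ∃ V ∈ 𝓝 x₀,
      Tendsto (fun s : ℝ => eLpNorm (fun p : SpaceTime => u (p.1 - s • ν, p.2) - a p) 2
        (lateralPart Ω T V)) (𝓝[>] 0) (𝓝 0)) :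
    WeakIdentity (cylinder Ω T) (0, 1) u r (timeBoundary Ω T a₀ a₁) ∧
      ∀ k, WeakIdentity (cylinder Ω T) (EuclideanSpace.single k 1, 0) u (v k)
        (lateralBoundary Ω T a (EuclideanSpace.single k 1)) := by
  have hQ := isOpen_cylinder hΩ T
  have hQ' := volume_cylinder_lt_top hb T
  refine ⟨(hu.weakIdentity_iff hQ hQ' (mem_univ _) fun p hp => by
      rw [(hd p hp).fderiv, gradientMap_time]).2 fun φ hφ hc => ?_,
    fun k => (hu.weakIdentity_iff hQ hQ' (mem_univ _) fun p hp => by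
      rw [(hd p hp).fderiv, gradientMap_single]).2 fun φ hφ hc =>
        integral_mulDeriv_eq h hΩ hb hT (hu.mono (subset_univ _)) ha htr hφ hc _⟩
  obtain ⟨g₀, g₁, hg⟩ := hu.exists_hasTimeTraces (mem_univ _) hΩ hb hT
  obtain ⟨e0, e1⟩ := hg.ae_eq hu hΩ hT ha₀ ha₁ ht0 ht1
  rw [hg.integral_mulDeriv φ (hφ.of_le (by exact_mod_cast le_top)) hc, timeBoundary]
  congr 1
  · exact integral_congr_ae (e1.mono fun x hx => by simp only [hx])
  · exact integral_congr_ae (e0.mono fun x hx => by simp only [hx])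

theorem timeBoundary_eq_zero {φ : SpaceTime → ℝ} (hs : tsupport φ ⊆ cylinder Ω T) :
    timeBoundary Ω T a₀ a₁ φ = 0 := by
  have h0 : ∀ x : Space, φ (x, 0) = 0 := fun x =>
    image_eq_zero_of_notMem_tsupport fun h => lt_irrefl _ (hs h).2.1
  have h1 : ∀ x : Space, φ (x, T) = 0 := fun x =>
    image_eq_zero_of_notMem_tsupport fun h => lt_irrefl _ (hs h).2.2
  simp [timeBoundary, h0, h1]

theorem ae_mem_frontier (Ω : Set Space) (T : ℝ) :
    ∀ᵐ p ∂(lateralMeasure Ω T), p.1 ∈ frontier Ω :=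
  Measure.quasiMeasurePreserving_fst.ae (ae_restrict_mem isClosed_frontier.measurableSet)

theorem lateralBoundary_eq_zero (hΩ : IsOpen Ω) {φ : SpaceTime → ℝ} (e : Space)
    (hs : tsupport φ ⊆ cylinder Ω T) : lateralBoundary Ω T a e φ = 0 := by
  refine integral_eq_zero_of_ae ?_
  filter_upwards [ae_mem_frontier Ω T] with p hp
  rw [hΩ.frontier_eq] at hp
  rw [image_eq_zero_of_notMem_tsupport fun h => hp.2 (hs h).1]
  simp

theorem hasFDerivAt_of_weakIdentity (hΩ : IsOpen Ω) (huc : ContinuousOn u (cylinder Ω T))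
    (hvc : ∀ k, ContinuousOn (v k) (cylinder Ω T)) (hrc : ContinuousOn r (cylinder Ω T))
    (hu : IntegrableOn u (cylinder Ω T)) (hv : ∀ k, IntegrableOn (v k) (cylinder Ω T))
    (hr : IntegrableOn r (cylinder Ω T))
    (hw : WeakIdentity (cylinder Ω T) (0, 1) u r (timeBoundary Ω T a₀ a₁))
    (hw' : ∀ k, WeakIdentity (cylinder Ω T) (EuclideanSpace.single k 1, 0) u (v k)
      (lateralBoundary Ω T a (EuclideanSpace.single k 1)))
    {p : SpaceTime} (hp : p ∈ cylinder Ω T) :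
    HasFDerivAt u (gradientMap (fun k => v k p) (r p)) p := by
  have hQ := isOpen_cylinder hΩ T
  refine hasFDerivAt_of_weak (μ := volume) (L := fun p => gradientMap (fun k => v k p) (r p))
    hQ huc (continuousOn_gradientMap hvc hrc) (fun e φ hφ hc hs => ?_) hp
  have hφ1 : ContDiff ℝ 1 φ := hφ.of_le (by exact_mod_cast le_top)
  have hL : IntegrableOn (fun p => φ p • gradientMap (fun k => v k p) (r p)) (cylinder Ω T) := by
    obtain ⟨c, hcb⟩ := hc.exists_bound_of_continuous hφ.continuous
    exact (integrable_gradientMap hv hr).bdd_smul c hφ.continuous.aestronglyMeasurable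
      (Eventually.of_forall hcb)
  have hU : IntegrableOn (fun p => u p • fderiv ℝ φ p) (cylinder Ω T) := by
    have hcd := hφ1.continuous_fderiv one_ne_zero
    obtain ⟨c, hcb⟩ := (hc.fderiv ℝ).exists_bound_of_continuous hcd
    exact hu.smul_bdd c hcd.aestronglyMeasurable (Eventually.of_forall hcb)
  have happ : ∀ e : SpaceTime,
      (∫ p in cylinder Ω T, gradientMap (fun k => v k p) (r p) e * φ p) +
        ∫ p in cylinder Ω T, u p * fderiv ℝ φ p e =
      ((∫ p in cylinder Ω T, φ p • gradientMap (fun k => v k p) (r p)) +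
        ∫ p in cylinder Ω T, u p • fderiv ℝ φ p) e := fun e => by
    rw [add_apply, ContinuousLinearMap.integral_apply hL, ContinuousLinearMap.integral_apply hU]
    simp only [smul_apply, smul_eq_mul, mul_comm]
  rw [happ, eq_gradientMap (_ + _)]
  have h0 := hw φ hφ hc
  have hk := fun k => hw' k φ hφ hc
  simp only [← happ, gradientMap_single, gradientMap_time, h0, hk, timeBoundary_eq_zero hs,
    lateralBoundary_eq_zero hΩ _ hs]
  simp [gradientMap_apply]

theorem traces_of_weakIdentity (h : HasPiecewiseSmoothBoundary Ω) (hΩ : IsOpen Ω)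
    (hb : Bornology.IsBounded Ω) (hT : 0 < T) (hu : IsSobolev (cylinder Ω T) univ u)
    (hd : ∀ p ∈ cylinder Ω T, HasFDerivAt u (gradientMap (fun k => v k p) (r p)) p)
    (ha₀ : Integrable a₀ (volume.restrict Ω))
    (ha₁ : Integrable a₁ (volume.restrict Ω)) (ha : MemLp a 2 (lateralMeasure Ω T))
    (hw : WeakIdentity (cylinder Ω T) (0, 1) u r (timeBoundary Ω T a₀ a₁))
    (hw' : ∀ k, WeakIdentity (cylinder Ω T) (EuclideanSpace.single k 1, 0) u (v k)
      (lateralBoundary Ω T a (EuclideanSpace.single k 1))) :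
    Tendsto (fun t : ℝ => eLpNorm (fun x => u (x, t) - a₀ x) 2 (volume.restrict Ω))
        (𝓝[>] 0) (𝓝 0) ∧
      Tendsto (fun t : ℝ => eLpNorm (fun x => u (x, t) - a₁ x) 2 (volume.restrict Ω))
        (𝓝[<] T) (𝓝 0) ∧
      ∀ x₀ ν : Space, IsOutwardNormal Ω x₀ ν → ∃ V ∈ 𝓝 x₀, MeasurableSet V ∧
        (∀ᶠ s : ℝ in 𝓝[>] 0, AEStronglyMeasurable (fun p : SpaceTime => u (p.1 - s • ν, p.2))
          (lateralPart Ω T V)) ∧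
        Tendsto (fun s : ℝ => eLpNorm (fun p : SpaceTime => u (p.1 - s • ν, p.2) - a p) 2
          (lateralPart Ω T V)) (𝓝[>] 0) (𝓝 0) := by
  have hQ := isOpen_cylinder hΩ T
  have hQ' := volume_cylinder_lt_top hb T
  rw [hu.weakIdentity_iff hQ hQ' (mem_univ _) fun p hp => by
    rw [(hd p hp).fderiv, gradientMap_time]] at hw
  replace hw' := fun k => (hu.weakIdentity_iff hQ hQ' (mem_univ _) fun p hp => by
    rw [(hd p hp).fderiv, gradientMap_single]).1 (hw' k)
  obtain ⟨g₀, g₁, hg⟩ := hu.exists_hasTimeTraces (mem_univ _) hΩ hb hT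
  obtain ⟨e0, e1⟩ := hg.ae_eq_of_weak hb hT ha₀ ha₁ hw
  refine ⟨hg.initial.congr fun t => eLpNorm_congr_ae (e0.mono fun x hx => by simp only [hx]),
    hg.terminal.congr fun t => eLpNorm_congr_ae (e1.mono fun x hx => by simp only [hx]),
    fun x₀ ν hν => ?_⟩
  obtain ⟨V, -, hV, hxV, -, hVt⟩ := hν.exists_hasTrace hΩ hb T univ_mem
  obtain ⟨G, hG⟩ := hVt u (hu.mono (subset_univ _))
  have hGa := hG.ae_eq_of_weak h hΩ hb hV ha hw'
  exact ⟨V, hV.mem_nhds hxV, hV.measurableSet, hG.aestronglyMeasurable,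
    hG.tendsto.congr fun s => eLpNorm_congr_ae (hGa.mono fun x hx => by simp only [hx])⟩

end Scalar

end FirstOrderSystem

namespace FirstOrderSystem
open scoped ContDiff

/-! ### The Fourier transform of the weak identities -/

theorem exists_closure_subset_ball {Ω : Set Space} (hb : Bornology.IsBounded Ω) (T : ℝ) :
    ∃ R : ℝ, closure Ω ×ˢ Icc 0 T ⊆ Metric.ball (0 : SpaceTime) R :=
  (hb.closure.prod (Metric.isBounded_Icc 0 T)).subset_ball 0

section Rows

variable {Ω : Set Space} {T : ℝ} {u r : SpaceTime → ℝ}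

theorem cylinder_subset_closure (Ω : Set Space) (T : ℝ) :
    cylinder Ω T ⊆ closure Ω ×ˢ Icc 0 T :=
  prod_mono subset_closure Ioo_subset_Icc_self

theorem weakIdentity_time_iff {m : ℕ} {A₁ A₂ : Space → Fin m → ℝ} (hΩ : IsOpen Ω)
    (hb : Bornology.IsBounded Ω) (hT : 0 < T) (hu : IntegrableOn u (cylinder Ω T))
    (hr : IntegrableOn r (cylinder Ω T)) (i : Fin m) (h₁ : IntegrableOn (fun x => A₁ x i) Ω)
    (h₂ : IntegrableOn (fun x => A₂ x i) Ω) :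
    WeakIdentity (cylinder Ω T) (0, 1) u r
        (timeBoundary Ω T (fun x => A₁ x i) fun x => A₂ x i) ↔
      ∀ᵐ ξ : SpaceTime, setTransform (cylinder Ω T) r ξ -
        Complex.I * ξ.2 * setTransform (cylinder Ω T) u ξ = f₀ Ω T A₁ A₂ ξ i := by
  obtain ⟨R, hR⟩ := exists_closure_subset_ball hb T
  have hmT : Measurable fun x : Space => ((x, T) : SpaceTime) := by fun_prop
  have hm0 : Measurable fun x : Space => ((x, 0) : SpaceTime) := by fun_prop
  have h₁' : Integrable (fun x => -A₁ x i) (volume.restrict Ω) := h₁.neg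
  have hx : ∀ t ∈ Icc 0 T, ∀ᵐ x ∂(volume.restrict Ω),
      ((x, t) : SpaceTime) ∈ Metric.closedBall 0 R := fun t ht =>
    (ae_restrict_mem hΩ.measurableSet).mono fun x hx =>
      Metric.ball_subset_closedBall (hR ⟨subset_closure hx, ht⟩)
  rw [weakIdentity_iff_ae (isOpen_cylinder hΩ T) hu hr h₂ h₁' hmT hm0
    ((cylinder_subset_closure Ω T).trans hR) (hx T (right_mem_Icc.2 hT.le))
    (hx 0 (left_mem_Icc.2 hT.le)) fun φ hφ hc => ?_]
  · refine eventually_congr (Eventually.of_forall fun ξ => ?_)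
    have e : f₀ Ω T A₁ A₂ ξ i = (∫ x in Ω, ((A₂ x i : ℝ) : ℂ) * wave (x, T) (-ξ)) +
        ∫ x in Ω, ((-A₁ x i : ℝ) : ℂ) * wave (x, 0) (-ξ) := by
      have i1 : Integrable (fun x => ((A₂ x i : ℝ) : ℂ) * wave (x, T) (-ξ)) (volume.restrict Ω) :=
        integrable_mul_wave (h₂.ofReal (𝕜 := ℂ)) hmT _
      have i2 : Integrable (fun x => ((-A₁ x i : ℝ) : ℂ) * wave (x, 0) (-ξ))
        (volume.restrict Ω) := integrable_mul_wave (h₁'.ofReal (𝕜 := ℂ)) hm0 _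
      rw [f₀, ← integral_add i1 i2]
      refine integral_congr_ae (Eventually.of_forall fun x => ?_)
      have hw : wave (x, T) (-ξ) = wave (0, T) (-ξ) * wave (x, 0) (-ξ) := by
        simp only [wave, ← Complex.exp_add]
        congr 1
        simp
        ring
      simp only [hw, Complex.ofReal_neg]
      ring
    rw [e]
    simp [phase_apply]
  · rw [timeBoundary, sub_eq_add_neg, ← integral_neg]
    simp

theorem weakIdentity_lateral_iff {m : ℕ} {A₃ : SpaceTime → Fin m → ℝ} (hΩ : IsOpen Ω)
    (hb : Bornology.IsBounded Ω) (h : HasPiecewiseSmoothBoundary Ω)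
    (hu : IntegrableOn u (cylinder Ω T)) (hr : IntegrableOn r (cylinder Ω T)) (i : Fin m)
    (k : Fin 3)
    (h₃ : Integrable (fun p => A₃ p i * outwardNormal Ω p.1 k) (lateralMeasure Ω T)) :
    WeakIdentity (cylinder Ω T) (EuclideanSpace.single k 1, 0) u r
        (lateralBoundary Ω T (fun p => A₃ p i) (EuclideanSpace.single k 1)) ↔
      ∀ᵐ ξ : SpaceTime, setTransform (cylinder Ω T) r ξ -
        iξ ξ.1 k * setTransform (cylinder Ω T) u ξ = fLateral Ω T A₃ k ξ i := by
  obtain ⟨R, hR⟩ := exists_closure_subset_ball hb T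
  have hfin := h.isFiniteMeasure T
  have h0 : Integrable (fun _ : SpaceTime => (0 : ℝ)) (lateralMeasure Ω T) := integrable_zero _ _ _
  have hmem : ∀ᵐ p ∂(lateralMeasure Ω T), id p ∈ Metric.closedBall (0 : SpaceTime) R := by
    have h2 : ∀ᵐ p ∂(lateralMeasure Ω T), p.2 ∈ Ioo 0 T :=
      Measure.quasiMeasurePreserving_snd.ae (ae_restrict_mem measurableSet_Ioo)
    filter_upwards [ae_mem_frontier Ω T, h2] with p hp hp2
    exact Metric.ball_subset_closedBall
      (hR ⟨frontier_subset_closure hp, Ioo_subset_Icc_self hp2⟩)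
  rw [weakIdentity_iff_ae (isOpen_cylinder hΩ T) hu hr h₃ h0 measurable_id
    measurable_id ((cylinder_subset_closure Ω T).trans hR) hmem hmem fun φ hφ hc => ?_]
  · refine eventually_congr (Eventually.of_forall fun ξ => ?_)
    simp [phase_apply, fLateral, iξ, EuclideanSpace.inner_single_left]
  · simp only [lateralBoundary, id, zero_mul, integral_zero, add_zero]
    refine integral_congr_ae (Eventually.of_forall fun p => ?_)
    simp [EuclideanSpace.inner_single_right]
    ring

end Rows

/-! ### Vector-valued convergence -/

section Components

variable {X : Type*} [MeasurableSpace X] {μ : Measure X} {m : ℕ}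

theorem eLpNorm_two_le_sum {F : X → Fin m → ℝ} (hF : ∀ i, AEStronglyMeasurable (fun x => F x i) μ) :
    eLpNorm F 2 μ ≤ ∑ i, eLpNorm (fun x => F x i) 2 μ := by
  have h1 : eLpNorm F 2 μ ≤ eLpNorm (∑ i, fun x => |F x i|) 2 μ := by
    refine eLpNorm_mono_real fun x => ?_
    rw [Finset.sum_apply]
    exact (pi_norm_le_iff_of_nonneg (Finset.sum_nonneg fun _ _ => abs_nonneg _)).2 fun i =>
      Finset.single_le_sum (f := fun i => |F x i|) (fun _ _ => abs_nonneg _) (Finset.mem_univ i)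
  refine h1.trans ((eLpNorm_sum_le (fun i _ => (hF i).norm) one_le_two).trans
    (Finset.sum_le_sum fun i _ => ?_))
  exact (eLpNorm_norm fun x => F x i).le

theorem tendsto_eLpNorm_component {l : Filter ℝ} {U : ℝ → X → Fin m → ℝ}
    (h : Tendsto (fun s => eLpNorm (U s) 2 μ) l (𝓝 0)) (i : Fin m) :
    Tendsto (fun s => eLpNorm (fun x => U s x i) 2 μ) l (𝓝 0) :=
  tendsto_of_tendsto_of_tendsto_of_le_of_le tendsto_const_nhds h (fun _ => zero_le)
    fun s => eLpNorm_mono fun x => norm_le_pi_norm (U s x) i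

theorem tendsto_eLpNorm_of_components {l : Filter ℝ} {U : ℝ → X → Fin m → ℝ}
    (hm : ∀ i, ∀ᶠ s in l, AEStronglyMeasurable (fun x => U s x i) μ)
    (h : ∀ i, Tendsto (fun s => eLpNorm (fun x => U s x i) 2 μ) l (𝓝 0)) :
    Tendsto (fun s => eLpNorm (U s) 2 μ) l (𝓝 0) := by
  have h0 : Tendsto (fun s => ∑ i, eLpNorm (fun x => U s x i) 2 μ) l (𝓝 0) := by
    simpa using tendsto_finsetSum Finset.univ fun i _ => h i
  exact tendsto_of_tendsto_of_tendsto_of_le_of_le' tendsto_const_nhds h0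
    (Eventually.of_forall fun _ => zero_le)
    ((eventually_all.2 hm).mono fun s hs => eLpNorm_two_le_sum hs)

theorem memLp_component {F : X → Fin m → ℝ} (h : MemLp F 2 μ) (i : Fin m) :
    MemLp (fun x => F x i) 2 μ :=
  (memLp_pi_iff.1 h) i

end Components

end FirstOrderSystem

namespace FirstOrderSystem
open scoped ContDiff

/-! ### Solutions and weak identities -/

section Solution

variable {m : ℕ} {Ω : Set Space} {T : ℝ} {f : (Fin 4 → Fin m → ℝ) → SpaceTime → Fin m → ℝ}
  {A B C D : Matrix (Fin m) (Fin m) ℝ}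
  {A₁ A₂ : Space → Fin m → ℝ} {A₃ : SpaceTime → Fin m → ℝ} {Z : SpaceTime → Fin 4 → Fin m → ℝ}

theorem continuousOn_apply
    (hf : ContinuousOn (fun q : (Fin 4 → Fin m → ℝ) × SpaceTime => f q.1 q.2)
      (univ ×ˢ cylinder Ω T)) (hZ : ContinuousOn Z (cylinder Ω T)) :
    ContinuousOn (fun p => f (Z p) p) (cylinder Ω T) :=
  hf.comp (hZ.prodMk continuousOn_id) fun _ hp => ⟨mem_univ _, hp⟩

theorem memLp_mulVec {X : Type*} [MeasurableSpace X] {μ : Measure X}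
    (M : Matrix (Fin m) (Fin m) ℝ) {z : X → Fin m → ℝ} (hz : ∀ i, MemLp (fun p => z p i) 2 μ)
    (i : Fin m) : MemLp (fun p => (M *ᵥ z p) i) 2 μ := by
  simp only [Matrix.mulVec, dotProduct]
  exact memLp_finsetSum _ fun j _ => (hz j).const_mul _

theorem memLp_apply {μ : Measure SpaceTime} (hZ : ∀ k i, MemLp (fun p => Z p k i) 2 μ)
    (hψ : ∀ i, MemLp (fun p => psi f A B C D Z p i) 2 μ) (i : Fin m) :
    MemLp (fun p => f (Z p) p i) 2 μ := by
  simp only [apply_eq_psi_add (A := A) (B := B) (C := C) (D := D)]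
  exact ((((hψ i).add (memLp_mulVec A (hZ 0) i)).add (memLp_mulVec B (hZ 1) i)).add
    (memLp_mulVec C (hZ 2) i)).add (memLp_mulVec D (hZ 3) i)

theorem jet_succ (u : SpaceTime → Fin m → ℝ) (p : SpaceTime) (k : Fin 3) :
    jet u p k.succ = spaceDeriv k u p := by
  fin_cases k <;> rfl

theorem IsSolution.hasFDerivAt_component (hΩ : IsOpen Ω)
    (h : IsSolution f Ω T A₁ A₂ A₃ fun p => Z p 0)
    (hj : ∀ p ∈ cylinder Ω T, Z p = jet (fun p => Z p 0) p) {p : SpaceTime}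
    (hp : p ∈ cylinder Ω T) (i : Fin m) :
    HasFDerivAt (fun p => Z p 0 i) (gradientMap (fun k => Z p k.succ i) (f (Z p) p i)) p := by
  have hd : HasFDerivAt (fun p => Z p 0) (fderiv ℝ (fun p => Z p 0) p) p :=
    ((h.contDiffOn.contDiffAt ((isOpen_cylinder hΩ T).mem_nhds hp)).differentiableAt
      one_ne_zero).hasFDerivAt
  have hi := hasFDerivAt_pi'.1 hd i
  have e0 : f (Z p) p = timeDeriv (fun p => Z p 0) p := by
    rw [h.equation p hp, ← hj p hp]
  have ek : ∀ k : Fin 3, Z p k.succ = spaceDeriv k (fun p => Z p 0) p := fun k => by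
    rw [← jet_succ, ← hj p hp]
  refine hi.congr_fderiv ((eq_gradientMap _).trans ?_)
  simp only [e0, ek]
  rfl

theorem hasLateralTrace_of_components (h : HasPiecewiseSmoothBoundary Ω)
    (hA₃ : MemLp A₃ 2 (lateralMeasure Ω T)) {u : SpaceTime → Fin m → ℝ}
    (hu : ∀ i, ∀ x₀ ν : Space, IsOutwardNormal Ω x₀ ν → ∃ V ∈ 𝓝 x₀, MeasurableSet V ∧
      (∀ᶠ s : ℝ in 𝓝[>] 0, AEStronglyMeasurable (fun p : SpaceTime => u (p.1 - s • ν, p.2) i)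
        (lateralPart Ω T V)) ∧
      Tendsto (fun s : ℝ => eLpNorm (fun p : SpaceTime => u (p.1 - s • ν, p.2) i - A₃ p i) 2
        (lateralPart Ω T V)) (𝓝[>] 0) (𝓝 0)) : HasLateralTrace Ω T u A₃ := by
  intro x₀ ν hν
  choose V hV hVm hm ht using fun i => hu i x₀ ν hν
  have hm' : MeasurableSet (⋂ i, V i) := MeasurableSet.iInter hVm
  have hle : ∀ i, lateralPart Ω T (⋂ i, V i) ≤ lateralPart Ω T (V i) := fun i =>
    h.lateralPart_mono hm' (iInter_subset V i)
  refine ⟨⋂ i, V i, iInter_mem.2 hV, tendsto_eLpNorm_of_components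
    (μ := lateralPart Ω T (⋂ i, V i)) (fun i => ?_) fun i => ?_⟩
  · filter_upwards [hm i] with s hs
    exact (hs.mono_measure (hle i)).sub
      ((memLp_component hA₃ i).1.mono_measure (lateralPart_le h hm'))
  · exact tendsto_of_tendsto_of_tendsto_of_le_of_le tendsto_const_nhds (ht i) (fun _ => zero_le)
      fun s => eLpNorm_mono_measure _ (hle i)

theorem hasTimeTrace_of_components {W : Set SpaceTime} (hΩ : IsOpen Ω) {u : SpaceTime → Fin m → ℝ}
    (hu : ∀ i, IsSobolev (cylinder Ω T) W fun p => u p i) {g : Space → Fin m → ℝ}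
    (hg : MemLp g 2 (volume.restrict Ω)) {t₀ : ℝ} {J : Set ℝ} (hJ : ∀ᶠ t in 𝓝[J] t₀, t ∈ Ioo 0 T)
    (h : ∀ i, Tendsto (fun t : ℝ => eLpNorm (fun x => u (x, t) i - g x i) 2 (volume.restrict Ω))
      (𝓝[J] t₀) (𝓝 0)) : HasTimeTrace Ω u t₀ J g :=
  tendsto_eLpNorm_of_components (fun i => hJ.mono fun _ ht =>
    ((hu i).aestronglyMeasurable_slice hΩ ht).sub (memLp_component hg i).1) h

theorem isSolution_iff_weakIdentity (hΩ : IsOpen Ω) (hb : Bornology.IsBounded Ω)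
    (h : HasPiecewiseSmoothBoundary Ω) (hT : 0 < T)
    (hf : ContinuousOn (fun q : (Fin 4 → Fin m → ℝ) × SpaceTime => f q.1 q.2)
      (univ ×ˢ cylinder Ω T))
    (hA₁ : MemLp A₁ 2 (volume.restrict Ω)) (hA₂ : MemLp A₂ 2 (volume.restrict Ω))
    (hA₃ : MemLp A₃ 2 (lateralMeasure Ω T)) (hZ : ContinuousOn Z (cylinder Ω T))
    (hZ2 : ∀ k i, MemLp (fun p => Z p k i) 2 (volume.restrict (cylinder Ω T)))
    (hf2 : ∀ i, MemLp (fun p => f (Z p) p i) 2 (volume.restrict (cylinder Ω T))) :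
    (IsSolution f Ω T A₁ A₂ A₃ (fun p => Z p 0) ∧
        ∀ p ∈ cylinder Ω T, Z p = jet (fun p => Z p 0) p) ↔
      ∀ i, WeakIdentity (cylinder Ω T) (0, 1) (fun p => Z p 0 i) (fun p => f (Z p) p i)
          (timeBoundary Ω T (fun x => A₁ x i) fun x => A₂ x i) ∧
        ∀ k : Fin 3, WeakIdentity (cylinder Ω T) (EuclideanSpace.single k 1, 0)
          (fun p => Z p 0 i) (fun p => Z p k.succ i)
          (lateralBoundary Ω T (fun p => A₃ p i) (EuclideanSpace.single k 1)) := by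
  have hQ := isOpen_cylinder hΩ T
  have hQ' := volume_cylinder_lt_top hb T
  have hfin : IsFiniteMeasure (volume.restrict (cylinder Ω T)) := ⟨by simpa using hQ'⟩
  have hfinΩ : IsFiniteMeasure (volume.restrict Ω) := ⟨by simpa using hb.measure_lt_top⟩
  have hZc : ∀ k i, ContinuousOn (fun p => Z p k i) (cylinder Ω T) := fun k i =>
    continuousOn_pi.1 (continuousOn_pi.1 hZ k) i
  have hfc : ∀ i, ContinuousOn (fun p => f (Z p) p i) (cylinder Ω T) := fun i =>
    continuousOn_pi.1 (continuousOn_apply hf hZ) i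
  have hsob : ∀ i, (∀ p ∈ cylinder Ω T, HasFDerivAt (fun p => Z p 0 i)
      (gradientMap (fun k => Z p k.succ i) (f (Z p) p i)) p) →
      IsSobolev (cylinder Ω T) univ fun p => Z p 0 i := fun i hd =>
    isSobolev_of_hasFDerivAt hQ hd (fun k => hZc k.succ i) (hfc i) (hZ2 0 i)
      (fun k => hZ2 k.succ i) (hf2 i)
  constructor
  · rintro ⟨hs, hj⟩ i
    have hd := fun p hp => hs.hasFDerivAt_component hΩ hj (p := p) hp i
    exact weakIdentity_of_traces h hΩ hb hT (hsob i hd) hd (memLp_component hA₁ i).1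
      (memLp_component hA₂ i).1 (memLp_component hA₃ i)
      (tendsto_eLpNorm_component hs.initial i) (tendsto_eLpNorm_component hs.terminal i)
      fun x₀ ν hν => by
        obtain ⟨V, hV, ht⟩ := hs.lateral x₀ ν hν
        exact ⟨V, hV, tendsto_eLpNorm_component ht i⟩
  · intro hw
    have hd : ∀ i, ∀ p ∈ cylinder Ω T, HasFDerivAt (fun p => Z p 0 i)
        (gradientMap (fun k => Z p k.succ i) (f (Z p) p i)) p := fun i p hp =>
      hasFDerivAt_of_weakIdentity (v := fun k p => Z p k.succ i) hΩ (hZc 0 i)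
        (fun k => hZc k.succ i) (hfc i) ((hZ2 0 i).integrable one_le_two)
        (fun k => (hZ2 k.succ i).integrable one_le_two) ((hf2 i).integrable one_le_two)
        (hw i).1 (hw i).2 hp
    have htr := fun i => traces_of_weakIdentity (v := fun k p => Z p k.succ i) h hΩ hb hT
      (hsob i (hd i)) (hd i) ((memLp_component hA₁ i).integrable one_le_two)
      ((memLp_component hA₂ i).integrable one_le_two) (memLp_component hA₃ i) (hw i).1 (hw i).2
    have hd' : ∀ p ∈ cylinder Ω T, HasFDerivAt (fun p => Z p 0) (ContinuousLinearMap.pi fun i =>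
        gradientMap (fun k => Z p k.succ i) (f (Z p) p i)) p := fun p hp =>
      hasFDerivAt_pi.2 fun i => hd i p hp
    have hjet : ∀ p ∈ cylinder Ω T, Z p = jet (fun p => Z p 0) p := fun p hp => by
      funext k
      induction k using Fin.cases with
      | zero => rfl
      | succ k =>
        rw [jet_succ, spaceDeriv, (hd' p hp).fderiv]
        funext i
        exact (gradientMap_single (fun k => Z p k.succ i) (f (Z p) p i) k).symm
    refine ⟨⟨contDiffOn_pi.2 fun i => (hsob i (hd i)).contDiffOn, fun p hp => ?_,
      hasTimeTrace_of_components hΩ (fun i => hsob i (hd i)) hA₁ (Ioo_mem_nhdsGT hT)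
        fun i => (htr i).1,
      hasTimeTrace_of_components hΩ (fun i => hsob i (hd i)) hA₂ (Ioo_mem_nhdsLT hT)
        fun i => (htr i).2.1,
      hasLateralTrace_of_components h hA₃ fun i => (htr i).2.2⟩, hjet⟩
    rw [← hjet p hp, timeDeriv, (hd' p hp).fderiv]
    funext i
    exact gradientMap_time (fun k => Z p k.succ i) (f (Z p) p i)

end Solution

end FirstOrderSystem

open FirstOrderSystem in
theorem theorem3p1 (m : ℕ)
    -- the domain, the final time, and the right-hand side
    (Ω : Set Space) (hΩ_open : IsOpen Ω) (hΩ_bdd : Bornology.IsBounded Ω)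
    (hΩ : HasPiecewiseSmoothBoundary Ω) (T : ℝ) (hT : 0 < T)
    (f : (Fin 4 → Fin m → ℝ) → SpaceTime → Fin m → ℝ)
    (hf : ContinuousOn (fun q : (Fin 4 → Fin m → ℝ) × SpaceTime => f q.1 q.2)
      (univ ×ˢ cylinder Ω T))
    -- the parameter matrices, such that the inverse Fourier transform of `B₀⁻¹` exists
    (A B C D : Matrix (Fin m) (Fin m) ℝ)
    (hB₀ : ∀ i j, HasInvFourier (fun ξ => (B₀ A B C D ξ)⁻¹ i j))
    -- the data at `t = 0`, at `t = T`, and on the lateral boundary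
    (A₁ A₂ : Space → Fin m → ℝ) (A₃ : SpaceTime → Fin m → ℝ)
    (hA₁ : MemLp A₁ 2 (volume.restrict Ω)) (hA₂ : MemLp A₂ 2 (volume.restrict Ω))
    (hA₃ : MemLp A₃ 2 (lateralMeasure Ω T)) :
    -- `B₁` is invertible off the null set `C₀`, and `w₁`, `w₂` exist
    (∀ ξ, (B₁ A B C D ξ).det = (B₀ A B C D ξ).det) ∧
    volume {ξ | (B₀ A B C D ξ).det = 0} = 0 ∧
    (∀ k, HasInvFourier (w₁Symbol A B C D Ω T A₁ A₂ A₃ k)) ∧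
    (∀ k j, HasInvFourier (w₂Symbol A B C D k j)) ∧
    -- the differential equation is equivalent to the integral equation
    (∀ Z : SpaceTime → Fin 4 → Fin m → ℝ,
      ContinuousOn Z (cylinder Ω T) →
      MemLp Z 2 (volume.restrict (cylinder Ω T)) →
      MemLp (psi f A B C D Z) 2 (volume.restrict (cylinder Ω T)) →
      ((IsSolution f Ω T A₁ A₂ A₃ (fun p => Z p 0) ∧
          ∀ p ∈ cylinder Ω T, Z p = jet (fun p => Z p 0) p) ↔
        IntegralEquation f A B C D Ω T A₁ A₂ A₃ Z)) ∧
    -- if the eigenvalues of `a₂` have positive real part, `A₂` has no influence on `w₁` for `t < T`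
    ((∀ (ξ : Space), ∀ μ ∈ spectrum ℂ (a₂ A B C D ξ), 0 < μ.re) →
      ∀ (k : Fin 4 × Fin m) (φ : 𝓢(SpaceTime, ℂ)), tsupport φ ⊆ {p | p.2 < T} →
        w₁ A B C D Ω T A₁ A₂ A₃ k φ = w₁ A B C D Ω T A₁ 0 A₃ k φ) := by
  have hfinΩ : IsFiniteMeasure (volume.restrict Ω) := ⟨by simpa using hΩ_bdd.measure_lt_top⟩
  have hfinQ : IsFiniteMeasure (volume.restrict (cylinder Ω T)) :=
    ⟨by simpa using volume_cylinder_lt_top hΩ_bdd T⟩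
  have hfinL := hΩ.isFiniteMeasure T
  have h₁ : ∀ i, IntegrableOn (fun x => A₁ x i) Ω := fun i =>
    (memLp_component hA₁ i).integrable one_le_two
  have h₂ : ∀ i, IntegrableOn (fun x => A₂ x i) Ω := fun i =>
    (memLp_component hA₂ i).integrable one_le_two
  have h₃ : ∀ (k : Fin 3) i,
      Integrable (fun p => A₃ p i * outwardNormal Ω p.1 k) (lateralMeasure Ω T) := fun k i => by
    simpa [EuclideanSpace.inner_single_right] using hΩ.integrable_mul_inner hΩ_open hΩ_bdd
      ((memLp_component hA₃ i).integrable one_le_two) (EuclideanSpace.single k 1)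
  have hw₁ := hasInvFourier_w₁Symbol hB₀ h₁ h₂ h₃
  have hw₂ := hasInvFourier_w₂Symbol hB₀
  refine ⟨det_B₁ A B C D, volume_det_B₀_eq_zero A B C D, hw₁, hw₂, fun Z hZ hZ2 hψ => ?_,
    fun hspec k φ hφ => ?_⟩
  · have hZ2' : ∀ k i, MemLp (fun p => Z p k i) 2 (volume.restrict (cylinder Ω T)) := fun k i =>
      memLp_pi_iff.1 (memLp_pi_iff.1 hZ2 k) i
    have hψ' : ∀ i, MemLp (fun p => psi f A B C D Z p i) 2 (volume.restrict (cylinder Ω T)) :=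
      memLp_component hψ
    have hf2 := memLp_apply hZ2' hψ'
    have hZi : ∀ k i, IntegrableOn (fun p => Z p k i) (cylinder Ω T) := fun k i =>
      (hZ2' k i).integrable one_le_two
    have hfi : ∀ i, IntegrableOn (fun p => f (Z p) p i) (cylinder Ω T) := fun i =>
      (hf2 i).integrable one_le_two
    rw [isSolution_iff_weakIdentity hΩ_open hΩ_bdd hΩ hT hf hA₁ hA₂ hA₃ hZ hZ2' hf2,
      integralEquation_iff_rows hw₁ hw₂ hZi fun j => (hψ' j).integrable one_le_two, forall_and]
    refine and_congr (forall_congr' fun i => weakIdentity_time_iff hΩ_open hΩ_bdd hT (hZi 0 i)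
      (hfi i) i (h₁ i) (h₂ i)) ?_
    rw [forall_comm]
    exact forall_congr' fun k => forall_congr' fun i => weakIdentity_lateral_iff hΩ_open hΩ_bdd hΩ
      (hZi 0 i) (hZi k.succ i) i k (h₃ k i)
  · exact w₁_eq_of_spectrum hspec (hw₁ k)
      (hasInvFourier_w₁Symbol hB₀ h₁ (fun _ => integrable_zero _ _ _) h₃ k) h₁ h₂ φ
      fun x t ht => image_eq_zero_of_notMem_tsupport fun h => absurd (hφ h) (not_lt.2 ht)
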